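/- For integers $s_1,s_2$, Dirichlet characters $\chi_1,\chi_2$ modulo $r_1,r_2\ge 1$ and $\mathrm{Im}\,\tau>0$ put $$\Xi_{s_1,s_2}(\chi_1,\chi_2;\tau)=\sum_{n_1,n_2\ge1}\frac{\chi_1(n_1)}{n_1^{s_1}}\frac{\chi_2(n_2)}{n_2^{s_2}}\,e^{2\pi i\tau n_1n_2}.$$ For primitive $\chi$ modulo $r$ let $\chi(-1)=(-1)^{\kappa}$, $\kappa\in\{0,1\}$, and $\epsilon(\chi)=\frac{1}{i^{\kappa}\sqrt r}\sum_{n=1}^{r}\chi(n)e^{2\pi i n/r}$. Write $(s)_n=s(s+1)\cdots(s+n-1)$, $\gamma$ for Euler's constant, $\psi=\Gamma'/\Gamma$, $\log$ for the principal branch, $L(\chi,\cdot)$ for the continued $L$-function and $L'$ for its derivative. Let $\chi_1,\chi_2$ be primitive modulo $r_1,r_2$ with parities $\kappa_1,\kappa_2$, and let $s_1,s_2\in\mathbb Z$ with $s_1+s_2\equiv\kappa_1+\kappa_2+1 \pmod 2$. **Perturbative part.** Let $$\Xi^{\rm Pert}_{s_1,s_2}(\chi_1,\chi_2;\tau)=A_{s_1,s_2}(\chi_1,\chi_2;\tau)+A_{s_2,s_1}(\chi_2,\chi_1;\tau)+\sum_{k=0}^{\infty}P_k(\tau),\qquad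 P_k(\tau)=\frac{(2\pi i\tau)^k}{k!}L(\chi_1,s_1-k)L(\chi_2,s_2-k),$$ where $A_{s_1,s_2}(\chi_1,\chi_2;\tau)=(-2\pi i\tau)^{s_2-1}\Gamma(1-s_2)L(\chi_1,s_1+1-s_2)$ if $r_2=1$ and $s_2\le0$, and $0$ otherwise; and where, if $r_2=1$ and $s_2=k+1\ge1$, one instead sets $$P_k(\tau)=\frac{(2\pi i\tau)^k}{k!}\Bigl[L'(\chi_1,s_1-k)+\bigl(\gamma+\psi(k+1)-\log(-2\pi i\tau)\bigr)L(\chi_1,s_1-k)\Bigr],$$ and symmetrically if $r_1=1$ and $s_1=k+1\ge1$. Then $P_k=0$ for all $k>\max(s_1,s_2)$, so that $\Xi^{\rm Pert}=P(\tau)+Q(\tau)\log(-2\pi i\tau)$ with Laurent polynomials $P,Q$; $Q=0$ if $r_1,r_2\neq1$, and also if $s_1\le0$ or $s_2\le0$ and the characters are not both trivial. **Fricke identity.** Let $C=r_1^{\frac12-s_1}r_2^{\frac12-s_2}\epsilon(\chi_1)\epsilon(\chi_2)i^{\kappa_1+\kappa_2}$, $\tau'=-1/(r_1r_2\tau)$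 and $$T_n(\tau)=C\,\frac{(s_1)_n(s_2)_n}{n!}\,\frac{(r_1r_2\tau)^{s_1+s_2+n-1}}{(-2\pi i)^n}\,\Xi_{s_1+n,s_2+n}(\bar\chi_2,\bar\chi_1;\tau').$$ The double series for $\Xi$ converges absolutely, and $$\Xi_{s_1,s_2}(\chi_1,\chi_2;\tau)=\Xi^{\rm Pert}_{s_1,s_2}(\chi_1,\chi_2;\tau)+\sum_{n\ge0}T_n(\tau)\qquad(\mathrm{Im}\,\tau>0)$$ in the following sense. 1. If $s_1\le0$ (resp. $s_2\le0$), then the sum terminates at $n=|s_1|$ (resp. $n=|s_2|$) and the identity is exact. 2. If $s_1,s_2\ge1$, then the sum over $n$ diverges and is replaced by its Borel resummation: exactly $$\Xi_{s_1,s_2}=\Xi^{\rm Pert}_{s_1,s_2}+C(r_1r_2\tau)^{s_1+s_2-1}\sum_{n_1,n_2\ge1}\frac{\bar\chi_2(n_1)}{n_1^{s_1}}\frac{\bar\chi_1(n_2)}{n_2^{s_2}}\,e^{-z}\,B(z),\qquad z=\frac{2\pi i\,n_1n_2}{r_1r_2\tau},$$ $$B(z)=z^{s_1+s_2}\int_0^\infty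 e^{-tz}\,\frac{t^{s_1+s_2-1}}{\Gamma(s_1+s_2)}\,{}_2F_1(s_1,s_2;s_1+s_2;-t)\,dt ,$$ where the double series converges absolutely and so does the integral for $\mathrm{Re}\,z>0$. 3. In all cases, for every $N\ge0$ and $\tau=iy$, $y\to0^+$, $$\Xi_{s_1,s_2}-\Xi^{\rm Pert}_{s_1,s_2}-\sum_{n<N}T_n=O\bigl(y^{s_1+s_2+N-1}e^{-2\pi/(r_1r_2y)}\bigr).$$ **Upper-triangular action.** Let $m\ge1$, $m\equiv\kappa_1+\kappa_2\pmod 2$. The vector $(\Xi_{a,a-m+1}(\chi_1,\chi_2;\tau))_{1\le a\le m-1}$ equals $(\Xi^{\rm Pert}_{a,a-m+1}(\chi_1,\chi_2;\tau))_a$ plus the upper-triangular matrix whose $(a,b)$ entry, $a\le b$, is $$r_1^{\frac12-a}r_2^{m-a-\frac12}\epsilon(\chi_1)\epsilon(\chi_2)i^{\kappa_1+\kappa_2}\,\frac{(a)_{b-a}(a-m+1)_{b-a}}{(b-a)!}\,\frac{(r_1r_2\tau)^{a+b-m}}{(-2\pi i)^{b-a}},$$ applied to $(\Xi_{b,b-m+1}(\bar\chi_2,\bar\chi_1;\tau'))_{1\le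 b\le m-1}$. In particular, if $\kappa_1+\kappa_2=1$, then $$\begin{pmatrix}\Xi_{1,-1}(\chi_1,\chi_2;\tau)\\ \Xi_{2,0}(\chi_1,\chi_2;\tau)\end{pmatrix}=\begin{pmatrix}\Xi^{\rm Pert}_{1,-1}(\chi_1,\chi_2;\tau)\\ \Xi^{\rm Pert}_{2,0}(\chi_1,\chi_2;\tau)\end{pmatrix}+i\,\epsilon(\chi_1)\epsilon(\chi_2)r_1^{-\frac32}r_2^{\frac12}\begin{pmatrix}\tau^{-1}&\frac{r_1r_2}{2\pi i}\\0&r_1r_2\tau\end{pmatrix}\begin{pmatrix}\Xi_{1,-1}(\bar\chi_2,\bar\chi_1;\tau')\\ \Xi_{2,0}(\bar\chi_2,\bar\chi_1;\tau')\end{pmatrix}.$$ **One nontrivial character.** Let $\chi$ be primitive modulo $r>1$ with parity $\kappa$, let $1$ be the trivial character modulo $1$, and put $\mathcal L_s(\chi;\tau)=\Xi_{s,0}(\chi,1;\tau)$, $\tilde{\mathcal L}_s(\chi;\tau)=\Xi_{0,s}(\chi,1;\tau)$. For every $m\ge1$ with $m\equiv\kappa\pmod 2$, $$\mathcal L_{m-1}(\chi;\tau)=-\frac{L(\chi,m)}{2\pi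 i\tau}+\sum_{k=0}^{m+\kappa-2}\frac{(2\pi i\tau)^k}{k!}\zeta(-k)L(\chi,m-k-1)+i^\kappa\frac{\epsilon(\chi)}{\sqrt r}\tau^{m-2}\tilde{\mathcal L}_{m-1}\Bigl(\bar\chi;\frac{-1}{r\tau}\Bigr),$$ $$\tilde{\mathcal L}_{m-1}(\chi;\tau)=R_m(\tau)+\sum_{\substack{k=0\\k\ne m-2}}^{m+\kappa-1}\frac{(2\pi i\tau)^k}{k!}\zeta(m-k-1)L(\chi,-k)+i^\kappa\epsilon(\chi)\sqrt r\,(r\tau)^{m-2}\mathcal L_{m-1}\Bigl(\bar\chi;\frac{-1}{r\tau}\Bigr),$$ where $R_1(\tau)=-\frac{L(\chi,1)}{2\pi i\tau}$ and, for $m\ge2$, $$R_m(\tau)=\frac{(2\pi i\tau)^{m-2}}{(m-2)!}\Bigl[L'(\chi,2-m)+\bigl(\gamma+\psi(m-1)-\log(-2\pi i\tau)\bigr)L(\chi,2-m)\Bigr].$$ -/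

import Mathlib

open Complex Filter Topology Asymptotics MeasureTheory
open scoped Real Nat Matrix

namespace TwistedLambert

noncomputable section

open Classical in
/-- The parity `κ ∈ {0, 1}` of a Dirichlet character, `χ (-1) = (-1) ^ κ`. -/
def parity {r : ℕ} (χ : DirichletCharacter ℂ r) : ℕ := if χ.Even then 0 else 1

/-- The `(n₁, n₂)` term of the double series `Ξ`, with `q = exp (2 π i τ)`. -/
def xiTerm {r₁ r₂ : ℕ} (s₁ s₂ : ℤ) (χ₁ : DirichletCharacter ℂ r₁)
    (χ₂ : DirichletCharacter ℂ r₂) (τ : ℂ) (n : ℕ+ × ℕ+) : ℂ :=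
  χ₁ ((n.1 : ℕ) : ZMod r₁) / (n.1 : ℂ) ^ s₁ * (χ₂ ((n.2 : ℕ) : ZMod r₂) / (n.2 : ℂ) ^ s₂) *
    cexp (2 * π * I * τ * ((n.1 : ℂ) * (n.2 : ℂ)))

/-- `Ξ_{s₁,s₂}(χ₁, χ₂; τ) = ∑_{n₁,n₂ ≥ 1} χ₁(n₁) n₁^{-s₁} χ₂(n₂) n₂^{-s₂} q^{n₁ n₂}`. -/
def Xi {r₁ r₂ : ℕ} (s₁ s₂ : ℤ) (χ₁ : DirichletCharacter ℂ r₁)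
    (χ₂ : DirichletCharacter ℂ r₂) (τ : ℂ) : ℂ :=
  ∑' n : ℕ+ × ℕ+, xiTerm s₁ s₂ χ₁ χ₂ τ n

/-- The Lambert series `ℒ_s(χ; τ) = Ξ_{s,0}(χ, 1; τ)`. -/
def lambert {r : ℕ} (s : ℤ) (χ : DirichletCharacter ℂ r) (τ : ℂ) : ℂ :=
  Xi s 0 χ (1 : DirichletCharacter ℂ 1) τ

/-- The dual Lambert series `ℒ̃_s(χ; τ) = Ξ_{0,s}(χ, 1; τ)`. -/
def lambertTilde {r : ℕ} (s : ℤ) (χ : DirichletCharacter ℂ r) (τ : ℂ) : ℂ :=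
  Xi 0 s χ (1 : DirichletCharacter ℂ 1) τ

/-- The Fricke involution `τ ↦ -1 / (r τ)` of level `r`. -/
def fricke (r : ℕ) (τ : ℂ) : ℂ := -1 / ((r : ℂ) * τ)

/-! ### The perturbative expansion -/

/-- The residue at the double pole `t = -k` of `Γ(t) L(χ, t + s) ζ(t + k + 1) (-2 π i τ)^{-t}`.
It replaces the ordinary `k`-th perturbative term when the other character is trivial and its
parameter equals `k + 1`. -/
def doublePoleTerm {r : ℕ} [NeZero r] (s : ℤ) (χ : DirichletCharacter ℂ r) (τ : ℂ) (k : ℕ) : ℂ :=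
  (2 * π * I * τ) ^ k / (k ! : ℂ) *
    (deriv χ.LFunction ((s - k : ℤ) : ℂ) +
      ((Real.eulerMascheroniConstant : ℂ) + digamma ((k : ℂ) + 1) - log (-2 * π * I * τ)) *
        χ.LFunction ((s - k : ℤ) : ℂ))

/-- The `k`-th term of the perturbative expansion of `Ξ_{s₁,s₂}(χ₁, χ₂; τ)`, for primitive
characters (so that `χᵢ` is trivial iff `rᵢ = 1`). -/
def pertTerm {r₁ r₂ : ℕ} [NeZero r₁] [NeZero r₂] (s₁ s₂ : ℤ) (χ₁ : DirichletCharacter ℂ r₁)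
    (χ₂ : DirichletCharacter ℂ r₂) (τ : ℂ) (k : ℕ) : ℂ :=
  if r₂ = 1 ∧ s₂ = k + 1 then doublePoleTerm s₁ χ₁ τ k
  else if r₁ = 1 ∧ s₁ = k + 1 then doublePoleTerm s₂ χ₂ τ k
  else (2 * π * I * τ) ^ k / (k ! : ℂ) *
    (χ₁.LFunction ((s₁ - k : ℤ) : ℂ) * χ₂.LFunction ((s₂ - k : ℤ) : ℂ))

/-- The isolated monomial `(-2 π i τ)^{s₂-1} Γ(1 - s₂) L(χ₁, s₁ + 1 - s₂)`, which is present when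
`χ₂` is the trivial character. For `s₂ ≥ 1` it has merged with the term `k = s₂ - 1` into
`doublePoleTerm`. -/
def isolatedTerm {r₁ : ℕ} [NeZero r₁] (r₂ : ℕ) (s₁ s₂ : ℤ) (χ₁ : DirichletCharacter ℂ r₁)
    (τ : ℂ) : ℂ :=
  if r₂ = 1 ∧ s₂ ≤ 0 then
    (-2 * π * I * τ) ^ (s₂ - 1) * Complex.Gamma (1 - s₂) * χ₁.LFunction ((s₁ + 1 - s₂ : ℤ) : ℂ)
  else 0

/-- From this index on, all terms of the perturbative expansion vanish
if `s₁ + s₂ ≡ κ₁ + κ₂ + 1` modulo `2`. -/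
def pertLength (s₁ s₂ : ℤ) : ℕ := (max s₁ s₂ + 1).toNat

/-- The terminating perturbative expansion `Ξ^Pert_{s₁,s₂}(χ₁, χ₂; τ)`. -/
def XiPert {r₁ r₂ : ℕ} [NeZero r₁] [NeZero r₂] (s₁ s₂ : ℤ) (χ₁ : DirichletCharacter ℂ r₁)
    (χ₂ : DirichletCharacter ℂ r₂) (τ : ℂ) : ℂ :=
  isolatedTerm r₂ s₁ s₂ χ₁ τ + isolatedTerm r₁ s₂ s₁ χ₂ τ +
    ∑ k ∈ Finset.range (pertLength s₁ s₂), pertTerm s₁ s₂ χ₁ χ₂ τ k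

/-! ### The non-perturbative terms -/

/-- `r₁^{1/2-s₁} r₂^{1/2-s₂} ε(χ₁) ε(χ₂) i^{κ₁+κ₂}`, where
`ε(χ) = (∑_{n mod r} χ(n) e^{2 π i n / r}) / (i^κ √r)`. -/
def frickeConst {r₁ r₂ : ℕ} [NeZero r₁] [NeZero r₂] (s₁ s₂ : ℤ) (χ₁ : DirichletCharacter ℂ r₁)
    (χ₂ : DirichletCharacter ℂ r₂) : ℂ :=
  (r₁ : ℂ) ^ ((1 : ℂ) / 2 - s₁) * (r₂ : ℂ) ^ ((1 : ℂ) / 2 - s₂) *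
    χ₁.rootNumber * χ₂.rootNumber * I ^ (parity χ₁ + parity χ₂)

/-- The coefficient of `Ξ_{s₁+n,s₂+n}(χ̄₂, χ̄₁; -1/(r₁ r₂ τ))` in the transseries. -/
def frickeCoeff {r₁ r₂ : ℕ} [NeZero r₁] [NeZero r₂] (s₁ s₂ : ℤ) (χ₁ : DirichletCharacter ℂ r₁)
    (χ₂ : DirichletCharacter ℂ r₂) (τ : ℂ) (n : ℕ) : ℂ :=
  frickeConst s₁ s₂ χ₁ χ₂ *
    ((ascPochhammer ℂ n).eval (s₁ : ℂ) * (ascPochhammer ℂ n).eval (s₂ : ℂ) / (n ! : ℂ)) *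
    (((r₁ : ℂ) * r₂ * τ) ^ (s₁ + s₂ + n - 1) / (-2 * π * I) ^ n)

/-- The `n`-th non-perturbative term of the transseries. -/
def npTerm {r₁ r₂ : ℕ} [NeZero r₁] [NeZero r₂] (s₁ s₂ : ℤ) (χ₁ : DirichletCharacter ℂ r₁)
    (χ₂ : DirichletCharacter ℂ r₂) (τ : ℂ) (n : ℕ) : ℂ :=
  frickeCoeff s₁ s₂ χ₁ χ₂ τ n *
    Xi (s₁ + n) (s₂ + n) (star χ₂) (star χ₁) (fricke (r₁ * r₂) τ)

/-- Gauss's hypergeometric function `₂F₁(a, b; c; x)` for `0 < b < c` and real `x < 1`, given by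
Euler's integral (the analytic continuation of the Gauss series to `x ≤ -1`). -/
def hyp2F1 (a b c x : ℝ) : ℝ :=
  Real.Gamma c / (Real.Gamma b * Real.Gamma (c - b)) *
    ∫ u in (0 : ℝ)..1, u ^ (b - 1) * (1 - u) ^ (c - b - 1) * (1 - x * u) ^ (-a)

/-- The integrand of the Laplace integral in `borelSum`. -/
def borelIntegrand (s₁ s₂ : ℤ) (z : ℂ) (t : ℝ) : ℂ :=
  cexp (-(t * z)) *
    ((t ^ (s₁ + s₂ - 1) / Real.Gamma (s₁ + s₂) * hyp2F1 s₁ s₂ (s₁ + s₂) (-t) : ℝ) : ℂ)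

/-- The Borel sum (along the positive real axis) of the formal series
`∑ₙ (s₁)ₙ (s₂)ₙ / n! (-z)^{-n}`, for positive `s₁`, `s₂`: write it as
`z^{s₁+s₂} ∑ₙ (-1)ⁿ (s₁)ₙ (s₂)ₙ / n! z^{-(s₁+s₂+n)}`, replace `z^{-a}` by `t^{a-1} / Γ(a)`, which
gives `t^{s₁+s₂-1} / Γ(s₁+s₂) · ₂F₁(s₁, s₂; s₁+s₂; -t)`, and take the Laplace transform. -/
def borelSum (s₁ s₂ : ℤ) (z : ℂ) : ℂ :=
  z ^ (s₁ + s₂) * ∫ t in Set.Ioi (0 : ℝ), borelIntegrand s₁ s₂ z t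

/-- The `(n₁, n₂)` term of the resummed non-perturbative part. The variable
`z = 2 π i n₁ n₂ / (r₁ r₂ τ)` satisfies `exp (-z) = exp (2 π i n₁ n₂ τ')` with
`τ' = -1 / (r₁ r₂ τ)`. -/
def npResummedTerm {r₁ r₂ : ℕ} [NeZero r₁] [NeZero r₂] (s₁ s₂ : ℤ)
    (χ₁ : DirichletCharacter ℂ r₁) (χ₂ : DirichletCharacter ℂ r₂) (τ : ℂ) (n : ℕ+ × ℕ+) : ℂ :=
  frickeConst s₁ s₂ χ₁ χ₂ * ((r₁ : ℂ) * r₂ * τ) ^ (s₁ + s₂ - 1) *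
    (xiTerm s₁ s₂ (star χ₂) (star χ₁) (fricke (r₁ * r₂) τ) n *
      borelSum s₁ s₂ (2 * π * I * ((n.1 : ℂ) * (n.2 : ℂ)) / ((r₁ : ℂ) * r₂ * τ)))

/-- For fixed `m`, the matrix by which the vector of the `Ξ_{a,a-m+1}`, `1 ≤ a ≤ m - 1`, transforms
under the Fricke involution. (The index `a : Fin (m - 1)` stands for `s₁ = a + 1`.) -/
def frickeMatrix {r₁ r₂ : ℕ} [NeZero r₁] [NeZero r₂] (m : ℕ) (χ₁ : DirichletCharacter ℂ r₁)
    (χ₂ : DirichletCharacter ℂ r₂) (τ : ℂ) : Matrix (Fin (m - 1)) (Fin (m - 1)) ℂ :=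
  Matrix.of fun a b =>
    if a ≤ b then frickeCoeff ((a : ℤ) + 1) ((a : ℤ) + 2 - m) χ₁ χ₂ τ ((b : ℕ) - (a : ℕ)) else 0

end

end TwistedLambert

open TwistedLambert

namespace TwistedLambert

/-! ### Shifting the contour of an inverse Mellin transform -/

section Contour

/-! Put F(t) = Γ(t) (2π)^{-t} L(χ₁, s₁+t) L(χ₂, s₂+t) (`mellinXi`). Integrating the double series
termwise, F is the Mellin transform of y ↦ Ξ(iy) on lines far to the right. The functional equations
of the two L-functions introduce two trigonometric factors. The parity condition makes their product
a multiple of sin πt (`trig_product`), and the reflection formula merges this sine with Γ(t) into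
1/Γ(1-t). With v = 1-s₁-s₂-t this gives (`mellinXi_functional_equation`) F(t) = const ·
Γ(v+s₁)Γ(v+s₂)/Γ(v+s₁+s₂) · (2π/(r₁r₂))^{-v} L(χ̄₂, s₁+v) L(χ̄₁, s₂+v). Let B be such that
e^{-x}B(x) has this Gamma quotient as Mellin transform (`IsResummation`). Then on lines far to the
left F is the transform of the dual series in which every exponential e^{-z} carries the factor B(z)
(`npSum`).

Two functions sharing a meromorphic transform on two different lines differ by the residues of F(t)
y^{-t} in between (`eq_add_residues_of_mellin`). These residues add up to the perturbative part: the
poles of Γ at -k give the P_k, a pole of ζ at a positive integer gives an isolated monomial, and a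
collision of the two gives a double pole and a logarithm. This proves the identity on the imaginary
axis, and the identity theorem extends it (`Xi_eq_XiPert_add_npSum`). Contours around poles are
avoided: the principal parts are subtracted as explicit Mellin transforms of truncated powers, and
the holomorphic remainder decays in the strip by Phragmén–Lindelöf.

It remains to find B. If s₁ or s₂ is nonpositive, the terminating sum of (s₁)ₙ(s₂)ₙ/n! (-z)^{-n}
works by Chu–Vandermonde (`isResummation_asymSum`). If a = s₁ and b = s₂ are positive, z^b/Γ(b) ∫
e^{-tz} t^{b-1}(1+t)^{-a} dt works by Euler's beta integral (`isResummation_laplaceResum`). It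
equals the Borel sum because the hypergeometric Borel integrand is the convolution of that density
with t^{a-1} (`borelSum_eq_laplaceResum`). Taylor expansion of (1+t)^{-a} yields the asymptotics.
The shape of the perturbative part comes from the trivial zeros of L-functions, and the other
statements are specialisations. -/

lemma verticalIntegrable_of_bound {H : ℂ → ℂ} {σ C : ℝ}
    (hd : ∀ t : ℂ, t.re = σ → ContinuousAt H t)
    (hC : ∀ t : ℂ, t.re = σ → 1 ≤ |t.im| → ‖H t‖ ≤ C / t.im ^ 2) :
    VerticalIntegrable H σ := by
  have hcont : Continuous fun y : ℝ => H (σ + y * I) := by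
    rw [continuous_iff_continuousAt]
    intro y
    exact ContinuousAt.comp (f := fun y : ℝ => (σ + y * I : ℂ)) (hd _ (by simp)) (by fun_prop)
  obtain ⟨D, hD⟩ := (isCompact_Icc (a := (-1 : ℝ)) (b := 1)).exists_bound_of_continuousOn
    hcont.continuousOn
  have hC0 : 0 ≤ C := by
    have := (norm_nonneg _).trans (hC (σ + (1 : ℝ) * I) (by simp) (by simp))
    simpa using this
  have hD0 : 0 ≤ D := (norm_nonneg _).trans (hD 0 (by simp))
  refine ((integrable_inv_one_add_sq).const_mul (2 * (C + D))).mono'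
    hcont.aestronglyMeasurable (ae_of_all _ fun y => ?_)
  rw [← div_eq_mul_inv, le_div_iff₀ (by positivity)]
  rcases le_total 1 |y| with h | h
  · have h1 := hC (σ + y * I) (by simp) (by simpa using h)
    have hy2 : 1 ≤ y ^ 2 := by rw [← sq_abs]; nlinarith
    simp only [add_im, ofReal_im, mul_im, ofReal_re, I_im, mul_one, I_re, mul_zero, add_zero,
      zero_add] at h1
    rw [le_div_iff₀ (by linarith)] at h1
    nlinarith [norm_nonneg (H (σ + y * I))]
  · have h1 := hD y (abs_le.1 h)
    have hy2 : y ^ 2 ≤ 1 := by rw [← sq_abs]; nlinarith [abs_nonneg y]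
    nlinarith [norm_nonneg (H (σ + y * I))]

lemma norm_ofReal_cpow_neg_le {a b y : ℝ} (hy : 0 < y) {t : ℂ} (ha : a ≤ t.re) (hb : t.re ≤ b) :
    ‖(y : ℂ) ^ (-t)‖ ≤ y ^ (-a) + y ^ (-b) := by
  rw [norm_cpow_eq_rpow_re_of_pos hy, neg_re]
  rcases le_total 1 y with h | h
  · have := Real.rpow_le_rpow_of_exponent_le h (neg_le_neg ha)
    have := Real.rpow_nonneg hy.le (-b)
    linarith
  · have := Real.rpow_le_rpow_of_exponent_ge hy h (neg_le_neg hb)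
    have := Real.rpow_nonneg hy.le (-a)
    linarith

/-- The line of integration of an inverse Mellin transform can be moved through a strip in which
the integrand is holomorphic and decays quadratically. -/
lemma mellinInv_eq_mellinInv_of_strip {H : ℂ → ℂ} {a b C : ℝ} (hab : a ≤ b)
    (hd : ∀ t : ℂ, a ≤ t.re → t.re ≤ b → DifferentiableAt ℂ H t)
    (hC : ∀ t : ℂ, a ≤ t.re → t.re ≤ b → 1 ≤ |t.im| → ‖H t‖ ≤ C / t.im ^ 2)
    {y : ℝ} (hy : 0 < y) : mellinInv a H y = mellinInv b H y := by
  set G : ℂ → ℂ := fun t => (y : ℂ) ^ (-t) * H t with hG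
  set D : ℝ := y ^ (-a) + y ^ (-b) with hD
  have hD0 : 0 ≤ D := by positivity
  have hGd : ∀ t : ℂ, a ≤ t.re → t.re ≤ b → DifferentiableAt ℂ G t := fun t h1 h2 => by
    refine DifferentiableAt.mul ?_ (hd t h1 h2)
    exact (differentiableAt_id.neg).const_cpow (Or.inl (by exact_mod_cast hy.ne'))
  have hGC : ∀ t : ℂ, a ≤ t.re → t.re ≤ b → 1 ≤ |t.im| → ‖G t‖ ≤ D * C / t.im ^ 2 := by
    intro t h1 h2 h3
    rw [hG, norm_mul, mul_div_assoc]
    exact mul_le_mul (norm_ofReal_cpow_neg_le hy h1 h2) (hC t h1 h2 h3) (norm_nonneg _) hD0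
  have hint : ∀ σ : ℝ, a ≤ σ → σ ≤ b → Integrable fun v : ℝ => G (σ + v * I) := fun σ h1 h2 =>
    verticalIntegrable_of_bound (fun t ht => (hGd t (by rw [ht]; exact h1)
      (by rw [ht]; exact h2)).continuousAt)
      (fun t ht => hGC t (by rw [ht]; exact h1) (by rw [ht]; exact h2))
  have hlim : ∀ σ : ℝ, a ≤ σ → σ ≤ b → Tendsto (fun T : ℝ => ∫ v in (-T)..T, G (σ + v * I)) atTop
      (𝓝 (∫ v : ℝ, G (σ + v * I))) := fun σ h1 h2 =>
    intervalIntegral_tendsto_integral (hint σ h1 h2) tendsto_neg_atTop_atBot tendsto_id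
  -- The sign e = ±1 treats the top and bottom sides together; quadratic decay makes them O(T⁻²).
  have hhor : ∀ e : ℝ, |e| = 1 →
      Tendsto (fun T : ℝ => ∫ x in a..b, G (x + (e * T : ℝ) * I)) atTop (𝓝 0) := by
    intro e he
    have hb : ∀ᶠ T : ℝ in atTop, ‖∫ x in a..b, G (x + (e * T : ℝ) * I)‖
        ≤ D * C * |b - a| * (T⁻¹) ^ 2 := by
      filter_upwards [eventually_ge_atTop 1] with T hT
      have : D * C * |b - a| * (T⁻¹) ^ 2 = D * C / (e * T) ^ 2 * |b - a| := by
        have : e ^ 2 = 1 := by rw [← sq_abs, he]; norm_num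
        rw [mul_pow, this, one_mul, inv_pow]
        ring
      rw [this]
      refine intervalIntegral.norm_integral_le_of_norm_le_const fun x hx => ?_
      rw [Set.uIoc_of_le hab] at hx
      have := hGC (x + (e * T : ℝ) * I) (by simpa using hx.1.le) (by simpa using hx.2)
        (by simpa [abs_mul, he] using hT.trans (le_abs_self T))
      simpa using this
    refine squeeze_zero_norm' hb ?_
    have : Tendsto (fun T : ℝ => D * C * |b - a| * (T⁻¹) ^ 2) atTop
      (𝓝 (D * C * |b - a| * 0 ^ 2)) := (tendsto_inv_atTop_zero.pow 2).const_mul _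
    simpa using this
  have hrect : ∀ T : ℝ, (∫ x in a..b, G (x + ((-1) * T : ℝ) * I)) -
      (∫ x in a..b, G (x + (1 * T : ℝ) * I)) + I * (∫ v in (-T)..T, G (b + v * I)) -
      I * (∫ v in (-T)..T, G (a + v * I)) = 0 := by
    intro T
    have := integral_boundary_rect_eq_zero_of_differentiableOn G (a + (-T : ℝ) * I)
      (b + (T : ℝ) * I) (fun t ht => by
        have h1 := (mem_reProdIm.1 ht).1
        simp only [add_re, ofReal_re, mul_re, I_re, mul_zero, ofReal_im, I_im, mul_one, sub_self,
          add_zero, Set.uIcc_of_le hab] at h1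
        exact (hGd t h1.1 h1.2).differentiableWithinAt)
    simpa using this
  have hfin := (((hhor (-1) (by simp)).sub (hhor 1 (by simp))).add
    ((hlim b hab le_rfl).const_mul I)).sub ((hlim a le_rfl hab).const_mul I)
  have h0 := tendsto_nhds_unique (hfin.congr hrect) tendsto_const_nhds
  have h1 : ∫ v : ℝ, G (a + v * I) = ∫ v : ℝ, G (b + v * I) := by
    have h2 : I * ((∫ v : ℝ, G (b + v * I)) - ∫ v : ℝ, G (a + v * I)) = 0 := by
      rw [← h0]; ring
    have := (mul_eq_zero.1 h2).resolve_left I_ne_zero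
    exact (sub_eq_zero.1 this).symm
  simp only [mellinInv, smul_eq_mul]
  rw [show (∫ v : ℝ, (y : ℂ) ^ (-((a : ℂ) + v * I)) * H (a + v * I)) = ∫ v : ℝ, G (a + v * I)
    from rfl, h1]

/-- Quadratic decay on the edges of a strip propagates to the interior, given exponential growth. -/
lemma exists_quadratic_decay_of_edges {H : ℂ → ℂ} {a b B c C : ℝ} (hab : a < b)
    (hd : ∀ t : ℂ, a ≤ t.re → t.re ≤ b → DifferentiableAt ℂ H t)
    (hgrowth : ∀ t : ℂ, a ≤ t.re → t.re ≤ b → 1 ≤ |t.im| → ‖H t‖ ≤ B * Real.exp (c * |t.im|))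
    (ha : ∀ t : ℂ, t.re = a → ‖H t‖ ≤ C / (1 + t.im ^ 2))
    (hb : ∀ t : ℂ, t.re = b → ‖H t‖ ≤ C / (1 + t.im ^ 2)) :
    ∃ C' : ℝ, ∀ t : ℂ, a ≤ t.re → t.re ≤ b → 1 ≤ |t.im| → ‖H t‖ ≤ C' / t.im ^ 2 := by
  set D : ℝ := 1 + (b - a) ^ 2 with hD
  have hC0 : 0 ≤ C := by simpa using (norm_nonneg _).trans (ha a (by simp))
  have hn : ∀ t : ℂ, ‖(t - a) ^ 2‖ = (t.re - a) ^ 2 + t.im ^ 2 := fun t => by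
    rw [norm_pow, ← normSq_eq_norm_sq, normSq_apply]; simp; ring
  have hn' : ∀ t : ℂ, a ≤ t.re → t.re ≤ b → ‖(t - a) ^ 2‖ ≤ D * (1 + t.im ^ 2) := by
    intro t h1 h2
    rw [hn]
    nlinarith [sq_nonneg t.im, sq_nonneg (b - a),
      mul_nonneg (sq_nonneg t.im) (sq_nonneg (b - a)), pow_le_pow_left₀ (sub_nonneg.2 h1)
        (sub_le_sub_right h2 a) 2]
  -- Multiplication by (t - a)², of size at most D(1 + im²) in the strip, turns quadratic decay on
  -- the edges into boundedness, which is what Phragmén–Lindelöf propagates.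
  set f : ℂ → ℂ := fun t => H t * (t - a) ^ 2 with hf
  have hedge : ∀ t : ℂ, a ≤ t.re → t.re ≤ b → ‖H t‖ ≤ C / (1 + t.im ^ 2) → ‖f t‖ ≤ C * D := by
    intro t h1 h2 h3
    have hpos : 0 < 1 + t.im ^ 2 := by positivity
    calc ‖f t‖ = ‖H t‖ * ‖(t - a) ^ 2‖ := norm_mul _ _
      _ ≤ C / (1 + t.im ^ 2) * (D * (1 + t.im ^ 2)) :=
        mul_le_mul h3 (hn' t h1 h2) (norm_nonneg _) (by positivity)
      _ = C * D := by field_simp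
  have hdiff : ∀ t : ℂ, a ≤ t.re → t.re ≤ b → DifferentiableAt ℂ f t := fun t h1 h2 =>
    (hd t h1 h2).mul (by fun_prop)
  have hcl : closure (re ⁻¹' Set.Ioo a b) ⊆ re ⁻¹' Set.Icc a b :=
    closure_minimal (Set.preimage_mono Set.Ioo_subset_Icc_self)
      (isClosed_Icc.preimage continuous_re)
  refine ⟨C * D, fun t h1 h2 h3 => ?_⟩
  have key : ‖f t‖ ≤ C * D := by
    refine PhragmenLindelof.vertical_strip (a := a) (b := b) ?_ ?_ ?_ ?_ h1 h2
    · exact DifferentiableOn.diffContOnCl fun t ht =>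
        (hdiff t (hcl ht).1 (hcl ht).2).differentiableWithinAt
    · have hpos : 0 < π / (b - a) := div_pos Real.pi_pos (sub_pos.2 hab)
      -- Any rate below the critical π/(b - a) is allowed; half of it is taken. The 2 in |c| + 2
      -- pays for the factor (t - a)², through 1 + v² ≤ e^{2v}.
      refine ⟨π / (b - a) / 2, by linarith, (|c| + 2) / (π / (b - a) / 2), ?_⟩
      refine IsBigO.of_bound (|B| * D) ?_
      have hev : ∀ᶠ z : ℂ in comap (_root_.abs ∘ im) atTop ⊓ 𝓟 (re ⁻¹' Set.Ioo a b),
          1 ≤ |z.im| ∧ z ∈ re ⁻¹' Set.Ioo a b := by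
        refine Eventually.and ?_ ?_
        · exact ((eventually_ge_atTop (1 : ℝ)).comap _).filter_mono inf_le_left
        · exact Filter.mem_inf_of_right (mem_principal_self _)
      filter_upwards [hev] with z hz
      have hz1 := hgrowth z hz.2.1.le hz.2.2.le hz.1
      have hz2 := hn' z hz.2.1.le hz.2.2.le
      set v := |z.im| with hv
      have hv2 : z.im ^ 2 = v ^ 2 := (sq_abs _).symm
      rw [Real.norm_of_nonneg (Real.exp_pos _).le]
      have e1 : 1 + v ^ 2 ≤ Real.exp (2 * v) := by
        have := Real.quadratic_le_exp_of_nonneg (x := 2 * v) (by linarith [hz.1])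
        nlinarith [hz.1]
      have e2 : (|c| + 2) * v ≤
          (|c| + 2) / (π / (b - a) / 2) * Real.exp (π / (b - a) / 2 * v) := by
        have h3 : π / (b - a) / 2 * v ≤ Real.exp (π / (b - a) / 2 * v) := by
          linarith [Real.add_one_le_exp (π / (b - a) / 2 * v)]
        rw [div_mul_eq_mul_div, le_div_iff₀ (by positivity)]
        have := mul_le_mul_of_nonneg_left h3 (by positivity : 0 ≤ |c| + 2)
        linarith
      calc ‖f z‖ = ‖H z‖ * ‖(z - a) ^ 2‖ := norm_mul _ _
        _ ≤ (|B| * Real.exp (|c| * v)) * (D * Real.exp (2 * v)) := by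
          refine mul_le_mul (hz1.trans ?_) (hz2.trans ?_) (norm_nonneg _) (by positivity)
          · refine mul_le_mul (le_abs_self _) (Real.exp_le_exp.2 ?_) (Real.exp_pos _).le
              (abs_nonneg _)
            exact mul_le_mul_of_nonneg_right (le_abs_self _) (abs_nonneg _)
          · rw [hv2]; exact mul_le_mul_of_nonneg_left e1 (by positivity)
        _ = |B| * D * Real.exp ((|c| + 2) * v) := by
          rw [show (|c| + 2) * v = |c| * v + 2 * v by ring, Real.exp_add]; ring
        _ ≤ _ := mul_le_mul_of_nonneg_left (Real.exp_le_exp.2 e2) (by positivity)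
    · exact fun z hz => hedge z hz.ge (hz.le.trans hab.le) (ha z hz)
    · exact fun z hz => hedge z (hab.le.trans hz.ge) hz.le (hb z hz)
  have hpos : 0 < t.im ^ 2 := by rw [← sq_abs]; positivity
  rw [le_div_iff₀ hpos]
  refine le_trans ?_ key
  rw [hf, norm_mul, hn]
  exact mul_le_mul_of_nonneg_left (by nlinarith [sq_nonneg (t.re - a)]) (norm_nonneg _)

end Contour

/-! ### Mellin transforms of truncated powers -/

section Truncated

/-- Indicator forms of truncated powers and their min/max forms may disagree at y = 1, which is a
null set. -/
lemma hasMellin_congr_of_ne_one {f g : ℝ → ℂ} {t m : ℂ} (hf : HasMellin f t m)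
    (h : ∀ y : ℝ, 0 < y → y ≠ 1 → f y = g y) : HasMellin g t m := by
  have hae : (fun y : ℝ => (y : ℂ) ^ (t - 1) • f y) =ᵐ[volume.restrict (Set.Ioi 0)]
      fun y : ℝ => (y : ℂ) ^ (t - 1) • g y := by
    have h1 : ∀ᵐ y : ℝ ∂(volume.restrict (Set.Ioi 0)), y ≠ 1 :=
      Measure.ae_ne (volume.restrict (Set.Ioi 0)) 1
    filter_upwards [h1, ae_restrict_mem measurableSet_Ioi] with y hy1 hy0
    rw [h y hy0 hy1]
  exact ⟨hf.1.congr hae, by rw [← hf.2, mellin, mellin, integral_congr_ae hae]⟩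

lemma hasMellin_comp_inv {f : ℝ → ℂ} {t m : ℂ} (hf : HasMellin f (-t) m) :
    HasMellin (fun y => f y⁻¹) t m := by
  refine ⟨?_, by rw [mellin_comp_inv, hf.2]⟩
  have := (MellinConvergent.comp_rpow (f := f) (s := t) (a := -1) (by norm_num)).2
    (by simpa [div_neg] using hf.1)
  simpa [Real.rpow_neg_one] using this

lemma hasMellin_finset_sum {ι : Type*} (S : Finset ι) {f : ι → ℝ → ℂ} {m : ι → ℂ} {t : ℂ}
    (h : ∀ i ∈ S, HasMellin (f i) t (m i)) :
    HasMellin (fun y => ∑ i ∈ S, f i y) t (∑ i ∈ S, m i) := by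
  classical
  induction S using Finset.induction_on with
  | empty => exact ⟨by simp [MellinConvergent], by simp [mellin]⟩
  | insert j S hj ih =>
    simp only [Finset.sum_insert hj]
    have h1 := h j (Finset.mem_insert_self _ _)
    have h2 := ih fun i hi => h i (Finset.mem_insert_of_mem hi)
    have := hasMellin_add h1.1 h2.1
    exact ⟨this.1, by rw [this.2, h1.2, h2.2]⟩

lemma _root_.HasMellin.fun_const_mul {f : ℝ → ℂ} {t m : ℂ} (hf : HasMellin f t m) (c : ℂ) :
    HasMellin (fun y => c * f y) t (c * m) := by
  have := hasMellin_const_smul hf.1 c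
  exact ⟨this.1, by rw [← hf.2]; exact this.2⟩

lemma _root_.HasMellin.fun_sub {f g : ℝ → ℂ} {t m n : ℂ} (hf : HasMellin f t m) (hg : HasMellin g t n) :
    HasMellin (fun y => f y - g y) t (m - n) := by
  have := hasMellin_sub hf.1 hg.1
  exact ⟨this.1, by rw [this.2, hf.2, hg.2]⟩

/-- Differentiating the transform 1/(t + a) of the truncated power in t brings down log y. -/
lemma hasMellin_log_mul_cpow_Ioc (a : ℂ) {t : ℂ} (ht : 0 < t.re + a.re) :
    HasMellin (Set.indicator (Set.Ioc 0 1) fun y : ℝ => (y : ℂ) ^ a * Real.log y) t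
      (-1 / (t + a) ^ 2) := by
  set f : ℝ → ℂ := Set.indicator (Set.Ioc 0 1) fun y : ℝ => (y : ℂ) ^ a with hf
  have hloc : LocallyIntegrableOn f (Set.Ioi 0) := by
    intro x hx
    suffices h : LocallyIntegrableOn (fun y : ℝ => (y : ℂ) ^ a) (Set.Ioi 0) by
      obtain ⟨u, hu, hi⟩ := h x hx
      exact ⟨u, hu, hi.indicator measurableSet_Ioc⟩
    refine ContinuousOn.locallyIntegrableOn ?_ measurableSet_Ioi
    intro y (hy : 0 < y)
    exact (continuousAt_ofReal_cpow_const _ _ (Or.inr hy.ne')).continuousWithinAt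
  have htop : f =O[atTop] fun y : ℝ => y ^ (-(t.re + 1)) := by
    refine IsBigO.of_bound 1 ?_
    filter_upwards [eventually_gt_atTop 1] with y hy
    rw [hf, Set.indicator_of_notMem (by simp [hy])]
    simp
  have hbot : f =O[𝓝[>] 0] fun y : ℝ => y ^ (-(-a.re)) := by
    refine IsBigO.of_bound 1 ?_
    filter_upwards [Ioo_mem_nhdsGT (show (0 : ℝ) < 1 from one_pos)] with y hy
    rw [hf, Set.indicator_of_mem (show y ∈ Set.Ioc (0 : ℝ) 1 from ⟨hy.1, hy.2.le⟩), norm_cpow_eq_rpow_re_of_pos hy.1, neg_neg,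
      one_mul]
    exact le_abs_self _
  have key := mellin_hasDerivAt_of_isBigO_rpow hloc htop (by linarith) hbot (s := t) (by linarith)
  have hd : HasDerivAt (mellin f) (-1 / (t + a) ^ 2) t := by
    have h1 : HasDerivAt (fun u : ℂ => 1 / (u + a)) (-1 / (t + a) ^ 2) t := by
      have hne : t + a ≠ 0 := fun h => by
        have := congrArg re h; simp at this; linarith
      have := ((hasDerivAt_id t).add_const a).fun_inv hne
      simpa using this
    refine h1.congr_of_eventuallyEq ?_
    have : ∀ᶠ u : ℂ in 𝓝 t, 0 < u.re + a.re :=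
      (continuous_re.add continuous_const).continuousAt.eventually (lt_mem_nhds ht)
    filter_upwards [this] with u hu using (hasMellin_cpow_Ioc a hu).2
  have h3 : HasMellin (fun y : ℝ => Real.log y • f y) t (-1 / (t + a) ^ 2) :=
    ⟨key.1, key.2.unique hd⟩
  convert h3 using 2 with y
  by_cases hy : y ∈ Set.Ioc (0 : ℝ) 1
  · simp [hf, hy, mul_comm]
  · simp [hf, hy]

lemma ofReal_cpow_inv_inv {y : ℝ} (hy : 0 < y) (a : ℂ) : ((y⁻¹ : ℝ) : ℂ) ^ (-a) = (y : ℂ) ^ a := by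
  rw [ofReal_inv, inv_cpow _ _ (by rw [arg_ofReal_of_nonneg hy.le]; exact Real.pi_pos.ne),
    cpow_neg, inv_inv]

/-- Unlike an indicator, the min form is continuous at y = 1, so Mellin inversion recovers it at
every point. The second power contributes -1/(t + M), which improves the decay of 1/(t - p) from
linear to quadratic. -/
lemma hasMellin_min_cpow {p t : ℂ} {M : ℝ} (hp : p.re < t.re) (hM : -M < t.re) :
    HasMellin (fun y : ℝ => ((min y 1 : ℝ) : ℂ) ^ (-p) - ((min y 1 : ℝ) : ℂ) ^ (M : ℂ)) t
      (1 / (t - p) - 1 / (t + M)) := by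
  have h1 := hasMellin_cpow_Ioc (-p) (s := t) (by simpa using hp)
  have h2 := hasMellin_cpow_Ioc (M : ℂ) (s := t) (by simp; linarith)
  refine hasMellin_congr_of_ne_one (h1.fun_sub h2) fun y hy hy1 => ?_
  rcases lt_or_gt_of_ne hy1 with h | h
  · rw [min_eq_left h.le]; simp [hy, h.le]
  · rw [min_eq_right h.le]; simp [h]

lemma hasMellin_min_log {p t : ℂ} (hp : p.re < t.re) :
    HasMellin (fun y : ℝ => ((min y 1 : ℝ) : ℂ) ^ (-p) * Real.log (min y 1)) t
      (-1 / (t - p) ^ 2) := by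
  have h1 := hasMellin_log_mul_cpow_Ioc (-p) (t := t) (by simpa using hp)
  refine hasMellin_congr_of_ne_one h1 fun y hy hy1 => ?_
  rcases lt_or_gt_of_ne hy1 with h | h
  · rw [min_eq_left h.le]; simp [hy, h.le]
  · rw [min_eq_right h.le]; simp [h]

/-- The rational function of `hasMellin_min_cpow` has a different original to the left of the pole
p. The two originals differ by exactly y^{-p} for all y > 0, which is how a residue appears without
a contour around p. -/
lemma hasMellin_max_cpow {p t : ℂ} {M : ℝ} (hp : t.re < p.re) (hM : -M < t.re) :
    HasMellin (fun y : ℝ => 1 - ((max y 1 : ℝ) : ℂ) ^ (-p) - ((min y 1 : ℝ) : ℂ) ^ (M : ℂ)) t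
      (1 / (t - p) - 1 / (t + M)) := by
  have h1 := hasMellin_comp_inv (hasMellin_cpow_Ioc p (s := -t) (by simpa using hp))
  have h2 := hasMellin_cpow_Ioc (M : ℂ) (s := t) (by simp; linarith)
  have h3 := (h1.fun_const_mul (-1)).fun_sub h2
  rw [show -1 * (1 / (-t + p)) = 1 / (t - p) by
    rw [show t - p = -(-t + p) by ring, one_div_neg_eq_neg_one_div]; ring] at h3
  refine hasMellin_congr_of_ne_one h3 fun y hy hy1 => ?_
  rcases lt_or_gt_of_ne hy1 with h | h
  · rw [min_eq_left h.le, max_eq_right h.le]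
    simp [hy, h.le, (one_lt_inv₀ hy).2 h]
  · rw [min_eq_right h.le, max_eq_left h.le]
    have := ofReal_cpow_inv_inv hy (-p)
    rw [neg_neg] at this
    simp only [ofReal_inv] at this
    simp [hy, h, inv_le_one_of_one_le₀ h.le, this]

lemma hasMellin_max_log {p t : ℂ} (hp : t.re < p.re) :
    HasMellin (fun y : ℝ => -(((max y 1 : ℝ) : ℂ) ^ (-p) * Real.log (max y 1))) t
      (-1 / (t - p) ^ 2) := by
  have h1 := hasMellin_comp_inv (hasMellin_log_mul_cpow_Ioc p (t := -t) (by simpa using hp))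
  rw [show (-t + p) ^ 2 = (t - p) ^ 2 by ring] at h1
  refine hasMellin_congr_of_ne_one h1 fun y hy hy1 => ?_
  rcases lt_or_gt_of_ne hy1 with h | h
  · rw [max_eq_right h.le]
    simp [(one_lt_inv₀ hy).2 h]
  · rw [max_eq_left h.le]
    have := ofReal_cpow_inv_inv hy (-p)
    rw [neg_neg] at this
    simp only [ofReal_inv] at this
    simp [hy, inv_le_one_of_one_le₀ h.le, this]

end Truncated

/-! ### Functions with the same Mellin transform in different half-planes -/

section Comparison

/-- If `f` and `g` have the same meromorphic Mellin transform `F` on two vertical lines, then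
`f - g` is the sum of the residues of `F(t) y^{-t}` between the lines. -/
theorem eq_add_residues_of_mellin {f g : ℝ → ℂ} {F : ℂ → ℂ} {a b B c C : ℝ} (hab : a < b)
    (S : Finset ℤ) (α β : ℤ → ℂ)
    (hS : ∀ p ∈ S, a < p ∧ (p : ℝ) < b)
    (hf : ContinuousOn f (Set.Ioi 0)) (hg : ContinuousOn g (Set.Ioi 0))
    (hfF : ∀ t : ℂ, t.re = b → HasMellin f t (F t))
    (hgF : ∀ t : ℂ, t.re = a → HasMellin g t (F t))
    (hFd : ∀ t : ℂ, a ≤ t.re → t.re ≤ b → (∀ p ∈ S, t ≠ (p : ℂ)) → AnalyticAt ℂ F t)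
    (hFp : ∀ p ∈ S, ∃ h : ℂ → ℂ, AnalyticAt ℂ h p ∧ ∀ᶠ t in 𝓝[≠] (p : ℂ),
      F t - α p / (t - p) - β p / (t - p) ^ 2 = h t)
    (hgrowth : ∀ t : ℂ, a ≤ t.re → t.re ≤ b → 1 ≤ |t.im| → ‖F t‖ ≤ B * Real.exp (c * |t.im|))
    (ha : ∀ t : ℂ, t.re = a → ‖F t‖ ≤ C / (1 + t.im ^ 2))
    (hb : ∀ t : ℂ, t.re = b → ‖F t‖ ≤ C / (1 + t.im ^ 2))
    {y : ℝ} (hy : 0 < y) :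
    f y = g y + ∑ p ∈ S, (α p * (y : ℂ) ^ (-(p : ℂ)) - β p * ((y : ℂ) ^ (-(p : ℂ)) * Real.log y)) := by
  obtain ⟨M, hM⟩ : ∃ M : ℝ, -M < a := ⟨-a + 1, by linarith⟩
  -- The auxiliary pole -M lies to the left of the strip, so the principal part at p is unaffected.
  -- The double pole is written through -1/(t - p)², the transform of the logarithmic truncated
  -- power.
  set ρ : ℤ → ℂ → ℂ := fun p t => α p * (1 / (t - p) - 1 / (t + M)) - β p * (-1 / (t - p) ^ 2)
    with hρ
  set R : ℂ → ℂ := fun t => ∑ p ∈ S, ρ p t with hR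
  -- The limit fills in the removable singularities on S, so that H is holomorphic at every point of
  -- the closed strip and equals F - R off S.
  set H : ℂ → ℂ := fun t => limUnder (𝓝[≠] t) fun u => F u - R u with hH
  have hMt : ∀ t : ℂ, a ≤ t.re → t + M ≠ 0 := fun t h1 h => by
    have := congrArg re h; simp at this; linarith
  have hρan : ∀ (p : ℤ) (t : ℂ), a ≤ t.re → t ≠ p → AnalyticAt ℂ (ρ p) t := by
    intro p t h1 h2
    have h3 := hMt t h1
    have h4 : t - p ≠ 0 := sub_ne_zero.2 h2
    have h5 : (t - p) ^ 2 ≠ 0 := pow_ne_zero 2 h4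
    have e1 : AnalyticAt ℂ (fun t : ℂ => t - p) t := by fun_prop
    have e2 : AnalyticAt ℂ (fun t : ℂ => t + M) t := by fun_prop
    exact (analyticAt_const.mul ((analyticAt_const.div e1 h4).sub (analyticAt_const.div e2 h3))).sub
      (analyticAt_const.mul (analyticAt_const.div (e1.pow 2) h5))
  have hloc : ∀ t : ℂ, a ≤ t.re → t.re ≤ b → ∃ h : ℂ → ℂ, AnalyticAt ℂ h t ∧
      ∀ᶠ u in 𝓝[≠] t, F u - R u = h u := by
    intro t h1 h2
    by_cases hp : ∃ p ∈ S, t = (p : ℂ)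
    · obtain ⟨p, hpS, rfl⟩ := hp
      obtain ⟨h, hh, hhe⟩ := hFp p hpS
      refine ⟨fun u => h u + α p * (1 / (u + M)) - ∑ q ∈ S.erase p, ρ q u, ?_, ?_⟩
      · refine (hh.add (analyticAt_const.mul (analyticAt_const.div (by fun_prop) (hMt _ h1)))).sub ?_
        refine Finset.analyticAt_fun_sum _ fun q hq => hρan q p h1 ?_
        exact fun h => (Finset.ne_of_mem_erase hq) (by exact_mod_cast h.symm)
      · filter_upwards [hhe] with u hu
        rw [← hu, hR]
        simp only
        rw [← Finset.add_sum_erase S _ hpS]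
        simp only [hρ]
        ring
    · push Not at hp
      refine ⟨fun u => F u - R u, (hFd t h1 h2 hp).sub ?_, Eventually.of_forall fun u => rfl⟩
      exact Finset.analyticAt_fun_sum _ fun q hq => hρan q t h1 (hp q hq)
  have hHloc : ∀ t : ℂ, a ≤ t.re → t.re ≤ b → ∀ h : ℂ → ℂ, AnalyticAt ℂ h t →
      (∀ᶠ u in 𝓝[≠] t, F u - R u = h u) → H =ᶠ[𝓝 t] h := by
    intro t h1 h2 h hh hhe
    have hlim : ∀ u : ℂ, ContinuousAt h u → (∀ᶠ v in 𝓝[≠] u, F v - R v = h v) → H u = h u := by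
      intro u hu hue
      refine Tendsto.limUnder_eq ?_
      exact (hu.tendsto.mono_left nhdsWithin_le_nhds).congr' (hue.mono fun v hv => hv.symm)
    have e1 : ∀ᶠ u in 𝓝 t, ContinuousAt h u :=
      hh.eventually_analyticAt.mono fun u hu => hu.continuousAt
    -- The identity on a punctured neighbourhood of t holds on a full neighbourhood of each u ≠ t
    -- close to t, so the limit defining H can be evaluated at u as well.
    have e2 : ∀ᶠ u in 𝓝[≠] t, ∀ᶠ v in 𝓝[≠] u, F v - R v = h v := by
      have := eventually_eventually_nhdsWithin.2 hhe
      filter_upwards [this, self_mem_nhdsWithin] with u hu hut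
      have h3 : 𝓝[{t}ᶜ] u = 𝓝 u := (isOpen_compl_singleton).nhdsWithin_eq hut
      rw [h3] at hu
      exact hu.filter_mono nhdsWithin_le_nhds
    have e3 : ∀ᶠ u in 𝓝[≠] t, H u = h u := by
      filter_upwards [e2, e1.filter_mono nhdsWithin_le_nhds] with u h3 h4 using hlim u h4 h3
    rw [eventually_nhdsWithin_iff] at e3
    filter_upwards [e3] with u hu
    by_cases hut : u = t
    · rw [hut]; exact hlim t hh.continuousAt hhe
    · exact hu hut
  have hHd : ∀ t : ℂ, a ≤ t.re → t.re ≤ b → DifferentiableAt ℂ H t := by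
    intro t h1 h2
    obtain ⟨h, hh, hhe⟩ := hloc t h1 h2
    exact hh.differentiableAt.congr_of_eventuallyEq (hHloc t h1 h2 h hh hhe)
  have hHeq : ∀ t : ℂ, a ≤ t.re → t.re ≤ b → (∀ p ∈ S, t ≠ (p : ℂ)) → H t = F t - R t := by
    intro t h1 h2 hp
    exact (hHloc t h1 h2 _ ((hFd t h1 h2 hp).sub (Finset.analyticAt_fun_sum _ fun q hq =>
      hρan q t h1 (hp q hq))) (Eventually.of_forall fun u => rfl)).eq_of_nhds
  have hnS : ∀ t : ℂ, (t.re = a ∨ t.re = b ∨ 1 ≤ |t.im|) → ∀ p ∈ S, t ≠ (p : ℂ) := by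
    rintro t ht p hp rfl
    have := hS p hp
    rcases ht with h | h | h
    · simp at h; linarith [this.1]
    · simp at h; linarith [this.2]
    · simp at h; linarith
  -- bounds for the rational function
  have hρb : ∀ p ∈ S, ∃ D : ℝ, 0 ≤ D ∧ ∀ t : ℂ, a ≤ t.re → t.re ≤ b →
      (t.re = a ∨ t.re = b ∨ 1 ≤ |t.im|) → ‖ρ p t‖ ≤ D / (1 + t.im ^ 2) := by
    intro p hp
    obtain ⟨h1, h2⟩ := hS p hp
    -- On the edges and for |im t| ≥ 1 the quantities |t - p|² and |t + M|² both dominate a multiple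
    -- of 1 + im²; δ collects the worst constants from the two edges, from |im t| ≥ 1 and from the
    -- pole -M.
    obtain ⟨δ, hδ0, hδ1, hδa, hδb, hδM⟩ : ∃ δ : ℝ, 0 < δ ∧ δ ≤ 1 / 2 ∧ δ ≤ (p - a) ^ 2 ∧
        δ ≤ (b - p) ^ 2 ∧ δ ≤ (a + M) ^ 2 :=
      ⟨min (1 / 2) (min ((p - a) ^ 2) (min ((b - p) ^ 2) ((a + M) ^ 2))),
        lt_min (by norm_num) (lt_min (pow_pos (by linarith) 2) (lt_min (pow_pos (by linarith) 2)
          (pow_pos (by linarith) 2))), min_le_left _ _,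
        (min_le_right _ _).trans (min_le_left _ _),
        (min_le_right _ _).trans ((min_le_right _ _).trans (min_le_left _ _)),
        (min_le_right _ _).trans ((min_le_right _ _).trans (min_le_right _ _))⟩
    set δ' := δ / 2 with hδ'
    have hδ'0 : 0 < δ' := by positivity
    have hlow : ∀ t : ℂ, (t.re = a ∨ t.re = b ∨ 1 ≤ |t.im|) →
        δ' * (1 + t.im ^ 2) ≤ ‖t - p‖ ^ 2 := by
      intro t ht
      rw [← normSq_eq_norm_sq, normSq_apply]
      simp only [sub_re, intCast_re, sub_im, intCast_im, sub_zero]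
      rcases ht with h | h | h
      · rw [h]; nlinarith [sq_nonneg t.im]
      · rw [h]; nlinarith [sq_nonneg t.im]
      · have : 1 ≤ t.im ^ 2 := by rw [← sq_abs]; nlinarith
        nlinarith [sq_nonneg (t.re - p)]
    have hlowM : ∀ t : ℂ, a ≤ t.re → δ' * (1 + t.im ^ 2) ≤ ‖t + M‖ ^ 2 := by
      intro t ht
      rw [← normSq_eq_norm_sq, normSq_apply]
      simp only [add_re, ofReal_re, add_im, ofReal_im, add_zero]
      have : (a + M) ^ 2 ≤ (t.re + M) ^ 2 := pow_le_pow_left₀ (by linarith) (by linarith) 2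
      nlinarith [sq_nonneg t.im]
    refine ⟨(‖α p‖ * (|p + M|) + ‖β p‖) / δ', by positivity, fun t h3 h4 h5 => ?_⟩
    have hx : 0 < δ' * (1 + t.im ^ 2) := by positivity
    have e1 : ‖(1 : ℂ) / (t - p) - 1 / (t + M)‖ ≤ |p + M| / (δ' * (1 + t.im ^ 2)) := by
      have hne : t - p ≠ 0 := sub_ne_zero.2 (hnS t h5 p hp)
      rw [div_sub_div _ _ hne (hMt t h3), norm_div, norm_mul]
      have : ‖(1 : ℂ) * (t + M) - (t - p) * 1‖ = |p + M| := by
        rw [show (1 : ℂ) * (t + M) - (t - p) * 1 = ((p + M : ℝ) : ℂ) by push_cast; ring,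
          norm_real, Real.norm_eq_abs]
      rw [this]
      refine div_le_div_of_nonneg_left (abs_nonneg _) hx ?_
      have := mul_le_mul (hlow t h5) (hlowM t h3) hx.le (sq_nonneg _)
      rw [← mul_pow, ← sq] at this
      exact le_of_sq_le_sq this (by positivity)
    have e2 : ‖(-1 : ℂ) / (t - p) ^ 2‖ ≤ 1 / (δ' * (1 + t.im ^ 2)) := by
      rw [norm_div, norm_neg, norm_one, norm_pow]
      exact one_div_le_one_div_of_le hx (hlow t h5)
    calc ‖ρ p t‖ ≤ ‖α p‖ * ‖(1 : ℂ) / (t - p) - 1 / (t + M)‖ + ‖β p‖ * ‖(-1 : ℂ) / (t - p) ^ 2‖ := by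
          rw [← norm_mul, ← norm_mul]; exact norm_sub_le _ _
      _ ≤ ‖α p‖ * (|p + M| / (δ' * (1 + t.im ^ 2))) + ‖β p‖ * (1 / (δ' * (1 + t.im ^ 2))) := by
          gcongr
      _ = _ := by field_simp
  obtain ⟨D, hD0, hRb⟩ : ∃ D : ℝ, 0 ≤ D ∧ ∀ t : ℂ, a ≤ t.re → t.re ≤ b →
      (t.re = a ∨ t.re = b ∨ 1 ≤ |t.im|) → ‖R t‖ ≤ D / (1 + t.im ^ 2) := by
    choose! D hD0 hD using hρb
    refine ⟨∑ p ∈ S, D p, Finset.sum_nonneg hD0, fun t h1 h2 h3 => ?_⟩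
    rw [Finset.sum_div]
    exact (norm_sum_le _ _).trans (Finset.sum_le_sum fun p hp => hD p hp t h1 h2 h3)
  have hHa : ∀ t : ℂ, t.re = a → ‖H t‖ ≤ (C + D) / (1 + t.im ^ 2) := fun t ht => by
    rw [hHeq t ht.ge (ht.le.trans hab.le) (hnS t (Or.inl ht)), add_div]
    exact (norm_sub_le _ _).trans (add_le_add (ha t ht)
      (hRb t ht.ge (ht.le.trans hab.le) (Or.inl ht)))
  have hHb : ∀ t : ℂ, t.re = b → ‖H t‖ ≤ (C + D) / (1 + t.im ^ 2) := fun t ht => by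
    rw [hHeq t (hab.le.trans ht.ge) ht.le (hnS t (Or.inr (Or.inl ht))), add_div]
    exact (norm_sub_le _ _).trans (add_le_add (hb t ht)
      (hRb t (hab.le.trans ht.ge) ht.le (Or.inr (Or.inl ht))))
  obtain ⟨C', hC'⟩ := exists_quadratic_decay_of_edges (H := H) (B := |B| + D) (c := |c|) hab hHd
    (fun t h1 h2 h3 => by
      rw [hHeq t h1 h2 (hnS t (Or.inr (Or.inr h3)))]
      refine (norm_sub_le _ _).trans ?_
      have hexp : 1 ≤ Real.exp (|c| * |t.im|) := Real.one_le_exp (by positivity)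
      have e1 : ‖F t‖ ≤ |B| * Real.exp (|c| * |t.im|) := (hgrowth t h1 h2 h3).trans
        (mul_le_mul (le_abs_self _) (Real.exp_le_exp.2 (mul_le_mul_of_nonneg_right (le_abs_self _)
          (abs_nonneg _))) (Real.exp_pos _).le (abs_nonneg _))
      have e2 : ‖R t‖ ≤ D := (hRb t h1 h2 (Or.inr (Or.inr h3))).trans
        (div_le_self hD0 (by linarith [sq_nonneg t.im]))
      nlinarith) hHa hHb
  have hshift := mellinInv_eq_mellinInv_of_strip hab.le hHd hC' hy
  -- the two modified functions
  set fm : ℝ → ℂ := fun y => f y - ∑ p ∈ S, (α p * (((min y 1 : ℝ) : ℂ) ^ (-(p : ℂ)) -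
      ((min y 1 : ℝ) : ℂ) ^ (M : ℂ)) - β p * (((min y 1 : ℝ) : ℂ) ^ (-(p : ℂ)) *
        Real.log (min y 1))) with hfm
  set gm : ℝ → ℂ := fun y => g y - ∑ p ∈ S, (α p * (1 - ((max y 1 : ℝ) : ℂ) ^ (-(p : ℂ)) -
      ((min y 1 : ℝ) : ℂ) ^ (M : ℂ)) - β p * -(((max y 1 : ℝ) : ℂ) ^ (-(p : ℂ)) *
        Real.log (max y 1))) with hgm
  have hfmM : ∀ t : ℂ, t.re = b → HasMellin fm t (H t) := by
    intro t ht
    rw [hHeq t (hab.le.trans ht.ge) ht.le (hnS t (Or.inr (Or.inl ht)))]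
    refine (hfF t ht).fun_sub (hasMellin_finset_sum S fun p hp => ?_)
    have h1 : ((p : ℂ)).re < t.re := by rw [ht]; simpa using (hS p hp).2
    exact ((hasMellin_min_cpow h1 (by linarith)).fun_const_mul _).fun_sub
      ((hasMellin_min_log h1).fun_const_mul _)
  have hgmM : ∀ t : ℂ, t.re = a → HasMellin gm t (H t) := by
    intro t ht
    rw [hHeq t ht.ge (ht.le.trans hab.le) (hnS t (Or.inl ht))]
    refine (hgF t ht).fun_sub (hasMellin_finset_sum S fun p hp => ?_)
    have h1 : t.re < ((p : ℂ)).re := by rw [ht]; simpa using (hS p hp).1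
    exact ((hasMellin_max_cpow h1 (by linarith)).fun_const_mul _).fun_sub
      ((hasMellin_max_log h1).fun_const_mul _)
  have hminp : ContinuousAt (fun y : ℝ => min y 1) y := by fun_prop
  have hmaxp : ContinuousAt (fun y : ℝ => max y 1) y := by fun_prop
  have hmin0 : 0 < min y 1 := lt_min hy one_pos
  have hmax0 : 0 < max y 1 := lt_max_of_lt_right one_pos
  have hcmin : ∀ q : ℂ, ContinuousAt (fun y : ℝ => ((min y 1 : ℝ) : ℂ) ^ q) y := fun q =>
    ContinuousAt.comp (f := fun y : ℝ => min y 1) (g := fun x : ℝ => (x : ℂ) ^ q)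
      (continuousAt_ofReal_cpow_const _ _ (Or.inr hmin0.ne')) hminp
  have hcmax : ∀ q : ℂ, ContinuousAt (fun y : ℝ => ((max y 1 : ℝ) : ℂ) ^ q) y := fun q =>
    ContinuousAt.comp (f := fun y : ℝ => max y 1) (g := fun x : ℝ => (x : ℂ) ^ q)
      (continuousAt_ofReal_cpow_const _ _ (Or.inr hmax0.ne')) hmaxp
  have hlmin : ContinuousAt (fun y : ℝ => ((Real.log (min y 1) : ℝ) : ℂ)) y :=
    continuous_ofReal.continuousAt.comp (hminp.log hmin0.ne')
  have hlmax : ContinuousAt (fun y : ℝ => ((Real.log (max y 1) : ℝ) : ℂ)) y :=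
    continuous_ofReal.continuousAt.comp (hmaxp.log hmax0.ne')
  have hfmc : ContinuousAt fm y := (hf.continuousAt (Ioi_mem_nhds hy)).sub
    (tendsto_finsetSum _ fun p _ => (continuousAt_const.mul ((hcmin _).sub (hcmin _))).sub
      (continuousAt_const.mul ((hcmin _).mul hlmin)))
  have hgmc : ContinuousAt gm y := (hg.continuousAt (Ioi_mem_nhds hy)).sub
    (tendsto_finsetSum _ fun p _ => (continuousAt_const.mul ((continuousAt_const.sub
      (hcmax _)).sub (hcmin _))).sub (continuousAt_const.mul ((hcmax _).mul hlmax).neg))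
  have hinv : ∀ (σ : ℝ) (k : ℝ → ℂ), a ≤ σ → σ ≤ b → (∀ t : ℂ, t.re = σ → HasMellin k t (H t)) →
      ContinuousAt k y → mellinInv σ H y = k y := by
    intro σ k h1 h2 hk hkc
    have hline : ∀ v : ℝ, H (σ + v * I) = mellin k (σ + v * I) := fun v =>
      ((hk _ (by simp)).2).symm
    rw [← mellinInv_mellin_eq σ k hy (hk σ (by simp)).1 ?_ hkc]
    · simp only [mellinInv, hline]
    · have := verticalIntegrable_of_bound (H := H) (σ := σ)
        (fun t ht => (hHd t (by rw [ht]; exact h1) (by rw [ht]; exact h2)).continuousAt)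
        (fun t ht => hC' t (by rw [ht]; exact h1) (by rw [ht]; exact h2))
      simpa only [VerticalIntegrable, hline] using this
  have hfin : fm y = gm y := by
    rw [← hinv b fm hab.le le_rfl hfmM hfmc, ← hinv a gm le_rfl hab.le hgmM hgmc, hshift]
  simp only [hfm, hgm] at hfin
  rw [sub_eq_iff_eq_add] at hfin
  rw [hfin, sub_add, sub_eq_add_neg, add_right_inj, ← Finset.sum_sub_distrib,
    ← Finset.sum_neg_distrib]
  refine Finset.sum_congr rfl fun p _ => ?_
  -- On either side of y = 1 the min form minus the max form is y^{-p}, and y^{-p} log y for the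
  -- logarithmic pair.
  rcases le_total y 1 with h | h
  · rw [min_eq_left h, max_eq_right h]; simp; ring
  · rw [min_eq_right h, max_eq_left h]; simp; ring

end Comparison

/-! ### Double series -/

section Series

/-- The product `n₁ n₂` as a real number. -/
noncomputable def prodR (n : ℕ+ × ℕ+) : ℝ := (n.1 : ℝ) * (n.2 : ℝ)

/-- The coefficient of the double series `Ξ`. -/
noncomputable def coef {r₁ r₂ : ℕ} (s₁ s₂ : ℤ) (χ₁ : DirichletCharacter ℂ r₁)
    (χ₂ : DirichletCharacter ℂ r₂) (n : ℕ+ × ℕ+) : ℂ :=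
  χ₁ ((n.1 : ℕ) : ZMod r₁) / (n.1 : ℂ) ^ s₁ * (χ₂ ((n.2 : ℕ) : ZMod r₂) / (n.2 : ℂ) ^ s₂)

variable {r₁ r₂ : ℕ} (s₁ s₂ : ℤ) (χ₁ : DirichletCharacter ℂ r₁) (χ₂ : DirichletCharacter ℂ r₂)

lemma one_le_pnat_cast (n : ℕ+) : (1 : ℝ) ≤ (n : ℝ) := by exact_mod_cast n.2

lemma one_le_prodR (n : ℕ+ × ℕ+) : 1 ≤ prodR n :=
  one_le_mul_of_one_le_of_one_le (one_le_pnat_cast _) (one_le_pnat_cast _)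

lemma prodR_pos (n : ℕ+ × ℕ+) : 0 < prodR n := one_pos.trans_le (one_le_prodR n)

lemma norm_natCast_zpow_inv_le (s : ℤ) (n : ℕ+) : ‖((n : ℂ) ^ s)⁻¹‖ ≤ (n : ℝ) ^ s.natAbs := by
  rw [norm_inv, norm_zpow]
  have h : ‖(n : ℂ)‖ = (n : ℝ) := by simp
  rw [h, ← zpow_neg, ← zpow_natCast]
  refine zpow_le_zpow_right₀ (one_le_pnat_cast n) ?_
  omega

lemma norm_coef_le (n : ℕ+ × ℕ+) :
    ‖coef s₁ s₂ χ₁ χ₂ n‖ ≤ prodR n ^ (s₁.natAbs + s₂.natAbs) := by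
  have h1 := norm_natCast_zpow_inv_le s₁ n.1
  have h2 := norm_natCast_zpow_inv_le s₂ n.2
  have e1 := one_le_pnat_cast n.1
  have e2 := one_le_pnat_cast n.2
  have p1 := pow_le_pow_right₀ e1 (Nat.le_add_right s₁.natAbs s₂.natAbs)
  have p2 := pow_le_pow_right₀ e2 (Nat.le_add_left s₂.natAbs s₁.natAbs)
  rw [coef, div_eq_mul_inv, div_eq_mul_inv, norm_mul, norm_mul, norm_mul, prodR, mul_pow]
  have c1 := χ₁.norm_le_one ((n.1 : ℕ) : ZMod r₁)
  have c2 := χ₂.norm_le_one ((n.2 : ℕ) : ZMod r₂)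
  refine mul_le_mul ?_ ?_ (by positivity) (by positivity)
  · exact (mul_le_of_le_one_left (norm_nonneg _) c1).trans (h1.trans p1)
  · exact (mul_le_of_le_one_left (norm_nonneg _) c2).trans (h2.trans p2)

lemma summable_prodR_pow_mul_exp (A : ℕ) {c : ℝ} (hc : 0 < c) :
    Summable fun n : ℕ+ × ℕ+ => prodR n ^ A * Real.exp (-c * prodR n) := by
  have h1 : Summable fun n : ℕ+ => (n : ℝ) ^ A * Real.exp (-(c / 2) * n) := by
    have := (Real.summable_pow_mul_exp_neg_nat_mul A (r := c / 2) (by positivity)).comp_injective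
      PNat.coe_injective
    simpa [Function.comp_def] using this
  refine Summable.of_nonneg_of_le (fun n => ?_) (fun n => ?_)
    (h1.mul_of_nonneg h1 (fun n => by positivity) (fun n => by positivity))
  · have := prodR_pos n; positivity
  · have e1 := one_le_pnat_cast n.1
    have e2 := one_le_pnat_cast n.2
    -- The inequality mn ≥ (m + n)/2 for m, n ≥ 1 decouples the two variables.
    have : ((n.1 : ℝ) + n.2) / 2 ≤ prodR n := by rw [prodR]; nlinarith
    calc prodR n ^ A * Real.exp (-c * prodR n)
        ≤ prodR n ^ A * Real.exp (-c * (((n.1 : ℝ) + n.2) / 2)) := by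
          have := prodR_pos n
          gcongr ?_ * Real.exp ?_
          nlinarith
      _ = _ := by
          rw [prodR, mul_pow, show -c * (((n.1 : ℝ) + n.2) / 2) = -(c / 2) * n.1 + -(c / 2) * n.2
            by ring, Real.exp_add]
          ring

/-- Since n₁n₂ ≥ 1, raising the rate from c₀ to c costs every term at least the factor e^{-(c -
c₀)}. The sum thus decays like its first exponential, which becomes e^{-2π/(r₁r₂y)} in the remainder
estimate. -/
lemma exists_tsum_prodR_le (A : ℕ) {c₀ : ℝ} (hc₀ : 0 < c₀) : ∃ C : ℝ, 0 ≤ C ∧ ∀ c : ℝ, c₀ ≤ c →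
    ∑' n : ℕ+ × ℕ+, prodR n ^ A * Real.exp (-c * prodR n) ≤ C * Real.exp (-c) := by
  refine ⟨Real.exp c₀ * ∑' n : ℕ+ × ℕ+, prodR n ^ A * Real.exp (-c₀ * prodR n),
    mul_nonneg (Real.exp_pos _).le (tsum_nonneg fun n => by
      have := prodR_pos n; positivity), fun c hc => ?_⟩
  have hs := summable_prodR_pow_mul_exp A hc₀
  rw [mul_right_comm, ← Real.exp_add, ← tsum_mul_left]
  refine (summable_prodR_pow_mul_exp A (hc₀.trans_le hc)).tsum_le_tsum (fun n => ?_)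
    (hs.mul_left _)
  have h1 := one_le_prodR n
  rw [mul_left_comm, ← Real.exp_add]
  have := prodR_pos n
  gcongr
  nlinarith

lemma xiTerm_eq (τ : ℂ) (n : ℕ+ × ℕ+) :
    xiTerm s₁ s₂ χ₁ χ₂ τ n = coef s₁ s₂ χ₁ χ₂ n * cexp (-(-2 * π * I * τ * prodR n)) := by
  rw [xiTerm, coef, prodR]
  push_cast
  congr 2
  ring

/-- Functions on the right half-plane of the kind by which the terms of `Ξ` get multiplied. -/
structure IsMultiplier (B : ℂ → ℂ) : Prop where
  differentiableOn : DifferentiableOn ℂ B {z | 0 < z.re}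
  bound : ∃ (D : ℝ) (N p : ℕ), 0 ≤ D ∧ ∀ z : ℂ, 0 < z.re →
    ‖B z‖ ≤ D * (1 + z.re⁻¹) ^ N * (‖z‖ / z.re) ^ p

lemma isMultiplier_one : IsMultiplier fun _ => 1 :=
  ⟨differentiableOn_const _, 1, 0, 0, zero_le_one, fun z _ => by simp⟩

/-- The `n`-th term of `∑ coef n · e^{-ζ n₁n₂} B(ζ n₁n₂)`. -/
noncomputable def mulTerm (B : ℂ → ℂ) (ζ : ℂ) (n : ℕ+ × ℕ+) : ℂ :=
  coef s₁ s₂ χ₁ χ₂ n * (cexp (-(ζ * prodR n)) * B (ζ * prodR n))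

variable {B : ℂ → ℂ}

lemma re_mul_prodR_pos {ζ : ℂ} (hζ : 0 < ζ.re) (n : ℕ+ × ℕ+) : 0 < (ζ * prodR n).re := by
  simpa using mul_pos hζ (prodR_pos n)

/-- The multiplier bound suits scaling: ‖z‖/re z does not change under z = ζ n₁n₂, and (re z)⁻¹ only
decreases. One majorant therefore serves all terms, uniformly for ζ with re ζ ≥ δ and ‖ζ‖ ≤ R. -/
lemma IsMultiplier.norm_mulTerm_le (hB : IsMultiplier B) {δ R : ℝ} (hδ : 0 < δ) :
    ∃ D : ℝ, ∀ ζ : ℂ, δ ≤ ζ.re → ‖ζ‖ ≤ R → ∀ n, ‖mulTerm s₁ s₂ χ₁ χ₂ B ζ n‖ ≤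
      D * (prodR n ^ (s₁.natAbs + s₂.natAbs) * Real.exp (-δ * prodR n)) := by
  obtain ⟨D, N, p, hD, hb⟩ := hB.bound
  refine ⟨D * (1 + δ⁻¹) ^ N * (R / δ) ^ p, fun ζ h1 h2 n => ?_⟩
  have hζ : 0 < ζ.re := hδ.trans_le h1
  have hn := prodR_pos n
  have hn1 := one_le_prodR n
  have hz := hb _ (re_mul_prodR_pos hζ n)
  have hre : (ζ * prodR n).re = ζ.re * prodR n := by simp
  have hnorm : ‖ζ * prodR n‖ = ‖ζ‖ * prodR n := by
    rw [norm_mul, norm_real, Real.norm_of_nonneg hn.le]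
  rw [hre, hnorm, mul_div_mul_right _ _ hn.ne'] at hz
  have hR : 0 ≤ R := (norm_nonneg _).trans h2
  have hB' : ‖B (ζ * prodR n)‖ ≤ D * (1 + δ⁻¹) ^ N * (R / δ) ^ p := by
    refine hz.trans ?_
    have : (ζ.re * prodR n)⁻¹ ≤ δ⁻¹ := inv_anti₀ hδ (by nlinarith)
    have h0 : 0 ≤ (ζ.re * prodR n)⁻¹ := by positivity
    gcongr
  have hexp : ‖cexp (-(ζ * prodR n))‖ ≤ Real.exp (-δ * prodR n) := by
    rw [norm_exp, neg_re, hre]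
    exact Real.exp_le_exp.2 (by nlinarith)
  rw [mulTerm, norm_mul, norm_mul]
  calc _ ≤ prodR n ^ (s₁.natAbs + s₂.natAbs) * (Real.exp (-δ * prodR n) *
        (D * (1 + δ⁻¹) ^ N * (R / δ) ^ p)) := by
        gcongr
        exact norm_coef_le _ _ _ _ _
    _ = _ := by ring

lemma IsMultiplier.summable_mulTerm (hB : IsMultiplier B) {ζ : ℂ} (hζ : 0 < ζ.re) :
    Summable (mulTerm s₁ s₂ χ₁ χ₂ B ζ) := by
  obtain ⟨D, hD⟩ := hB.norm_mulTerm_le s₁ s₂ χ₁ χ₂ (R := ‖ζ‖) hζ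
  exact Summable.of_norm_bounded ((summable_prodR_pow_mul_exp _ hζ).mul_left D)
    (hD ζ le_rfl le_rfl)

lemma isOpen_re_pos : IsOpen {z : ℂ | 0 < z.re} := isOpen_lt continuous_const continuous_re

lemma IsMultiplier.differentiableOn_tsum_mulTerm (hB : IsMultiplier B) :
    DifferentiableOn ℂ (fun ζ => ∑' n, mulTerm s₁ s₂ χ₁ χ₂ B ζ n) {z | 0 < z.re} := by
  intro ζ₀ (hζ₀ : 0 < ζ₀.re)
  set U : Set ℂ := {z | ζ₀.re / 2 < z.re} ∩ Metric.ball 0 (‖ζ₀‖ + 1) with hU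
  have hUo : IsOpen U := (isOpen_lt continuous_const continuous_re).inter Metric.isOpen_ball
  have hUm : ζ₀ ∈ U := ⟨by simp; linarith, by simp⟩
  obtain ⟨D, hD⟩ := hB.norm_mulTerm_le s₁ s₂ χ₁ χ₂ (δ := ζ₀.re / 2) (R := ‖ζ₀‖ + 1) (by linarith)
  have : DifferentiableOn ℂ (fun ζ => ∑' n, mulTerm s₁ s₂ χ₁ χ₂ B ζ n) U := by
    refine differentiableOn_tsum_of_summable_norm
      ((summable_prodR_pow_mul_exp _ (show 0 < ζ₀.re / 2 by linarith)).mul_left D) (fun n => ?_) hUo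
      (fun n ζ hζ => hD ζ (le_of_lt hζ.1) (by have := mem_ball_zero_iff.1 hζ.2; exact this.le) n)
    have hlin : DifferentiableOn ℂ (fun ζ : ℂ => ζ * prodR n) U := by fun_prop
    refine (DifferentiableOn.mul hlin.neg.cexp (hB.differentiableOn.comp hlin ?_)).const_mul _
    intro ζ hζ
    exact re_mul_prodR_pos (by have : ζ₀.re / 2 < ζ.re := hζ.1; linarith) n
  exact (this.differentiableAt (hUo.mem_nhds hUm)).differentiableWithinAt

lemma re_neg_two_pi_I_mul (τ : ℂ) : (-2 * π * I * τ).re = 2 * π * τ.im := by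
  simp

lemma xiTerm_eq_mulTerm (τ : ℂ) :
    xiTerm s₁ s₂ χ₁ χ₂ τ = mulTerm s₁ s₂ χ₁ χ₂ (fun _ => 1) (-2 * π * I * τ) := by
  ext n
  rw [xiTerm_eq, mulTerm, mul_one]

lemma summable_xiTerm {τ : ℂ} (hτ : 0 < τ.im) : Summable (xiTerm s₁ s₂ χ₁ χ₂ τ) := by
  rw [xiTerm_eq_mulTerm]
  exact isMultiplier_one.summable_mulTerm _ _ _ _ (by rw [re_neg_two_pi_I_mul]; positivity)

lemma differentiableOn_Xi : DifferentiableOn ℂ (Xi s₁ s₂ χ₁ χ₂) {τ | 0 < τ.im} := by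
  have h1 := isMultiplier_one.differentiableOn_tsum_mulTerm s₁ s₂ χ₁ χ₂
  have h2 : DifferentiableOn ℂ (fun τ : ℂ => -2 * π * I * τ) {τ | 0 < τ.im} := by fun_prop
  refine (h1.comp h2 fun τ (hτ : 0 < τ.im) => ?_).congr fun τ _ => ?_
  · change 0 < (-2 * π * I * τ).re
    rw [re_neg_two_pi_I_mul]; positivity
  · simp only [Xi, xiTerm_eq_mulTerm, Function.comp]

lemma Xi_swap (τ : ℂ) : Xi s₁ s₂ χ₁ χ₂ τ = Xi s₂ s₁ χ₂ χ₁ τ := by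
  rw [Xi, Xi, ← (Equiv.prodComm ℕ+ ℕ+).tsum_eq]
  refine tsum_congr fun n => ?_
  simp only [xiTerm, Equiv.prodComm_apply, Prod.fst_swap, Prod.snd_swap]
  ring_nf

end Series

/-! ### Mellin transforms of the double series -/

section MellinSeries

lemma integrable_tsum_of_summable_integral_norm {α ι : Type*} [MeasurableSpace α] [Countable ι]
    {μ : Measure α} {F : ι → α → ℂ} (hF : ∀ i, Integrable (F i) μ)
    (hs : Summable fun i => ∫ a, ‖F i a‖ ∂μ)
    (hm : AEStronglyMeasurable (fun a => ∑' i, F i a) μ) : Integrable (fun a => ∑' i, F i a) μ := by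
  refine ⟨hm, ?_⟩
  have h1 : ∀ a, ‖∑' i, F i a‖ₑ ≤ ∑' i, ‖F i a‖ₑ := fun a => enorm_tsum_le_tsum_enorm
  refine (lintegral_mono h1).trans_lt ?_
  rw [lintegral_tsum fun i => (hF i).1.enorm]
  have h2 : ∀ i, ∫⁻ a, ‖F i a‖ₑ ∂μ = ENNReal.ofReal (∫ a, ‖F i a‖ ∂μ) := fun i =>
    (ofReal_integral_norm_eq_lintegral_enorm (hF i)).symm
  simp only [h2]
  rw [← ENNReal.ofReal_tsum_of_nonneg (fun i => integral_nonneg fun a => norm_nonneg _) hs]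
  exact ENNReal.ofReal_lt_top

/-- The Mellin transform of `∑ aᵢ k(λᵢ v)`. -/
lemma hasMellin_tsum_comp_mul {ι : Type*} [Countable ι] {a : ι → ℂ} {l : ι → ℝ} {k : ℝ → ℂ}
    {t m : ℂ} (hl : ∀ i, 0 < l i) (hk : HasMellin k t m)
    (hs : Summable fun i => ‖a i‖ * l i ^ (-t.re))
    (hm : ContinuousOn (fun v => ∑' i, a i * k (l i * v)) (Set.Ioi 0)) :
    HasMellin (fun v => ∑' i, a i * k (l i * v)) t (m * ∑' i, a i * (l i : ℂ) ^ (-t)) := by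
  set G : ι → ℝ → ℂ := fun i v => (v : ℂ) ^ (t - 1) * (a i * k (l i * v)) with hG
  have hGi : ∀ i, IntegrableOn (G i) (Set.Ioi 0) := fun i => by
    have h1 : MellinConvergent (fun v => k (l i * v)) t :=
      (MellinConvergent.comp_mul_left (hl i)).2 hk.1
    have := h1.const_smul (a i)
    simpa only [MellinConvergent, smul_eq_mul] using this
  -- Rescaling by lᵢ reduces all norm integrals to a single one, with weight ‖aᵢ‖ lᵢ^{-re t};
  -- summability of these weights justifies integrating termwise.
  have hGn : ∀ i, ∫ v in Set.Ioi (0 : ℝ), ‖G i v‖ =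
      (∫ x in Set.Ioi (0 : ℝ), ‖(x : ℂ) ^ (t - 1) * k x‖) * (‖a i‖ * l i ^ (-t.re)) := by
    intro i
    have h1 : ∀ v ∈ Set.Ioi (0 : ℝ), ‖G i v‖ = ‖a i‖ * l i ^ (1 - t.re) *
        ‖((l i * v : ℝ) : ℂ) ^ (t - 1) * k (l i * v)‖ := by
      intro v (hv : 0 < v)
      rw [hG, norm_mul, norm_mul, norm_mul, norm_cpow_eq_rpow_re_of_pos hv,
        norm_cpow_eq_rpow_re_of_pos (mul_pos (hl i) hv), Real.mul_rpow (hl i).le hv.le]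
      simp only [sub_re, one_re]
      have : l i ^ (1 - t.re) * l i ^ (t.re - 1) = 1 := by
        rw [← Real.rpow_add (hl i)]; simp
      linear_combination (-‖a i‖ * v ^ (t.re - 1) * ‖k (l i * v)‖) * this
    rw [setIntegral_congr_fun measurableSet_Ioi h1, integral_const_mul]
    have h2 := integral_comp_mul_left_Ioi (fun x : ℝ => ‖(x : ℂ) ^ (t - 1) * k x‖) 0 (hl i)
    rw [mul_zero] at h2
    rw [h2, smul_eq_mul]
    have : l i ^ (1 - t.re) * (l i)⁻¹ = l i ^ (-t.re) := by
      rw [← Real.rpow_neg_one, ← Real.rpow_add (hl i)]; ring_nf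
    linear_combination (‖a i‖ * ∫ x in Set.Ioi (0 : ℝ), ‖(x : ℂ) ^ (t - 1) * k x‖) * this
  have hsum : Summable fun i => ∫ v in Set.Ioi (0 : ℝ), ‖G i v‖ := by
    simp only [hGn]; exact hs.mul_left _
  have hGt : ∀ v : ℝ, ∑' i, G i v = (v : ℂ) ^ (t - 1) * ∑' i, a i * k (l i * v) := fun v => by
    rw [← tsum_mul_left]
  refine ⟨?_, ?_⟩
  · have := integrable_tsum_of_summable_integral_norm hGi hsum ?_
    · simpa only [MellinConvergent, smul_eq_mul, hGt, IntegrableOn] using this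
    · simp only [hGt]
      refine ContinuousOn.aestronglyMeasurable (ContinuousOn.mul ?_ hm) measurableSet_Ioi
      intro y (hy : 0 < y)
      exact (continuousAt_ofReal_cpow_const _ _ (Or.inr hy.ne')).continuousWithinAt
  · have h3 := integral_tsum_of_summable_integral_norm hGi hsum
    simp only [hGt] at h3
    simp only [mellin, smul_eq_mul]
    rw [← h3, ← tsum_mul_left]
    refine tsum_congr fun i => ?_
    have h4 := mellin_comp_mul_left k t (hl i)
    simp only [mellin, smul_eq_mul] at h4
    have h5 : ∀ v : ℝ, G i v = a i * ((v : ℂ) ^ (t - 1) * k (l i * v)) := fun v => by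
      rw [hG]; ring
    simp only [h5]
    rw [integral_const_mul, h4, ← hk.2, mellin]
    simp only [smul_eq_mul]
    ring

lemma coef_mul_cpow {r₁ r₂ : ℕ} (s₁ s₂ : ℤ) (χ₁ : DirichletCharacter ℂ r₁)
    (χ₂ : DirichletCharacter ℂ r₂) (t : ℂ) (n : ℕ+ × ℕ+) : coef s₁ s₂ χ₁ χ₂ n * (prodR n : ℂ) ^ (-t) =
    (χ₁ ((n.1 : ℕ) : ZMod r₁) * (n.1 : ℂ) ^ (-(s₁ + t))) *
      (χ₂ ((n.2 : ℕ) : ZMod r₂) * (n.2 : ℂ) ^ (-(s₂ + t))) := by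
  have h1 : ((n.1 : ℕ) : ℂ) ≠ 0 := by exact_mod_cast n.1.ne_zero
  have h2 : ((n.2 : ℕ) : ℂ) ≠ 0 := by exact_mod_cast n.2.ne_zero
  have h3 : (prodR n : ℂ) ^ (-t) = (n.1 : ℂ) ^ (-t) * (n.2 : ℂ) ^ (-t) := by
    rw [prodR, ofReal_mul, mul_cpow_ofReal_nonneg (by positivity) (by positivity)]
    simp
  rw [h3, neg_add, neg_add, cpow_add _ _ h1, cpow_add _ _ h2, coef, cpow_neg _ (s₁ : ℂ),
    cpow_neg _ (s₂ : ℂ), cpow_intCast, cpow_intCast, div_eq_mul_inv, div_eq_mul_inv]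
  ring

variable {r₁ r₂ : ℕ} [NeZero r₁] [NeZero r₂] (s₁ s₂ : ℤ) (χ₁ : DirichletCharacter ℂ r₁)
  (χ₂ : DirichletCharacter ℂ r₂)

lemma hasSum_pnat_LFunction {r : ℕ} [NeZero r] (χ : DirichletCharacter ℂ r) {s : ℂ}
    (hs : 1 < s.re) :
    (Summable fun n : ℕ+ => ‖χ ((n : ℕ) : ZMod r) * (n : ℂ) ^ (-s)‖) ∧
    ∑' n : ℕ+, χ ((n : ℕ) : ZMod r) * (n : ℂ) ^ (-s) = χ.LFunction s := by
  have h0 : LSeries.term (fun n => χ (n : ZMod r)) s 0 = 0 := LSeries.term_zero _ _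
  have h1 : ∀ n : ℕ+, χ ((n : ℕ) : ZMod r) * (n : ℂ) ^ (-s) =
      LSeries.term (fun n => χ (n : ZMod r)) s n := fun n => by
    rw [LSeries.term_of_ne_zero n.ne_zero, cpow_neg, div_eq_mul_inv]
  have hsm : LSeriesSummable (fun n => χ (n : ZMod r)) s := ZMod.LSeriesSummable_of_one_lt_re _ hs
  simp only [h1]
  refine ⟨hsm.norm.comp_injective PNat.coe_injective, ?_⟩
  rw [χ.LFunction_eq_LSeries hs, LSeries]
  refine PNat.coe_injective.tsum_eq fun n hn => ?_
  have hn0 : n ≠ 0 := fun h => hn (by rw [h]; exact h0)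
  exact ⟨⟨n, Nat.pos_of_ne_zero hn0⟩, rfl⟩

/-- Since (n₁n₂)^{-t} separates, the double series is a product of two absolutely convergent
Dirichlet series. -/
lemma summable_coef_mul_cpow {t : ℂ} (h₁ : 1 < s₁ + t.re) (h₂ : 1 < s₂ + t.re) :
    (Summable fun n => ‖coef s₁ s₂ χ₁ χ₂ n‖ * prodR n ^ (-t.re)) ∧
    ∑' n, coef s₁ s₂ χ₁ χ₂ n * (prodR n : ℂ) ^ (-t) =
      χ₁.LFunction (s₁ + t) * χ₂.LFunction (s₂ + t) := by
  obtain ⟨a1, b1⟩ := hasSum_pnat_LFunction χ₁ (s := s₁ + t) (by simpa using h₁)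
  obtain ⟨a2, b2⟩ := hasSum_pnat_LFunction χ₂ (s := s₂ + t) (by simpa using h₂)
  constructor
  · have := a1.mul_of_nonneg a2 (fun _ => norm_nonneg _) (fun _ => norm_nonneg _)
    refine this.congr fun n => ?_
    rw [← norm_mul, ← coef_mul_cpow, norm_mul, norm_cpow_eq_rpow_re_of_pos (prodR_pos n), neg_re]
  · simp only [coef_mul_cpow]
    rw [← b1, ← b2]
    exact (tsum_mul_tsum_of_summable_norm a1 a2).symm

/-- The Mellin transform of `∑ coef n · e^{-c n₁n₂ v} B(c n₁n₂ v)`. -/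
lemma IsMultiplier.hasMellin_tsum_mulTerm {B : ℂ → ℂ} (hB : IsMultiplier B) {c : ℝ} (hc : 0 < c)
    {t m : ℂ} (hm : HasMellin (fun x : ℝ => cexp (-x) * B x) t m)
    (h₁ : 1 < s₁ + t.re) (h₂ : 1 < s₂ + t.re) :
    HasMellin (fun v : ℝ => ∑' n, mulTerm s₁ s₂ χ₁ χ₂ B (c * v) n) t
      (m * ((c : ℂ) ^ (-t) * (χ₁.LFunction (s₁ + t) * χ₂.LFunction (s₂ + t)))) := by
  obtain ⟨hs1, hs2⟩ := summable_coef_mul_cpow s₁ s₂ χ₁ χ₂ h₁ h₂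
  have hfun : ∀ v : ℝ, ∑' n, mulTerm s₁ s₂ χ₁ χ₂ B (c * v) n =
      ∑' n, coef s₁ s₂ χ₁ χ₂ n * (fun x : ℝ => cexp (-x) * B x) (c * prodR n * v) := fun v => by
    refine tsum_congr fun n => ?_
    simp only [mulTerm]
    push_cast
    rw [show (c : ℂ) * v * prodR n = c * prodR n * v by ring]
  have hsum : ∑' n, coef s₁ s₂ χ₁ χ₂ n * ((c * prodR n : ℝ) : ℂ) ^ (-t) =
      (c : ℂ) ^ (-t) * (χ₁.LFunction (s₁ + t) * χ₂.LFunction (s₂ + t)) := by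
    rw [← hs2, ← tsum_mul_left]
    refine tsum_congr fun n => ?_
    rw [ofReal_mul, mul_cpow_ofReal_nonneg hc.le (prodR_pos n).le]
    ring
  have hcont : ContinuousOn (fun v : ℝ => ∑' n, mulTerm s₁ s₂ χ₁ χ₂ B (c * v) n) (Set.Ioi 0) :=
    (hB.differentiableOn_tsum_mulTerm s₁ s₂ χ₁ χ₂).continuousOn.comp (by fun_prop)
      fun v (hv : 0 < v) => by
        change 0 < ((c : ℂ) * v).re
        simpa using mul_pos hc hv
  rw [← hsum, funext hfun]
  rw [funext hfun] at hcont
  have := hasMellin_tsum_comp_mul (a := coef s₁ s₂ χ₁ χ₂) (l := fun n => c * prodR n)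
    (k := fun x : ℝ => cexp (-x) * B x) (fun n => mul_pos hc (prodR_pos n)) hm
  refine this ?_ hcont
  refine (hs1.mul_left (c ^ (-t.re))).congr fun n => ?_
  rw [Real.mul_rpow hc.le (prodR_pos n).le]
  ring

end MellinSeries

/-! ### Growth in vertical strips -/

section Growth

/-- Mellin transforms are bounded in vertical strips. -/
lemma exists_norm_mellin_le {f : ℝ → ℂ} {a b : ℝ} (ha : MellinConvergent f a)
    (hb : MellinConvergent f b) :
    ∃ C : ℝ, 0 ≤ C ∧ ∀ t : ℂ, a ≤ t.re → t.re ≤ b → ‖mellin f t‖ ≤ C := by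
  set h : ℝ → ℝ := fun x => ‖(x : ℂ) ^ ((a : ℂ) - 1) • f x‖ + ‖(x : ℂ) ^ ((b : ℂ) - 1) • f x‖
    with hh
  have hi : IntegrableOn h (Set.Ioi 0) := ha.norm.add hb.norm
  refine ⟨∫ x in Set.Ioi (0 : ℝ), h x, integral_nonneg fun x => by positivity,
    fun t h1 h2 => ?_⟩
  refine norm_integral_le_of_norm_le hi ?_
  filter_upwards [ae_restrict_mem measurableSet_Ioi] with x (hx : 0 < x)
  simp only [hh, norm_smul, norm_cpow_eq_rpow_re_of_pos hx, ← add_mul]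
  refine mul_le_mul_of_nonneg_right ?_ (norm_nonneg _)
  simp only [sub_re, ofReal_re, one_re]
  rcases le_total 1 x with h | h
  · have := Real.rpow_le_rpow_of_exponent_le h (sub_le_sub_right h2 1)
    have := Real.rpow_nonneg hx.le (a - 1)
    linarith
  · have := Real.rpow_le_rpow_of_exponent_ge hx h (sub_le_sub_right h1 1)
    have := Real.rpow_nonneg hx.le (b - 1)
    linarith

lemma mellinConvergent_exp_neg {t : ℂ} (ht : 0 < t.re) :
    HasMellin (fun x : ℝ => cexp (-x)) t (Gamma t) := by
  refine ⟨?_, ?_⟩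
  · have := GammaIntegral_convergent ht
    refine this.congr_fun (fun x _ => ?_) measurableSet_Ioi
    simp [mul_comm]
  · rw [Gamma_eq_integral ht, GammaIntegral_eq_mellin]
    simp [mellin]

lemma exists_norm_Gamma_le_of_pos {a : ℝ} (ha : 0 < a) (b : ℝ) :
    ∃ C : ℝ, 0 ≤ C ∧ ∀ t : ℂ, a ≤ t.re → t.re ≤ b → ‖Gamma t‖ ≤ C := by
  rcases lt_or_ge 0 b with hb | hb
  · obtain ⟨C, hC, h⟩ := exists_norm_mellin_le (mellinConvergent_exp_neg (t := a) (by simpa)).1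
      (mellinConvergent_exp_neg (t := b) (by simpa)).1
    exact ⟨C, hC, fun t h1 h2 => by
      rw [← (mellinConvergent_exp_neg (ha.trans_le h1)).2]; exact h t h1 h2⟩
  · exact ⟨0, le_rfl, fun t h1 h2 => by linarith⟩

/-- Γ(t) = Γ(t+1)/t moves the strip to the right until its real part is positive, each step costing
at most |t|⁻¹ ≤ 2. The threshold 1/2 instead of 1 is needed for the argument 1 - t/2 in
`expGrowth_Gammaℝ_inv`. -/
lemma exists_norm_Gamma_le (a b : ℝ) : ∃ C : ℝ, 0 ≤ C ∧ ∀ t : ℂ, a ≤ t.re → t.re ≤ b →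
    1 / 2 ≤ |t.im| → ‖Gamma t‖ ≤ C := by
  obtain ⟨n, hn⟩ := exists_nat_gt (-a)
  induction n generalizing a b with
  | zero =>
    obtain ⟨C, hC, h⟩ := exists_norm_Gamma_le_of_pos (a := a) (by simpa using hn) b
    exact ⟨C, hC, fun t h1 h2 _ => h t h1 h2⟩
  | succ n ih =>
    obtain ⟨C, hC, h⟩ := ih (a + 1) (b + 1) (by push_cast at hn; linarith)
    refine ⟨2 * C, by positivity, fun t h1 h2 h3 => ?_⟩
    have ht : 1 / 2 ≤ ‖t‖ := h3.trans (abs_im_le_norm t)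
    have h0 : t ≠ 0 := fun h => by simp [h] at ht; linarith
    have := h (t + 1) (by simpa) (by simpa) (by simpa using h3)
    rw [Gamma_add_one t h0, norm_mul] at this
    nlinarith [norm_nonneg (Gamma t)]

/-- Exponential growth in a vertical strip, away from the real axis. -/
def ExpGrowth (a b : ℝ) (f : ℂ → ℂ) : Prop :=
  ∃ B c : ℝ, ∀ t : ℂ, a ≤ t.re → t.re ≤ b → 1 ≤ |t.im| → ‖f t‖ ≤ B * Real.exp (c * |t.im|)

lemma ExpGrowth.mul {a b : ℝ} {f g : ℂ → ℂ} (hf : ExpGrowth a b f) (hg : ExpGrowth a b g) :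
    ExpGrowth a b fun t => f t * g t := by
  obtain ⟨B, c, h⟩ := hf
  obtain ⟨B', c', h'⟩ := hg
  refine ⟨B * B', c + c', fun t h1 h2 h3 => ?_⟩
  rw [norm_mul, add_mul, Real.exp_add, mul_mul_mul_comm]
  exact mul_le_mul (h t h1 h2 h3) (h' t h1 h2 h3) (norm_nonneg _)
    ((norm_nonneg _).trans (h t h1 h2 h3))

lemma ExpGrowth.add {a b : ℝ} {f g : ℂ → ℂ} (hf : ExpGrowth a b f) (hg : ExpGrowth a b g) :
    ExpGrowth a b fun t => f t + g t := by
  obtain ⟨B, c, h⟩ := hf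
  obtain ⟨B', c', h'⟩ := hg
  refine ⟨|B| + |B'|, max c c', fun t h1 h2 h3 => ?_⟩
  have e1 : Real.exp (c * |t.im|) ≤ Real.exp (max c c' * |t.im|) :=
    Real.exp_le_exp.2 (mul_le_mul_of_nonneg_right (le_max_left _ _) (abs_nonneg _))
  have e2 : Real.exp (c' * |t.im|) ≤ Real.exp (max c c' * |t.im|) :=
    Real.exp_le_exp.2 (mul_le_mul_of_nonneg_right (le_max_right _ _) (abs_nonneg _))
  calc ‖f t + g t‖ ≤ ‖f t‖ + ‖g t‖ := norm_add_le _ _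
    _ ≤ |B| * Real.exp (c * |t.im|) + |B'| * Real.exp (c' * |t.im|) := by
      refine add_le_add ((h t h1 h2 h3).trans ?_) ((h' t h1 h2 h3).trans ?_)
      · exact mul_le_mul_of_nonneg_right (le_abs_self _) (Real.exp_pos _).le
      · exact mul_le_mul_of_nonneg_right (le_abs_self _) (Real.exp_pos _).le
    _ ≤ |B| * Real.exp (max c c' * |t.im|) + |B'| * Real.exp (max c c' * |t.im|) := by
      gcongr
    _ = _ := by ring

lemma expGrowth_of_bounded {a b C : ℝ} {f : ℂ → ℂ}
    (h : ∀ t : ℂ, a ≤ t.re → t.re ≤ b → 1 ≤ |t.im| → ‖f t‖ ≤ C) : ExpGrowth a b f :=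
  ⟨C, 0, fun t h1 h2 h3 => by simpa using h t h1 h2 h3⟩

lemma expGrowth_const (a b : ℝ) (z : ℂ) : ExpGrowth a b fun _ => z :=
  expGrowth_of_bounded fun _ _ _ _ => le_rfl

lemma ExpGrowth.sum {ι : Type*} {a b : ℝ} (S : Finset ι) {f : ι → ℂ → ℂ}
    (h : ∀ i ∈ S, ExpGrowth a b (f i)) : ExpGrowth a b fun t => ∑ i ∈ S, f i t := by
  classical
  induction S using Finset.induction_on with
  | empty => simpa using expGrowth_const a b 0
  | insert j S hj ih =>
    simp only [Finset.sum_insert hj]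
    exact (h j (Finset.mem_insert_self _ _)).add
      (ih fun i hi => h i (Finset.mem_insert_of_mem hi))

lemma ExpGrowth.comp_add {a b c : ℝ} {f : ℂ → ℂ} (hf : ExpGrowth (c + a) (c + b) f) :
    ExpGrowth a b fun t => f (c + t) := by
  obtain ⟨B, k, h⟩ := hf
  refine ⟨B, k, fun t h1 h2 h3 => ?_⟩
  have := h (c + t) (by simpa) (by simpa) (by simpa using h3)
  simpa using this

lemma expGrowth_cpow (a b : ℝ) {x : ℝ} (hx : 0 < x) (c : ℂ) :
    ExpGrowth a b fun t => (x : ℂ) ^ (c * t) := by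
  obtain ⟨C, hC⟩ := (isCompact_Icc (a := a) (b := b)).exists_bound_of_continuousOn
    (f := fun σ : ℝ => x ^ (c.re * σ))
    (((continuous_const.rpow (continuous_const.mul continuous_id)) fun _ => Or.inl hx.ne').continuousOn)
  refine ⟨C, |Real.log x * c.im|, fun t h1 h2 h3 => ?_⟩
  rw [norm_cpow_eq_rpow_re_of_pos hx, mul_re, sub_eq_add_neg, Real.rpow_add hx]
  have h4 := hC t.re ⟨h1, h2⟩
  rw [Real.norm_of_nonneg (Real.rpow_nonneg hx.le _)] at h4
  refine mul_le_mul h4 ?_ (Real.rpow_nonneg hx.le _) ((Real.rpow_nonneg hx.le _).trans h4)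
  rw [Real.rpow_def_of_pos hx, Real.exp_le_exp, ← abs_mul]
  calc _ = -(Real.log x * c.im * t.im) := by ring
    _ ≤ _ := neg_le_abs _

lemma norm_sin_le_exp (z : ℂ) : ‖sin z‖ ≤ Real.exp |z.im| := by
  rw [sin]
  have h1 : ‖cexp (-z * I)‖ ≤ Real.exp |z.im| := by
    rw [norm_exp]
    exact Real.exp_le_exp.2 (by simpa using le_abs_self z.im)
  have h2 : ‖cexp (z * I)‖ ≤ Real.exp |z.im| := by
    rw [norm_exp]
    exact Real.exp_le_exp.2 (by simpa using neg_le_abs z.im)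
  rw [norm_div, norm_mul, norm_I, mul_one, Complex.norm_two]
  linarith [norm_sub_le (cexp (-z * I)) (cexp (z * I))]

/-- By reflection 1/Γ(t/2) = Γ(1 - t/2) sin(πt/2)/π, where the Gamma factor is bounded and the sine
grows exponentially. -/
lemma expGrowth_Gammaℝ_inv (a b : ℝ) : ExpGrowth a b fun t => (Gammaℝ t)⁻¹ := by
  have h1 : (fun t => (Gammaℝ t)⁻¹) =
      fun t => (π : ℂ) ^ ((1 / 2 : ℂ) * t) * (Gamma (t / 2))⁻¹ := by
    ext t
    rw [Gammaℝ_def, mul_inv, ← cpow_neg]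
    congr 2; ring
  rw [h1]
  refine (expGrowth_cpow a b Real.pi_pos _).mul ?_
  obtain ⟨C, hC, h⟩ := exists_norm_Gamma_le (1 - b / 2) (1 - a / 2)
  refine ⟨C / π, π / 2, fun t h2 h3 h4 => ?_⟩
  have hG : Gamma (1 - t / 2) ≠ 0 := by
    refine Gamma_ne_zero fun m hm => ?_
    have := congrArg im hm
    simp only [sub_im, one_im, neg_im, natCast_im, neg_zero, zero_sub, neg_eq_zero] at this
    rw [div_ofNat_im] at this
    have h0 : t.im = 0 := by linarith
    simp [h0] at h4
    linarith
  have hbd := h (1 - t / 2) (by simp; linarith) (by simp; linarith) (by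
    simp only [sub_im, one_im, div_ofNat_im, zero_sub, abs_neg, abs_div, Nat.abs_ofNat]
    linarith)
  have hrefl : (Gamma (t / 2))⁻¹ = Gamma (1 - t / 2) * (sin (π * (t / 2)) / π) := by
    have := Complex.Gamma_mul_Gamma_one_sub (t / 2)
    have h5 : sin (π * (t / 2)) ≠ 0 := by
      intro h6
      rw [h6, div_zero] at this
      rcases mul_eq_zero.1 this with h7 | h7
      · refine Gamma_ne_zero (fun m hm => ?_) h7
        have := congrArg im hm
        simp [div_ofNat_im] at this
        simp [this] at h4
        linarith
      · exact hG h7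
    have hpi : (π : ℂ) ≠ 0 := ofReal_ne_zero.2 Real.pi_ne_zero
    rw [eq_div_iff h5] at this
    refine inv_eq_of_mul_eq_one_right ?_
    rw [← mul_assoc, ← mul_div_assoc, this, div_self hpi]
  change ‖(Gamma (t / 2))⁻¹‖ ≤ _
  rw [hrefl, norm_mul, norm_div, norm_real, Real.norm_of_nonneg Real.pi_pos.le]
  have hsin := norm_sin_le_exp (π * (t / 2))
  have him : |((π : ℂ) * (t / 2)).im| = π / 2 * |t.im| := by
    rw [im_ofReal_mul, div_ofNat_im, abs_mul, abs_div, abs_of_pos Real.pi_pos]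
    simp; ring
  rw [him] at hsin
  calc _ ≤ C * (Real.exp (π / 2 * |t.im|) / π) := by gcongr
    _ = _ := by ring

/-- The Λ of a strong functional-equation pair is a convergent Mellin transform at every point,
hence bounded on vertical strips. -/
lemma expGrowth_strongFEPair {P : WeakFEPair ℂ} (hP : IsStrongFEPair P) (a b : ℝ) (c d : ℝ)
    (hc : 0 < c) : ExpGrowth a b fun t => P.Λ (c * t + d) := by
  obtain ⟨C, hC, h⟩ := exists_norm_mellin_le (f := P.f) (hP.hasMellin (c * a + d : ℝ)).1
    (hP.hasMellin (c * b + d : ℝ)).1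
  refine expGrowth_of_bounded (C := C) fun t h1 h2 h3 => ?_
  rw [hP.Λ_eq]
  exact h _ (by simp; nlinarith) (by simp; nlinarith)

/-- The completed L-function splits into entire even and odd Hurwitz parts, which come from strong
functional-equation pairs, and explicit multiples of 1/s and 1/(1 - s), which are bounded for |im s|
≥ 1. -/
lemma expGrowth_completedLFunction {r : ℕ} [NeZero r] (χ : DirichletCharacter ℂ r) (a b : ℝ) :
    ExpGrowth a b χ.completedLFunction := by
  have hr : (0 : ℝ) < r := by exact_mod_cast Nat.pos_of_ne_zero (NeZero.ne r)
  have hpow : ExpGrowth a b fun t => (r : ℂ) ^ (-t) := by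
    have := expGrowth_cpow a b hr (-1)
    simpa using this
  have hfun : χ.completedLFunction = fun s => ((r : ℂ) ^ (-s) * ∑ j : ZMod r,
      χ j * HurwitzZeta.completedHurwitzZetaEven₀ (ZMod.toAddCircle j) s
    + (r : ℂ) ^ (-s) * ∑ j : ZMod r, χ j * HurwitzZeta.completedHurwitzZetaOdd (ZMod.toAddCircle j) s)
    + (-χ 0) * ((r : ℂ) ^ (-s) * s⁻¹) + (-∑ j, χ j) * ((r : ℂ) ^ (-s) * (1 - s)⁻¹) := by
    ext s
    rw [DirichletCharacter.completedLFunction, ZMod.completedLFunction_eq, ZMod.completedLFunction₀]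
    ring
  rw [hfun]
  refine (((hpow.mul (ExpGrowth.sum _ fun j _ => (expGrowth_const _ _ _).mul ?_)).add
    (hpow.mul (ExpGrowth.sum _ fun j _ => (expGrowth_const _ _ _).mul ?_))).add
    ((expGrowth_const _ _ _).mul (hpow.mul ?_))).add ((expGrowth_const _ _ _).mul (hpow.mul ?_))
  · have h := expGrowth_strongFEPair
      (HurwitzZeta.hurwitzEvenFEPair (ZMod.toAddCircle j)).isStrongFEPair_toStrongFEPair
      a b (1 / 2) 0 (by norm_num)
    have h2 := (expGrowth_const a b (1 / 2)).mul h
    convert h2 using 2 with t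
    rw [HurwitzZeta.completedHurwitzZetaEven₀, WeakFEPair.Λ₀,
      (HurwitzZeta.hurwitzEvenFEPair (ZMod.toAddCircle j)).isStrongFEPair_toStrongFEPair.Λ_eq]
    push_cast
    rw [show (1 / 2 : ℂ) * t + 0 = t / 2 by ring, div_eq_mul_inv, mul_comm, one_div]
    rfl
  · have h := expGrowth_strongFEPair (HurwitzZeta.isStrong_hurwitzOddFEPair (ZMod.toAddCircle j))
      a b (1 / 2) (1 / 2) (by norm_num)
    have h2 := (expGrowth_const a b (1 / 2)).mul h
    convert h2 using 2 with t
    rw [HurwitzZeta.completedHurwitzZetaOdd]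
    push_cast
    rw [show (1 / 2 : ℂ) * t + 1 / 2 = (t + 1) / 2 by ring]
    ring
  · refine expGrowth_of_bounded (C := 1) fun t h1 h2 h3 => ?_
    rw [norm_inv]
    exact inv_le_one_of_one_le₀ (h3.trans (abs_im_le_norm t))
  · refine expGrowth_of_bounded (C := 1) fun t h1 h2 h3 => ?_
    rw [norm_inv]
    refine inv_le_one_of_one_le₀ (le_trans ?_ (abs_im_le_norm (1 - t)))
    simpa using h3

lemma expGrowth_congr {a b : ℝ} {f g : ℂ → ℂ} (hf : ExpGrowth a b f)
    (h : ∀ t : ℂ, 1 ≤ |t.im| → f t = g t) : ExpGrowth a b g := by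
  obtain ⟨B, c, hb⟩ := hf
  exact ⟨B, c, fun t h1 h2 h3 => by rw [← h t h3]; exact hb t h1 h2 h3⟩

lemma expGrowth_LFunction {r : ℕ} [NeZero r] (χ : DirichletCharacter ℂ r) (a b : ℝ) :
    ExpGrowth a b χ.LFunction := by
  have hg : ExpGrowth a b fun t => (χ.gammaFactor t)⁻¹ := by
    rcases χ.even_or_odd with h | h
    · simpa only [h.gammaFactor_def] using expGrowth_Gammaℝ_inv a b
    · simp only [h.gammaFactor_def]
      have := (expGrowth_Gammaℝ_inv (1 + a) (1 + b)).comp_add (c := 1)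
      simpa only [ofReal_one, add_comm] using this
  refine expGrowth_congr ((expGrowth_completedLFunction χ a b).mul hg) fun t ht => ?_
  rw [χ.LFunction_eq_completed_div_gammaFactor t (Or.inl ?_), div_eq_mul_inv]
  rintro rfl
  simp at ht
  linarith

end Growth

/-! ### Decay of the Gamma function -/

section GammaDecay

lemma one_add_im_sq_le {t : ℂ} {σ : ℝ} (hσ : 0 < σ) (ht : t.re = σ) :
    min 1 (σ ^ 2) * (1 + t.im ^ 2) ≤ ‖t‖ * ‖t + 1‖ := by
  set c := min 1 (σ ^ 2) with hc
  have hc0 : 0 < c := lt_min one_pos (by positivity)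
  have h1 : c * (1 + t.im ^ 2) ≤ ‖t‖ ^ 2 := by
    rw [← normSq_eq_norm_sq, normSq_apply, ht]
    nlinarith [min_le_left 1 (σ ^ 2), min_le_right 1 (σ ^ 2), sq_nonneg t.im]
  have h2 : c * (1 + t.im ^ 2) ≤ ‖t + 1‖ ^ 2 := by
    rw [← normSq_eq_norm_sq, normSq_apply]
    simp only [add_re, one_re, add_im, one_im, add_zero, ht]
    nlinarith [min_le_left 1 (σ ^ 2), min_le_right 1 (σ ^ 2), sq_nonneg t.im]
  have hx : 0 ≤ c * (1 + t.im ^ 2) := by positivity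
  have := mul_le_mul h1 h2 hx (sq_nonneg _)
  rw [← mul_pow, ← sq] at this
  exact le_of_sq_le_sq this (by positivity)

/-- Each double shift Γ(t+2) = (t+1) t Γ(t) gains one factor 1 + im², so boundedness on lines
further to the right gives decay of any polynomial order. -/
lemma exists_norm_Gamma_mul_le (N : ℕ) {σ : ℝ} (hσ : 0 < σ) :
    ∃ C : ℝ, 0 ≤ C ∧ ∀ t : ℂ, t.re = σ → ‖Gamma t‖ * (1 + t.im ^ 2) ^ N ≤ C := by
  induction N generalizing σ with
  | zero =>
    obtain ⟨C, hC, h⟩ := exists_norm_Gamma_le_of_pos hσ σ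
    exact ⟨C, hC, fun t ht => by simpa using h t ht.ge ht.le⟩
  | succ N ih =>
    obtain ⟨C, hC, h⟩ := ih (σ := σ + 2) (by linarith)
    have hc0 : 0 < min 1 (σ ^ 2) := lt_min one_pos (by positivity)
    refine ⟨C / min 1 (σ ^ 2), by positivity, fun t ht => ?_⟩
    have h0 : t ≠ 0 := fun h => by rw [h] at ht; simp at ht; linarith
    have h1 : t + 1 ≠ 0 := fun h => by
      have := congrArg re h; simp [ht] at this; linarith
    have h2 := h (t + 2) (by simp [ht])
    have h3 : Gamma (t + 2) = (t + 1) * (t * Gamma t) := by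
      rw [← Gamma_add_one t h0, ← Gamma_add_one _ h1]; ring_nf
    rw [h3, norm_mul, norm_mul] at h2
    simp only [add_im, im_ofNat, add_zero] at h2
    rw [le_div_iff₀ hc0]
    refine le_trans ?_ h2
    have h4 := one_add_im_sq_le hσ ht
    calc _ = ‖Gamma t‖ * (1 + t.im ^ 2) ^ N * (min 1 (σ ^ 2) * (1 + t.im ^ 2)) := by ring
      _ ≤ ‖Gamma t‖ * (1 + t.im ^ 2) ^ N * (‖t‖ * ‖t + 1‖) := by gcongr
      _ = _ := by ring

lemma exists_norm_Gamma_add_div_le (m : ℕ) {σ : ℝ} (hσ : 0 < σ) :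
    ∃ C : ℝ, 0 ≤ C ∧ ∀ t : ℂ, t.re = σ → ‖Gamma (t + m) / Gamma t‖ ≤ C * (1 + t.im ^ 2) ^ m := by
  induction m with
  | zero =>
    refine ⟨1, zero_le_one, fun t ht => ?_⟩
    have : Gamma t ≠ 0 := Gamma_ne_zero_of_re_pos (by rw [ht]; exact hσ)
    simp [this]
  | succ m ih =>
    obtain ⟨C, hC, h⟩ := ih
    refine ⟨C * (σ + m + 1), by positivity, fun t ht => ?_⟩
    have h1 : t + m ≠ 0 := fun h => by
      have := congrArg re h
      simp only [add_re, ht, natCast_re, zero_re] at this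
      have : 0 < σ + m := by positivity
      linarith
    have h2 : Gamma (t + (m + 1 : ℕ)) = (t + m) * Gamma (t + m) := by
      rw [← Gamma_add_one _ h1]; push_cast; ring_nf
    have h3 : ‖t + m‖ ≤ (σ + m + 1) * (1 + t.im ^ 2) := by
      refine (norm_le_abs_re_add_abs_im _).trans ?_
      simp only [add_re, natCast_re, add_im, natCast_im, add_zero, ht]
      rw [abs_of_pos (by positivity)]
      have e1 : |t.im| ≤ 1 + t.im ^ 2 := by
        rw [← sq_abs]; nlinarith [sq_nonneg (|t.im| - 1), abs_nonneg t.im]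
      have e2 : 0 ≤ (σ + m) * t.im ^ 2 := by positivity
      nlinarith
    rw [h2, mul_div_assoc, norm_mul, pow_succ]
    calc _ ≤ (σ + m + 1) * (1 + t.im ^ 2) * (C * (1 + t.im ^ 2) ^ m) :=
        mul_le_mul h3 (h t ht) (norm_nonneg _) (by positivity)
      _ = _ := by ring

lemma exists_norm_Gamma_div_add_le (m : ℕ) {σ : ℝ} (hσ : 0 < σ) :
    ∃ C : ℝ, 0 ≤ C ∧ ∀ t : ℂ, t.re = σ → ‖Gamma t / Gamma (t + m)‖ ≤ C := by
  induction m with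
  | zero =>
    refine ⟨1, zero_le_one, fun t ht => ?_⟩
    have : Gamma t ≠ 0 := Gamma_ne_zero_of_re_pos (by rw [ht]; exact hσ)
    simp [this]
  | succ m ih =>
    obtain ⟨C, hC, h⟩ := ih
    refine ⟨C / σ, by positivity, fun t ht => ?_⟩
    have h3 : σ ≤ ‖t + m‖ := by
      refine le_trans ?_ (re_le_norm _)
      simp [ht]
    have h1 : t + m ≠ 0 := fun h => by simp [h] at h3; linarith
    have h2 : Gamma (t + (m + 1 : ℕ)) = (t + m) * Gamma (t + m) := by
      rw [← Gamma_add_one _ h1]; push_cast; ring_nf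
    rw [h2, mul_comm, ← div_div, norm_div]
    exact div_le_div₀ hC (h t ht) hσ h3

/-- The quotient `Γ(v + s₁) Γ(v + s₂) / Γ(v + s₁ + s₂)` decays on vertical lines. -/
lemma exists_norm_Gamma_mul_Gamma_div_le (s₁ s₂ : ℤ) {σ : ℝ} (h₁ : 0 < σ + s₁) (h₂ : 0 < σ + s₂)
    (h : 0 < σ + s₁ + s₂) : ∃ C : ℝ, 0 ≤ C ∧ ∀ v : ℂ, v.re = σ →
      ‖Gamma (v + s₁) * Gamma (v + s₂) / Gamma (v + s₁ + s₂)‖ ≤ C / (1 + v.im ^ 2) := by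
  -- The quotient of Gamma values at an integer distance costs at most a power (1 + im²)^N; the
  -- remaining factor Γ(v + s₂) repays N + 1 such powers.
  obtain ⟨N, C₁, hC₁, hq⟩ : ∃ (N : ℕ) (C₁ : ℝ), 0 ≤ C₁ ∧ ∀ v : ℂ, v.re = σ →
      ‖Gamma (v + s₁) / Gamma (v + s₁ + s₂)‖ ≤ C₁ * (1 + v.im ^ 2) ^ N := by
    rcases le_total 0 s₂ with hs | hs
    · obtain ⟨m, rfl⟩ := Int.eq_ofNat_of_zero_le hs
      obtain ⟨C, hC, hb⟩ := exists_norm_Gamma_div_add_le m h₁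
      refine ⟨0, C, hC, fun v hv => ?_⟩
      have := hb (v + s₁) (by simp [hv])
      simpa using this
    · obtain ⟨m, hm⟩ := Int.eq_ofNat_of_zero_le (neg_nonneg.2 hs)
      obtain ⟨C, hC, hb⟩ := exists_norm_Gamma_add_div_le m h
      refine ⟨m, C, hC, fun v hv => ?_⟩
      have := hb (v + s₁ + s₂) (by simp [hv])
      have e : v + s₁ + s₂ + m = v + s₁ := by
        have : (m : ℂ) = -(s₂ : ℂ) := by
          have := congrArg (Int.cast : ℤ → ℂ) hm
          push_cast at this; exact this.symm
        rw [this]; ring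
      rw [e] at this
      simpa using this
  obtain ⟨C₂, hC₂, hd⟩ := exists_norm_Gamma_mul_le (N + 1) h₂
  refine ⟨C₁ * C₂, by positivity, fun v hv => ?_⟩
  have hpos : 0 < 1 + v.im ^ 2 := by positivity
  have h3 := hd (v + s₂) (by simp [hv])
  simp only [add_im, intCast_im, add_zero] at h3
  rw [le_div_iff₀ hpos, mul_div_right_comm, norm_mul]
  calc _ ≤ C₁ * (1 + v.im ^ 2) ^ N * ‖Gamma (v + s₂)‖ * (1 + v.im ^ 2) := by
        gcongr; exact hq v hv
    _ = C₁ * (‖Gamma (v + s₂)‖ * (1 + v.im ^ 2) ^ (N + 1)) := by ring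
    _ ≤ _ := by gcongr

end GammaDecay

/-! ### The functional equation -/

section FunctionalEquation

lemma parity_sign {r : ℕ} (χ : DirichletCharacter ℂ r) : χ (-1) = (-1) ^ parity χ := by
  rcases χ.even_or_odd with h | h
  · rw [parity, if_pos h, pow_zero]; exact h
  · rw [parity, if_neg h.not_even, pow_one]; exact h

/-- The asymmetric form of the functional equation of a primitive `L`-function. -/
lemma LFunction_one_sub_of_isPrimitive {r : ℕ} [NeZero r] {χ : DirichletCharacter ℂ r}
    (hχ : χ.IsPrimitive) {s : ℂ} (hs : ∀ n : ℕ, s ≠ -n) (hs' : s ≠ 1) :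
    χ.LFunction (1 - s) = (r : ℂ) ^ (s - 1) * (2 * π) ^ (-s) * Gamma s *
      gaussSum χ ZMod.stdAddChar * ((-1) ^ parity χ * cexp (π * I * s / 2) +
        cexp (-π * I * s / 2)) * (star χ).LFunction s := by
  rw [MulChar.star_eq_inv]
  have hσ : χ (-1) * χ⁻¹ (-1) = 1 := by
    rw [← MulChar.mul_apply, mul_inv_cancel, MulChar.one_apply isUnit_one.neg]
  have hσ2 : χ (-1) * χ (-1) = 1 := by rw [← map_mul]; simp
  have hinv : χ⁻¹ (-1) = χ (-1) := by
    calc χ⁻¹ (-1) = χ⁻¹ (-1) * (χ (-1) * χ (-1)) := by rw [hσ2, mul_one]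
      _ = χ (-1) * χ⁻¹ (-1) * χ (-1) := by ring
      _ = χ (-1) := by rw [hσ, one_mul]
  -- By primitivity the Fourier transform of χ is a Gauss sum times a conjugate character value, so
  -- both series in the general functional equation are multiples of L(χ̄, s).
  have h𝓕 : ∀ j, (ZMod.dft χ) j = χ (-1) * gaussSum χ ZMod.stdAddChar * χ⁻¹ j := fun j => by
    rw [hχ.fourierTransform_eq_inv_mul_gaussSum, ← neg_one_mul j, map_mul, hinv]
    ring
  have hL : ∀ c : ℂ, ZMod.LFunction (fun j => c * χ⁻¹ j) s = c * χ⁻¹.LFunction s := fun c => by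
    rw [DirichletCharacter.LFunction, ZMod.LFunction, ZMod.LFunction, Finset.mul_sum,
      Finset.mul_sum, Finset.mul_sum]
    exact Finset.sum_congr rfl fun j _ => by ring
  have h1 : ZMod.LFunction (ZMod.dft χ) s =
      χ (-1) * gaussSum χ ZMod.stdAddChar * χ⁻¹.LFunction s := by
    rw [← hL]; congr 1; exact funext h𝓕
  have h2 : ZMod.LFunction (ZMod.dft fun x => χ (-x)) s =
      gaussSum χ ZMod.stdAddChar * χ⁻¹.LFunction s := by
    rw [← hL]
    congr 1
    have : (fun x => χ (-x)) = fun x => χ (-1) • χ x := by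
      ext x; rw [← neg_one_mul, map_mul, smul_eq_mul]
    rw [this]
    have h3 : ZMod.dft (fun x => χ (-1) • χ x) = χ (-1) • ZMod.dft χ :=
      ZMod.dft_const_smul (χ (-1)) χ
    rw [h3]
    ext j
    rw [Pi.smul_apply, h𝓕, smul_eq_mul]
    linear_combination (gaussSum χ ZMod.stdAddChar * χ⁻¹ j) * hσ2
  rw [DirichletCharacter.LFunction, ZMod.LFunction_one_sub _ hs (Or.inr hs')]
  rw [h1, h2, ← parity_sign]
  ring

lemma gaussSum_eq_rootNumber {r : ℕ} [NeZero r] (χ : DirichletCharacter ℂ r) :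
    χ.rootNumber * I ^ parity χ * (r : ℂ) ^ ((1 : ℂ) / 2) = gaussSum χ ZMod.stdAddChar := by
  have hr : (r : ℂ) ^ ((1 : ℂ) / 2) ≠ 0 := by
    rw [cpow_ne_zero_iff]; exact Or.inl (NeZero.ne _)
  have hI : I ^ parity χ ≠ 0 := pow_ne_zero _ I_ne_zero
  rw [DirichletCharacter.rootNumber]
  simp only [parity] at hI ⊢
  field_simp

variable {r₁ r₂ : ℕ} [NeZero r₁] [NeZero r₂] {s₁ s₂ : ℤ} {χ₁ : DirichletCharacter ℂ r₁}
  {χ₂ : DirichletCharacter ℂ r₂}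

/-- The factors √r and i^κ of the root numbers cancel against the half-integral powers and
i^{κ₁+κ₂}. What is left are integral powers and Gauss sums, as the functional equations produce
them. -/
lemma frickeConst_eq : frickeConst s₁ s₂ χ₁ χ₂ = (r₁ : ℂ) ^ (-s₁) * (r₂ : ℂ) ^ (-s₂) *
    (gaussSum χ₁ ZMod.stdAddChar * gaussSum χ₂ ZMod.stdAddChar) := by
  have h1 : (r₁ : ℂ) ≠ 0 := NeZero.ne _
  have h2 : (r₂ : ℂ) ≠ 0 := NeZero.ne _
  rw [← gaussSum_eq_rootNumber, ← gaussSum_eq_rootNumber, frickeConst, sub_eq_add_neg,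
    sub_eq_add_neg, cpow_add _ _ h1, cpow_add _ _ h2, ← Int.cast_neg, ← Int.cast_neg, cpow_intCast,
    cpow_intCast, pow_add]
  ring

/-- The Mellin transform of `y ↦ Ξ(i y)`. -/
noncomputable def mellinXi {r₁ r₂ : ℕ} [NeZero r₁] [NeZero r₂] (s₁ s₂ : ℤ)
    (χ₁ : DirichletCharacter ℂ r₁) (χ₂ : DirichletCharacter ℂ r₂) (t : ℂ) : ℂ :=
  Gamma t * (((2 * π : ℝ) : ℂ) ^ (-t) * (χ₁.LFunction (s₁ + t) * χ₂.LFunction (s₂ + t)))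

/-- In terms of q = e^{πit/2} each factor is a combination of q and q⁻¹. The parity condition
cancels the two mixed terms (`a3`) and gives q² and q⁻² opposite coefficients (`a1`, `a2`), leaving
a sine. -/
lemma trig_product {κ₁ κ₂ : ℕ} (hpar : s₁ + s₂ ≡ κ₁ + κ₂ + 1 [ZMOD 2]) (t : ℂ) :
    ((-1) ^ κ₁ * cexp (π * I * (1 - (s₁ + t)) / 2) + cexp (-π * I * (1 - (s₁ + t)) / 2)) *
    ((-1) ^ κ₂ * cexp (π * I * (1 - (s₂ + t)) / 2) + cexp (-π * I * (1 - (s₂ + t)) / 2)) =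
      2 * I ^ (s₁ + s₂ - 1) * sin (π * t) := by
  set q := cexp (π * I * t / 2) with hq
  have hq0 : q ≠ 0 := exp_ne_zero _
  have hI : ∀ n : ℤ, cexp (n * (π / 2 * I)) = I ^ n := fun n => by
    rw [exp_int_mul, exp_pi_div_two_mul_I]
  have hE : ∀ s : ℤ, cexp (π * I * (1 - (s + t)) / 2) = I ^ (1 - s) * q⁻¹ ∧
      cexp (-π * I * (1 - (s + t)) / 2) = I ^ (s - 1) * q := fun s => by
    rw [hq, ← exp_neg, ← hI, ← hI, ← exp_add, ← exp_add]
    constructor <;> congr 1 <;> push_cast <;> ring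
  have hsin : sin (π * t) = (q⁻¹ ^ 2 - q ^ 2) * I / 2 := by
    rw [sin, hq, ← exp_neg, ← exp_nat_mul, ← exp_nat_mul]
    congr 3 <;> congr 1 <;> push_cast <;> ring
  have hI2 : ∀ n : ℤ, (I : ℂ) ^ (2 * n) = (-1) ^ n := fun n => by
    rw [zpow_mul]; norm_num
  obtain ⟨d, hd⟩ : ∃ d : ℤ, s₁ + s₂ - (κ₁ + κ₂ + 1) = 2 * d := by
    obtain ⟨d, hd⟩ := hpar.symm.dvd
    exact ⟨d, hd⟩
  have hs : s₂ = 2 * d + (κ₁ + κ₂ + 1) - s₁ := by omega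
  have e1 : ((-1 : ℂ)) ^ κ₁ = I ^ (2 * (κ₁ : ℤ)) := by rw [hI2, zpow_natCast]
  have e2 : ((-1 : ℂ)) ^ κ₂ = I ^ (2 * (κ₂ : ℤ)) := by rw [hI2, zpow_natCast]
  have h4 : ∀ n : ℤ, (I : ℂ) ^ (4 * n) = 1 := fun n => by
    rw [zpow_mul]; norm_num
  rw [(hE s₁).1, (hE s₁).2, (hE s₂).1, (hE s₂).2, hsin, e1, e2]
  have a1 : (I : ℂ) ^ (2 * (κ₁ : ℤ)) * I ^ (1 - s₁) * (I ^ (2 * (κ₂ : ℤ)) * I ^ (1 - s₂)) =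
      I ^ (s₁ + s₂ - 1) * I := by
    rw [← zpow_add₀ I_ne_zero, ← zpow_add₀ I_ne_zero, ← zpow_add₀ I_ne_zero,
      ← zpow_add_one₀ I_ne_zero]
    rw [show 2 * (κ₁ : ℤ) + (1 - s₁) + (2 * (κ₂ : ℤ) + (1 - s₂)) =
      (s₁ + s₂ - 1 + 1) + 4 * (-d) by omega, zpow_add₀ I_ne_zero, h4, mul_one]
  have a2 : (I : ℂ) ^ (s₁ - 1) * I ^ (s₂ - 1) = - (I ^ (s₁ + s₂ - 1) * I) := by
    rw [← zpow_add₀ I_ne_zero, ← zpow_add_one₀ I_ne_zero,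
      show s₁ + s₂ - 1 + 1 = (s₁ - 1 + (s₂ - 1)) + 2 * 1 by ring, zpow_add₀ I_ne_zero _ (2 * 1),
      hI2]
    simp
  have a3 : (I : ℂ) ^ (2 * (κ₁ : ℤ)) * I ^ (1 - s₁) * I ^ (s₂ - 1) +
      I ^ (s₁ - 1) * (I ^ (2 * (κ₂ : ℤ)) * I ^ (1 - s₂)) = 0 := by
    rw [← zpow_add₀ I_ne_zero, ← zpow_add₀ I_ne_zero, ← zpow_add₀ I_ne_zero,
      ← zpow_add₀ I_ne_zero]
    have : (2 * (κ₁ : ℤ) + (1 - s₁) + (s₂ - 1)) =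
      (s₁ - 1 + (2 * (κ₂ : ℤ) + (1 - s₂))) + 2 * (2 * (d + κ₁ - s₁) + 1) := by omega
    rw [this, zpow_add₀ I_ne_zero _ (2 * _), hI2, zpow_add_one₀ (by norm_num), zpow_mul]
    norm_num
  have hqq : q * q⁻¹ = 1 := mul_inv_cancel₀ hq0
  linear_combination q⁻¹ ^ 2 * a1 + q ^ 2 * a2 + a3 + ((I : ℂ) ^ (2 * (κ₁ : ℤ)) * I ^ (1 - s₁) * I ^ (s₂ - 1) +
      I ^ (s₁ - 1) * (I ^ (2 * (κ₂ : ℤ)) * I ^ (1 - s₂))) * hqq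

/-- Since 1 - (s₁+t) = s₂+v, the functional equation sends L(χ₁, s₁+t) to L(χ̄₁, s₂+v) and likewise
with the indices exchanged; hence the dual characters appear in swapped order. Then Γ(t) sin(πt) =
π/Γ(1-t) with 1 - t = v+s₁+s₂. Nonintegral t avoids all exceptional points. -/
lemma mellinXi_functional_equation (h₁ : χ₁.IsPrimitive) (h₂ : χ₂.IsPrimitive)
    (hpar : s₁ + s₂ ≡ parity χ₁ + parity χ₂ + 1 [ZMOD 2]) {t v : ℂ} (ht : ∀ n : ℤ, t ≠ n)
    (hv : v = 1 - (s₁ + s₂) - t) :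
    mellinXi s₁ s₂ χ₁ χ₂ t = frickeConst s₁ s₂ χ₁ χ₂ * ((r₁ : ℂ) * r₂ * I) ^ (s₁ + s₂ - 1) *
      ((Gamma (v + s₁) * Gamma (v + s₂) / Gamma (v + s₁ + s₂)) *
        (((2 * π / (r₁ * r₂) : ℝ) : ℂ) ^ (-v) *
          ((star χ₂).LFunction (s₁ + v) * (star χ₁).LFunction (s₂ + v)))) := by
  have p1 : (0 : ℝ) < r₁ := by exact_mod_cast Nat.pos_of_ne_zero (NeZero.ne r₁)
  have p2 : (0 : ℝ) < r₂ := by exact_mod_cast Nat.pos_of_ne_zero (NeZero.ne r₂)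
  have n1 : (r₁ : ℂ) ≠ 0 := NeZero.ne _
  have n2 : (r₂ : ℂ) ≠ 0 := NeZero.ne _
  have hpi : (0 : ℝ) < 2 * π := by positivity
  have npi : ((2 * π : ℝ) : ℂ) ≠ 0 := ofReal_ne_zero.2 hpi.ne'
  have hne : ∀ s : ℤ, (∀ n : ℕ, 1 - (s + t) ≠ -n) ∧ 1 - (s + t) ≠ 1 := fun s =>
    ⟨fun n h => ht (1 - s + n) (by push_cast; linear_combination -h),
      fun h => ht (-s) (by push_cast; linear_combination -h)⟩
  have f1 := LFunction_one_sub_of_isPrimitive h₁ (hne s₁).1 (hne s₁).2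
  have f2 := LFunction_one_sub_of_isPrimitive h₂ (hne s₂).1 (hne s₂).2
  rw [sub_sub_cancel] at f1 f2
  have htrig := trig_product hpar t
  have hrefl : Gamma t * sin (π * t) * Gamma (1 - t) = π := by
    have hsin : sin (π * t) ≠ 0 := by
      rw [Ne, sin_eq_zero_iff]
      rintro ⟨k, hk⟩
      refine ht k ?_
      have : (π : ℂ) ≠ 0 := ofReal_ne_zero.2 Real.pi_ne_zero
      exact mul_left_cancel₀ this (by rw [hk]; ring)
    have := Complex.Gamma_mul_Gamma_one_sub t
    rw [eq_div_iff hsin] at this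
    linear_combination this
  have hG1 : Gamma (1 - t) ≠ 0 :=
    Gamma_ne_zero fun m hm => ht (1 + m) (by push_cast; linear_combination -hm)
  have e1 : 1 - ((s₁ : ℂ) + t) = v + s₂ := by rw [hv]; ring
  have e2 : 1 - ((s₂ : ℂ) + t) = v + s₁ := by rw [hv]; ring
  have e3 : v + s₁ + s₂ = 1 - t := by rw [hv]; ring
  have hc : ((2 * π / (r₁ * r₂) : ℝ) : ℂ) ^ (-v) =
      ((2 * π : ℝ) : ℂ) ^ (-v) * ((r₁ : ℂ) ^ v * (r₂ : ℂ) ^ v) := by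
    rw [div_eq_mul_inv, ofReal_mul, mul_cpow_ofReal_nonneg hpi.le (by positivity), ofReal_inv,
      inv_cpow _ _ (by rw [arg_ofReal_of_nonneg (by positivity)]; exact Real.pi_pos.ne),
      cpow_neg ((r₁ * r₂ : ℝ) : ℂ) v, inv_inv, ofReal_mul r₁ r₂,
      mul_cpow_ofReal_nonneg p1.le p2.le]
    simp
  have hr1 : (r₁ : ℂ) ^ (v + s₂ - 1) = (r₁ : ℂ) ^ v * (r₁ : ℂ) ^ (s₂ - 1) := by
    rw [add_sub_assoc, cpow_add _ _ n1, ← cpow_intCast]; push_cast; rfl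
  have hr2 : (r₂ : ℂ) ^ (v + s₁ - 1) = (r₂ : ℂ) ^ v * (r₂ : ℂ) ^ (s₁ - 1) := by
    rw [add_sub_assoc, cpow_add _ _ n2, ← cpow_intCast]; push_cast; rfl
  have hp : ((2 * π : ℝ) : ℂ) ^ (-t) * (((2 * π : ℝ) : ℂ) ^ (-(v + s₂)) *
      ((2 * π : ℝ) : ℂ) ^ (-(v + s₁))) * (2 * π) = ((2 * π : ℝ) : ℂ) ^ (-v) := by
    have h1 : (2 * π : ℂ) = ((2 * π : ℝ) : ℂ) ^ (1 : ℂ) := by rw [cpow_one]; push_cast; rfl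
    rw [h1, ← cpow_add _ _ npi, ← cpow_add _ _ npi, ← cpow_add _ _ npi]
    congr 1; rw [hv]; ring
  have hpc : (2 * π : ℂ) = ((2 * π : ℝ) : ℂ) := by push_cast; rfl
  rw [mellinXi, f1, f2, frickeConst_eq, mul_zpow, mul_zpow, e3]
  rw [e1, e2] at htrig ⊢
  rw [hc, hr1, hr2, ← hp]
  rw [← hpc, add_comm (s₁ : ℂ) v, add_comm (s₂ : ℂ) v]
  have z1 : (r₁ : ℂ) ^ (-s₁) * (r₁ : ℂ) ^ (s₁ + s₂ - 1) = (r₁ : ℂ) ^ (s₂ - 1) := by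
    rw [← zpow_add₀ n1]; congr 1; ring
  have z2 : (r₂ : ℂ) ^ (-s₂) * (r₂ : ℂ) ^ (s₁ + s₂ - 1) = (r₂ : ℂ) ^ (s₁ - 1) := by
    rw [← zpow_add₀ n2]; congr 1; ring
  rw [← z1, ← z2]
  have key : Gamma t * (((-1) ^ parity χ₁ * cexp (π * I * (v + s₂) / 2) +
      cexp (-π * I * (v + s₂) / 2)) * ((-1) ^ parity χ₂ * cexp (π * I * (v + s₁) / 2) +
      cexp (-π * I * (v + s₁) / 2))) = 2 * π * I ^ (s₁ + s₂ - 1) / Gamma (1 - t) := by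
    rw [htrig, eq_div_iff hG1]
    linear_combination (2 * I ^ (s₁ + s₂ - 1)) * hrefl
  rw [div_eq_mul_inv] at key ⊢
  linear_combination ((2 * π : ℂ) ^ (-t) * ((r₁ : ℂ) ^ v * ((r₁ : ℂ) ^ (-s₁) *
    (r₁ : ℂ) ^ (s₁ + s₂ - 1)) * (2 * π : ℂ) ^ (-(v + s₂)) * Gamma (v + s₂) *
    gaussSum χ₁ ZMod.stdAddChar * (star χ₁).LFunction (v + s₂)) * ((r₂ : ℂ) ^ v *
    ((r₂ : ℂ) ^ (-s₂) * (r₂ : ℂ) ^ (s₁ + s₂ - 1)) * (2 * π : ℂ) ^ (-(v + s₁)) * Gamma (v + s₁) *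
    gaussSum χ₂ ZMod.stdAddChar * (star χ₂).LFunction (v + s₁))) * key

end FunctionalEquation

/-! ### Principal parts -/

section PrincipalParts

/-- `α / (t - p) + β / (t - p)²` is the principal part of `F` at `p`. -/
def HasPrincipalPart (F : ℂ → ℂ) (p α β : ℂ) : Prop :=
  ∃ h : ℂ → ℂ, AnalyticAt ℂ h p ∧ ∀ᶠ t in 𝓝[≠] p, F t - α / (t - p) - β / (t - p) ^ 2 = h t

lemma analyticAt_dslope {g : ℂ → ℂ} {p : ℂ} (hg : AnalyticAt ℂ g p) :
    AnalyticAt ℂ (dslope g p) p := by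
  obtain ⟨s, hs, hd⟩ := hg.exists_mem_nhds_analyticOnNhd
  exact ((Complex.differentiableOn_dslope hs).2 hd.differentiableOn).analyticAt hs

lemma eq_add_sub_mul_dslope (g : ℂ → ℂ) (p t : ℂ) : g t = g p + (t - p) * dslope g p t := by
  have := sub_smul_dslope g p t
  rw [smul_eq_mul] at this
  rw [this]; ring

/-- The two polar coefficients are g′(p) and g(p); taking `dslope` twice leaves the analytic
remainder. -/
lemma hasPrincipalPart_double {F g : ℂ → ℂ} {p g' : ℂ} (hg : AnalyticAt ℂ g p)
    (hg' : HasDerivAt g g' p) (hF : ∀ᶠ t in 𝓝[≠] p, F t = g t / (t - p) ^ 2) :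
    HasPrincipalPart F p g' (g p) := by
  refine ⟨_, analyticAt_dslope (analyticAt_dslope hg), ?_⟩
  filter_upwards [hF, self_mem_nhdsWithin] with t ht htp
  have h0 : t - p ≠ 0 := sub_ne_zero.2 htp
  rw [ht, eq_add_sub_mul_dslope g p t, eq_add_sub_mul_dslope (dslope g p) p t, dslope_same,
    hg'.deriv]
  field_simp
  ring

lemma hasPrincipalPart_simple {F g : ℂ → ℂ} {p : ℂ} (hg : AnalyticAt ℂ g p)
    (hF : ∀ᶠ t in 𝓝[≠] p, F t = g t / (t - p)) : HasPrincipalPart F p (g p) 0 := by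
  refine ⟨_, analyticAt_dslope hg, ?_⟩
  filter_upwards [hF, self_mem_nhdsWithin] with t ht htp
  have h0 : t - p ≠ 0 := sub_ne_zero.2 htp
  rw [ht, eq_add_sub_mul_dslope g p t]
  field_simp
  ring

lemma hasPrincipalPart_zero {F : ℂ → ℂ} {p : ℂ} (hF : AnalyticAt ℂ F p) :
    HasPrincipalPart F p 0 0 :=
  ⟨F, hF, Eventually.of_forall fun t => by simp⟩

lemma analyticAt_Gamma {s : ℂ} (hs : ∀ m : ℕ, s ≠ -m) : AnalyticAt ℂ Gamma s := by
  have := (differentiable_one_div_Gamma.analyticAt s).fun_inv (inv_ne_zero (Gamma_ne_zero hs))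
  simpa only [inv_inv] using this

lemma hasDerivAt_Gamma {s : ℂ} (hs : ∀ m : ℕ, s ≠ -m) :
    HasDerivAt Gamma (Gamma s * digamma s) s := by
  have h1 := (differentiableAt_Gamma s hs).hasDerivAt
  have h2 : deriv Gamma s = Gamma s * digamma s := by
    rw [digamma_def, logDeriv_apply, mul_div_cancel₀ _ (Gamma_ne_zero hs)]
  rwa [h2] at h1

/-- The Laurent expansion of `Γ` at `-k` to second order. -/
lemma exists_Gamma_eq_div (k : ℕ) : ∃ A : ℂ → ℂ, AnalyticAt ℂ A (-k) ∧
    A (-k) = (-1) ^ k / (k ! : ℂ) ∧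
    HasDerivAt A ((-1) ^ k / (k ! : ℂ) * digamma (k + 1)) (-k) ∧
    ∀ᶠ t in 𝓝[≠] (-k : ℂ), Gamma t = A t / (t + k) := by
  induction k with
  | zero =>
    have h1 : ∀ m : ℕ, (0 : ℂ) + 1 ≠ -m := fun m h => by
      have := congrArg re h
      simp only [add_re, zero_re, one_re, neg_re, natCast_re] at this
      have : (0 : ℝ) ≤ m := Nat.cast_nonneg m
      linarith
    refine ⟨fun t => Gamma (t + 1), ?_, by simp, ?_, ?_⟩
    · simp only [CharP.cast_eq_zero, neg_zero]
      exact (analyticAt_Gamma h1).comp_of_eq (f := fun t : ℂ => t + 1) (by fun_prop) rfl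
    · have := (hasDerivAt_Gamma h1).comp_add_const 0 1
      simpa using this
    · simp only [CharP.cast_eq_zero, neg_zero, add_zero]
      filter_upwards [self_mem_nhdsWithin] with t ht
      rw [Gamma_add_one t ht, mul_div_cancel_left₀ _ ht]
  | succ k ih =>
    obtain ⟨A, h1, h2, h3, h4⟩ := ih
    have hk0 : ((k : ℂ) + 1) ≠ 0 := by exact_mod_cast k.succ_ne_zero
    have hf0 : ((k ! : ℕ) : ℂ) ≠ 0 := by exact_mod_cast k.factorial_ne_zero
    have e : (-((k + 1 : ℕ) : ℂ)) + 1 = -k := by push_cast; ring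
    have e0 : (-((k + 1 : ℕ) : ℂ)) ≠ 0 := by push_cast; exact neg_ne_zero.2 hk0
    -- Γ(t) = Γ(t+1)/t carries the expansion from -k to -k-1; differentiating 1/t supplies the
    -- increment ψ(k+2) - ψ(k+1) = 1/(k+1).
    refine ⟨fun t => A (t + 1) / t, ?_, ?_, ?_, ?_⟩
    · exact (h1.comp_of_eq (f := fun t : ℂ => t + 1) (by fun_prop) e).div analyticAt_id e0
    · simp only [e, h2, Nat.factorial_succ]
      push_cast
      field_simp
      ring
    · have h5 : HasDerivAt (fun t => A (t + 1)) ((-1) ^ k / (k ! : ℂ) * digamma (k + 1))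
          (-((k + 1 : ℕ) : ℂ)) := by
        have := h3
        rw [← e] at this
        exact this.comp_add_const _ _
      have h6 := h5.fun_div (hasDerivAt_id' _) e0
      refine h6.congr_deriv ?_
      have hdig := digamma_apply_add_one (k + 1 : ℂ) fun m h => by
        have := congrArg re h
        simp only [add_re, natCast_re, one_re, neg_re] at this
        have : (0 : ℝ) ≤ m := Nat.cast_nonneg m
        have : (0 : ℝ) ≤ k := Nat.cast_nonneg k
        linarith
      rw [e, h2, show ((k + 1 : ℕ) : ℂ) + 1 = (k + 1 : ℂ) + 1 by push_cast; ring, hdig,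
        Nat.factorial_succ]
      push_cast
      field_simp
      ring
    · have h5 : Tendsto (fun t : ℂ => t + 1) (𝓝[≠] (-((k + 1 : ℕ) : ℂ))) (𝓝[≠] (-k : ℂ)) := by
        refine tendsto_nhdsWithin_of_tendsto_nhds_of_eventually_within _ ?_ ?_
        · have : ContinuousAt (fun t : ℂ => t + 1) (-((k + 1 : ℕ) : ℂ)) := by fun_prop
          rw [← e]
          exact this.tendsto.mono_left nhdsWithin_le_nhds
        · filter_upwards [self_mem_nhdsWithin] with t ht h
          exact ht (by rw [Set.mem_singleton_iff] at h ⊢; rw [← sub_eq_iff_eq_add.2 e.symm, ← h]; ring)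
      filter_upwards [h5.eventually h4, (continuousAt_id.eventually_ne e0).filter_mono
        nhdsWithin_le_nhds] with t ht ht0
      have ht0' : t ≠ 0 := ht0
      rw [Gamma_add_one t ht0'] at ht
      push_cast
      rw [div_div, mul_comm t, ← div_div, show t + ((k : ℂ) + 1) = t + 1 + k by ring, ← ht,
        mul_div_cancel_left₀ _ ht0']

/-- The Laurent expansion of `ζ` at `1` to second order. -/
lemma exists_zeta_eq_div : ∃ Z : ℂ → ℂ, AnalyticAt ℂ Z 1 ∧ Z 1 = 1 ∧
    HasDerivAt Z (Real.eulerMascheroniConstant : ℂ) 1 ∧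
    ∀ t : ℂ, t ≠ 1 → riemannZeta t = Z t / (t - 1) := by
  have hdiff := DirichletCharacter.differentiable_LFunctionTrivChar₁ 1
  have hval : ∀ t : ℂ, t ≠ 1 →
      DirichletCharacter.LFunctionTrivChar₁ 1 t = (t - 1) * riemannZeta t := fun t ht => by
    rw [DirichletCharacter.LFunctionTrivChar₁, Function.update_of_ne ht,
      DirichletCharacter.LFunctionTrivChar, DirichletCharacter.LFunction_modOne_eq]
  have h1 : DirichletCharacter.LFunctionTrivChar₁ 1 1 = 1 := by simp
  refine ⟨_, hdiff.analyticAt 1, h1, ?_, fun t ht => ?_⟩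
  -- The difference quotient of (t-1)ζ(t) at 1 is ζ(t) - 1/(t-1), whose limit is γ.
  · rw [hasDerivAt_iff_tendsto_slope]
    refine tendsto_riemannZeta_sub_one_div.congr' ?_
    filter_upwards [self_mem_nhdsWithin] with t ht
    have h0 : t - 1 ≠ 0 := sub_ne_zero.2 ht
    rw [slope_def_field, h1, hval t ht]
    field_simp
  · rw [hval t ht, mul_div_cancel_left₀ _ (sub_ne_zero.2 ht)]

variable {r : ℕ} [NeZero r] {χ : DirichletCharacter ℂ r}

lemma ne_one_of_isPrimitive (hχ : χ.IsPrimitive) (hr : r ≠ 1) : χ ≠ 1 := by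
  intro h
  rw [DirichletCharacter.IsPrimitive, h, DirichletCharacter.conductor_one] at hχ
  exact hr hχ.symm

lemma analyticAt_LFunction (hχ : χ.IsPrimitive) {s : ℂ} (h : s ≠ 1 ∨ r ≠ 1) :
    AnalyticAt ℂ χ.LFunction s := by
  rw [analyticAt_iff_eventually_differentiableAt]
  rcases h with h | h
  · filter_upwards [eventually_ne_nhds h] with t ht
      using χ.differentiableAt_LFunction t (Or.inl ht)
  · exact Eventually.of_forall fun t => χ.differentiableAt_LFunction t
      (Or.inr (ne_one_of_isPrimitive hχ h))

lemma analyticAt_LFunction_add (hχ : χ.IsPrimitive) {s : ℤ} {p : ℂ} (h : s + p ≠ 1 ∨ r ≠ 1) :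
    AnalyticAt ℂ (fun t => χ.LFunction (s + t)) p :=
  (analyticAt_LFunction hχ h).comp_of_eq (f := fun t : ℂ => s + t) (by fun_prop) rfl

lemma analyticAt_two_pi_cpow (p : ℂ) : AnalyticAt ℂ (fun t : ℂ => ((2 * π : ℝ) : ℂ) ^ (-t)) p := by
  have h0 : ((2 * π : ℝ) : ℂ) ≠ 0 := ofReal_ne_zero.2 (by positivity)
  have : Differentiable ℂ fun t : ℂ => ((2 * π : ℝ) : ℂ) ^ (-t) := fun t =>
    differentiableAt_id.neg.const_cpow (Or.inl h0)
  exact this.analyticAt p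

lemma two_pi_mul_I_mul_I_mul (y : ℝ) : 2 * π * I * (I * y) = -((2 * π : ℝ) * (y : ℂ)) := by
  push_cast
  linear_combination (2 * π * y : ℂ) * I_mul_I

lemma neg_two_pi_mul_I_mul_I_mul (y : ℝ) : -2 * π * I * (I * y) = ((2 * π * y : ℝ) : ℂ) := by
  push_cast
  linear_combination (-2 * π * y : ℂ) * I_mul_I

/-- The contribution of the pole at the integer `p` to the perturbative part at `τ = i y`. -/
noncomputable def polarContribution {r₁ r₂ : ℕ} [NeZero r₁] [NeZero r₂] (s₁ s₂ : ℤ)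
    (χ₁ : DirichletCharacter ℂ r₁) (χ₂ : DirichletCharacter ℂ r₂) (p : ℤ) (y : ℝ) : ℂ :=
  if p ≤ 0 then pertTerm s₁ s₂ χ₁ χ₂ (I * y) (-p).toNat
  else (if s₂ = 1 - p then isolatedTerm r₂ s₁ s₂ χ₁ (I * y) else 0) +
    (if s₁ = 1 - p then isolatedTerm r₁ s₂ s₁ χ₂ (I * y) else 0)

variable {r₁ r₂ : ℕ} [NeZero r₁] [NeZero r₂] {s₁ s₂ : ℤ} {χ₁ : DirichletCharacter ℂ r₁}
  {χ₂ : DirichletCharacter ℂ r₂}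

lemma mellinXi_swap (t : ℂ) : mellinXi s₁ s₂ χ₁ χ₂ t = mellinXi s₂ s₁ χ₂ χ₁ t := by
  rw [mellinXi, mellinXi, mul_comm (χ₁.LFunction _)]

lemma parity_of_level_one (χ : DirichletCharacter ℂ 1) : parity χ = 0 := by
  rw [parity, if_pos]
  rw [DirichletCharacter.Even, show (-1 : ZMod 1) = 1 from Subsingleton.elim _ _, map_one]

lemma two_pi_cpow_mul_pow (k : ℕ) (y : ℝ) :
    ((2 * π : ℝ) : ℂ) ^ (-(-(k : ℂ))) * ((-1) ^ k) * (y : ℂ) ^ (-((-(k : ℤ) : ℤ) : ℂ)) =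
      (2 * π * I * (I * y)) ^ k := by
  rw [two_pi_mul_I_mul_I_mul, neg_neg, cpow_natCast, Int.cast_neg, neg_neg, Int.cast_natCast,
    cpow_natCast, neg_pow (((2 * π : ℝ) : ℂ) * (y : ℂ)), mul_pow]
  ring

/-- The poles of Γ and ζ meet at -k. Logarithmic differentiation of the four factors there gives
ψ(k+1), γ, -log 2π and L′; together with -log y from y^{-t} the logarithms form -log(-2πiτ) at τ =
iy. -/
lemma principalPart_neg_of_double (h₁ : χ₁.IsPrimitive) {k : ℕ} (hr : r₂ = 1) (hs : s₂ = k + 1)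
    (hreg : (s₁ : ℂ) + (-k : ℂ) ≠ 1 ∨ r₁ ≠ 1) :
    ∃ α β : ℂ, HasPrincipalPart (mellinXi s₁ s₂ χ₁ χ₂) (-k : ℂ) α β ∧ ∀ y : ℝ, 0 < y →
      α * (y : ℂ) ^ (-((-(k : ℤ) : ℤ) : ℂ)) - β * ((y : ℂ) ^ (-((-(k : ℤ) : ℤ) : ℂ)) * Real.log y) =
        doublePoleTerm s₁ χ₁ (I * y) k := by
  subst hr
  obtain ⟨A, hA, hA0, hA1, hAe⟩ := exists_Gamma_eq_div k
  obtain ⟨Z, hZ, hZ0, hZ1, hZe⟩ := exists_zeta_eq_div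
  have e : (s₂ : ℂ) + (-k) = 1 := by rw [hs]; push_cast; ring
  have hL := analyticAt_LFunction_add (s := s₁) h₁ hreg
  have hP := analyticAt_two_pi_cpow (-k : ℂ)
  have hZc : AnalyticAt ℂ (fun t => Z (s₂ + t)) (-k : ℂ) :=
    hZ.comp_of_eq (f := fun t : ℂ => s₂ + t) (by fun_prop) e
  have hL1 : HasDerivAt (fun t => χ₁.LFunction (s₁ + t)) (deriv χ₁.LFunction (s₁ + (-k : ℂ)))
      (-k : ℂ) := by
    have := (analyticAt_LFunction h₁ hreg).differentiableAt.hasDerivAt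
    exact this.comp_const_add _ _
  have hZ1' : HasDerivAt (fun t => Z (s₂ + t)) (Real.eulerMascheroniConstant : ℂ) (-k : ℂ) := by
    rw [← e] at hZ1
    exact hZ1.comp_const_add _ _
  have h2pi : (0 : ℝ) < 2 * π := by positivity
  have hP1 : HasDerivAt (fun t : ℂ => ((2 * π : ℝ) : ℂ) ^ (-t))
      (-(((2 * π : ℝ) : ℂ) ^ (-(-k : ℂ)) * Real.log (2 * π))) (-k : ℂ) := by
    have := (hasDerivAt_neg (-k : ℂ)).const_cpow (c := ((2 * π : ℝ) : ℂ))
      (Or.inl (ofReal_ne_zero.2 h2pi.ne'))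
    refine this.congr_deriv ?_
    rw [← ofReal_log h2pi.le]; ring
  refine ⟨_, _, hasPrincipalPart_double (g := fun t => A t * (((2 * π : ℝ) : ℂ) ^ (-t) *
    (χ₁.LFunction (s₁ + t) * Z (s₂ + t)))) (hA.mul (hP.mul (hL.mul hZc)))
    (hA1.mul (hP1.mul (hL1.mul hZ1'))) ?_, fun y hy => ?_⟩
  · filter_upwards [hAe, self_mem_nhdsWithin] with t ht htk
    have hne : (s₂ : ℂ) + t ≠ 1 := fun h => htk (by
      have : t = -k := by linear_combination h - e
      exact this)
    rw [mellinXi, ht, DirichletCharacter.LFunction_modOne_eq, hZe _ hne,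
      show (s₂ : ℂ) + t - 1 = t + k by linear_combination e, sub_neg_eq_add]
    have h0 : t + k ≠ 0 := fun h => htk (eq_neg_of_add_eq_zero_left h)
    field_simp
  · rw [doublePoleTerm, ← two_pi_cpow_mul_pow, neg_two_pi_mul_I_mul_I_mul,
      ← ofReal_log (by positivity), Real.log_mul h2pi.ne' hy.ne', hA0, e, hZ0]
    push_cast
    rw [show (s₁ : ℂ) + -k = s₁ - k by ring]
    ring

lemma principalPart_neg_of_simple (h₁ : χ₁.IsPrimitive) (h₂ : χ₂.IsPrimitive) {k : ℕ}
    (hreg₁ : (s₁ : ℂ) + (-k : ℂ) ≠ 1 ∨ r₁ ≠ 1) (hreg₂ : (s₂ : ℂ) + (-k : ℂ) ≠ 1 ∨ r₂ ≠ 1) :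
    ∃ α β : ℂ, HasPrincipalPart (mellinXi s₁ s₂ χ₁ χ₂) (-k : ℂ) α β ∧ ∀ y : ℝ, 0 < y →
      α * (y : ℂ) ^ (-((-(k : ℤ) : ℤ) : ℂ)) - β * ((y : ℂ) ^ (-((-(k : ℤ) : ℤ) : ℂ)) * Real.log y) =
        (2 * π * I * (I * y)) ^ k / (k ! : ℂ) *
          (χ₁.LFunction ((s₁ - k : ℤ) : ℂ) * χ₂.LFunction ((s₂ - k : ℤ) : ℂ)) := by
  obtain ⟨A, hA, hA0, hA1, hAe⟩ := exists_Gamma_eq_div k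
  refine ⟨_, _, hasPrincipalPart_simple (g := fun t => A t * (((2 * π : ℝ) : ℂ) ^ (-t) *
    (χ₁.LFunction (s₁ + t) * χ₂.LFunction (s₂ + t)))) (hA.mul ((analyticAt_two_pi_cpow _).mul
    ((analyticAt_LFunction_add h₁ hreg₁).mul (analyticAt_LFunction_add h₂ hreg₂)))) ?_,
    fun y hy => ?_⟩
  · filter_upwards [hAe] with t ht
    rw [mellinXi, ht, sub_neg_eq_add]
    ring
  · rw [← two_pi_cpow_mul_pow, hA0]
    push_cast
    rw [show (s₁ : ℂ) + -k = s₁ - k by ring, show (s₂ : ℂ) + -k = s₂ - k by ring]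
    ring

/-- At a positive integer Γ is regular, so only the simple pole of ζ(s₂ + t) at t = 1 - s₂
contributes. -/
lemma principalPart_pos_of_isolated (h₁ : χ₁.IsPrimitive) {p : ℤ} (hp : 0 < p) (hr : r₂ = 1)
    (hs : s₂ = 1 - p) (hreg : (s₁ : ℂ) + p ≠ 1 ∨ r₁ ≠ 1) :
    ∃ α β : ℂ, HasPrincipalPart (mellinXi s₁ s₂ χ₁ χ₂) p α β ∧ ∀ y : ℝ, 0 < y →
      α * (y : ℂ) ^ (-(p : ℂ)) - β * ((y : ℂ) ^ (-(p : ℂ)) * Real.log y) =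
        isolatedTerm r₂ s₁ s₂ χ₁ (I * y) := by
  subst hr
  obtain ⟨Z, hZ, hZ0, hZ1, hZe⟩ := exists_zeta_eq_div
  have e : (s₂ : ℂ) + p = 1 := by rw [hs]; push_cast; ring
  have hZc : AnalyticAt ℂ (fun t => Z (s₂ + t)) (p : ℂ) :=
    hZ.comp_of_eq (f := fun t : ℂ => s₂ + t) (by fun_prop) e
  have hG : AnalyticAt ℂ Gamma p := analyticAt_Gamma fun m h => by
    have : p = -m := by exact_mod_cast h
    omega
  refine ⟨_, _, hasPrincipalPart_simple (g := fun t => Gamma t * (((2 * π : ℝ) : ℂ) ^ (-t) *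
    (χ₁.LFunction (s₁ + t) * Z (s₂ + t)))) (hG.mul ((analyticAt_two_pi_cpow _).mul
    ((analyticAt_LFunction_add h₁ hreg).mul hZc))) ?_, fun y hy => ?_⟩
  · filter_upwards [self_mem_nhdsWithin] with t htp
    have hne : (s₂ : ℂ) + t ≠ 1 := fun h => htp (by
      have : t = p := by linear_combination h - e
      exact this)
    rw [mellinXi, DirichletCharacter.LFunction_modOne_eq, hZe _ hne,
      show (s₂ : ℂ) + t - 1 = t - p by linear_combination e]
    ring
  · rw [isolatedTerm, if_pos ⟨rfl, by omega⟩, neg_two_pi_mul_I_mul_I_mul, e, hZ0,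
      show s₂ - 1 = -p by omega, ofReal_mul (2 * π) y, mul_zpow, ← cpow_intCast, ← cpow_intCast,
      show (1 : ℂ) - s₂ = p by linear_combination -e, ← Int.cast_neg]
    push_cast
    rw [show (s₁ : ℂ) + 1 - s₂ = s₁ + p by linear_combination -e]
    ring

lemma isolatedTerm_eq_zero_of_ne_one {r₁ r₂ : ℕ} [NeZero r₁] {s₁ s₂ : ℤ}
    {χ₁ : DirichletCharacter ℂ r₁} (hr : r₂ ≠ 1) (τ : ℂ) : isolatedTerm r₂ s₁ s₂ χ₁ τ = 0 := by
  rw [isolatedTerm, if_neg fun h => hr h.1]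

lemma exists_principalPart (h₁ : χ₁.IsPrimitive) (h₂ : χ₂.IsPrimitive)
    (hpar : s₁ + s₂ ≡ parity χ₁ + parity χ₂ + 1 [ZMOD 2]) (p : ℤ) :
    ∃ α β : ℂ, HasPrincipalPart (mellinXi s₁ s₂ χ₁ χ₂) p α β ∧ ∀ y : ℝ, 0 < y →
      α * (y : ℂ) ^ (-(p : ℂ)) - β * ((y : ℂ) ^ (-(p : ℂ)) * Real.log y) =
        polarContribution s₁ s₂ χ₁ χ₂ p y := by
  -- With both characters trivial the parity condition makes s₁ + s₂ odd. Thus the poles of two zeta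
  -- factors never coincide and no triple pole arises.
  have hne : r₁ = 1 → r₂ = 1 → s₁ ≠ s₂ := by
    rintro rfl rfl rfl
    rw [parity_of_level_one, parity_of_level_one] at hpar
    have := hpar.dvd
    simp at this
    omega
  have hcast : ∀ s : ℤ, (s : ℂ) + p = 1 ↔ s = 1 - p := fun s => by
    rw [← Int.cast_add, ← Int.cast_one, Int.cast_inj]; omega
  have hswap : mellinXi s₁ s₂ χ₁ χ₂ = mellinXi s₂ s₁ χ₂ χ₁ := funext mellinXi_swap
  simp only [polarContribution]
  by_cases hp : p ≤ 0
  · obtain ⟨k, hk⟩ := Int.eq_ofNat_of_zero_le (neg_nonneg.2 hp)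
    obtain rfl : p = -(k : ℤ) := by omega
    have hpc : ((-(k : ℤ) : ℤ) : ℂ) = -k := by push_cast; rfl
    simp only [hp, if_true, neg_neg, Int.toNat_natCast, pertTerm]
    rw [hpc] at hcast
    by_cases hd₂ : r₂ = 1 ∧ s₂ = k + 1
    · simp only [if_pos hd₂]
      have hreg : (s₁ : ℂ) + (-k : ℂ) ≠ 1 ∨ r₁ ≠ 1 := by
        by_contra! h
        exact hne h.2 hd₂.1 (by rw [(hcast s₁).1 h.1, hd₂.2]; ring)
      have := principalPart_neg_of_double (χ₂ := χ₂) h₁ hd₂.1 hd₂.2 hreg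
      rw [hpc] at this ⊢
      exact this
    · simp only [if_neg hd₂]
      by_cases hd₁ : r₁ = 1 ∧ s₁ = k + 1
      · simp only [if_pos hd₁]
        have hreg : (s₂ : ℂ) + (-k : ℂ) ≠ 1 ∨ r₂ ≠ 1 := by
          by_contra! h
          exact hne hd₁.1 h.2 (by rw [(hcast s₂).1 h.1, hd₁.2]; ring)
        have := principalPart_neg_of_double (χ₂ := χ₁) h₂ hd₁.1 hd₁.2 hreg
        rw [← hswap] at this
        rw [hpc] at this ⊢
        exact this
      · simp only [if_neg hd₁]
        have := principalPart_neg_of_simple (k := k) (s₁ := s₁) (s₂ := s₂) h₁ h₂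
          (by by_contra! h; exact hd₁ ⟨h.2, by rw [(hcast s₁).1 h.1]; ring⟩)
          (by by_contra! h; exact hd₂ ⟨h.2, by rw [(hcast s₂).1 h.1]; ring⟩)
        rw [hpc] at this ⊢
        exact this
  · have hp0 : 0 < p := by omega
    simp only [hp, if_false]
    by_cases hd₂ : r₂ = 1 ∧ s₂ = 1 - p
    · have hreg : (s₁ : ℂ) + p ≠ 1 ∨ r₁ ≠ 1 := by
        by_contra! h
        exact hne h.2 hd₂.1 (by rw [(hcast s₁).1 h.1, hd₂.2])
      have hz : ∀ y : ℝ, (if s₁ = 1 - p then isolatedTerm r₁ s₂ s₁ χ₂ (I * y) else 0) = 0 := by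
        intro y
        split_ifs with h
        · exact isolatedTerm_eq_zero_of_ne_one (fun hr => hne hr hd₂.1 (by rw [h, hd₂.2])) _
        · rfl
      have := principalPart_pos_of_isolated (χ₂ := χ₂) h₁ hp0 hd₂.1 hd₂.2 hreg
      simp only [hz, if_pos hd₂.2, add_zero]
      exact this
    · have hz₂ : ∀ y : ℝ, (if s₂ = 1 - p then isolatedTerm r₂ s₁ s₂ χ₁ (I * y) else 0) = 0 := by
        intro y
        split_ifs with h
        · exact isolatedTerm_eq_zero_of_ne_one (fun hr => hd₂ ⟨hr, h⟩) _
        · rfl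
      by_cases hd₁ : r₁ = 1 ∧ s₁ = 1 - p
      · have := principalPart_pos_of_isolated (χ₂ := χ₁) h₂ hp0 hd₁.1 hd₁.2
          (by by_contra! h; exact hd₂ ⟨h.2, (hcast s₂).1 h.1⟩)
        rw [← hswap] at this
        simp only [hz₂, if_pos hd₁.2, zero_add]
        exact this
      · have hz₁ : ∀ y : ℝ, (if s₁ = 1 - p then isolatedTerm r₁ s₂ s₁ χ₂ (I * y) else 0) = 0 := by
          intro y
          split_ifs with h
          · exact isolatedTerm_eq_zero_of_ne_one (fun hr => hd₁ ⟨hr, h⟩) _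
          · rfl
        refine ⟨0, 0, hasPrincipalPart_zero ?_, fun y _ => by simp [hz₁, hz₂]⟩
        have hG : AnalyticAt ℂ Gamma p := analyticAt_Gamma fun m h => by
          have : p = -m := by exact_mod_cast h
          omega
        exact hG.mul ((analyticAt_two_pi_cpow _).mul
          ((analyticAt_LFunction_add h₁ (by
            by_contra! h; exact hd₁ ⟨h.2, (hcast s₁).1 h.1⟩)).mul
          (analyticAt_LFunction_add h₂ (by
            by_contra! h; exact hd₂ ⟨h.2, (hcast s₂).1 h.1⟩))))

/-- The residues add up to the perturbative part. -/
lemma sum_polarContribution {N : ℤ} (hN₁ : 1 - s₁ < N) (hN₂ : 1 - s₂ < N) (hN : 0 < N) (y : ℝ) :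
    ∑ p ∈ Finset.Ioo (-(pertLength s₁ s₂ : ℤ)) N, polarContribution s₁ s₂ χ₁ χ₂ p y =
      XiPert s₁ s₂ χ₁ χ₂ (I * y) := by
  set K := pertLength s₁ s₂ with hK
  have hsplit : Finset.Ioo (-(K : ℤ)) N = (Finset.range K).image (fun k : ℕ => -(k : ℤ)) ∪ Finset.Ioo 0 N := by
    ext p
    simp only [Finset.mem_Ioo, Finset.mem_union, Finset.mem_image, Finset.mem_range]
    constructor
    · rintro ⟨h1, h2⟩
      rcases le_or_gt p 0 with h | h
      · exact Or.inl ⟨(-p).toNat, by omega, by omega⟩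
      · exact Or.inr ⟨h, h2⟩
    · rintro (⟨k, h1, rfl⟩ | ⟨h1, h2⟩) <;> omega
  have hdisj : Disjoint ((Finset.range K).image (fun k : ℕ => -(k : ℤ))) (Finset.Ioo 0 N) := by
    rw [Finset.disjoint_left]
    intro p hp hq
    simp only [Finset.mem_Ioo, Finset.mem_image, Finset.mem_range] at hp hq
    obtain ⟨k, _, rfl⟩ := hp
    omega
  -- An isolated monomial sits at p = 1 - s, which is positive exactly when s ≤ 0; for other s the
  -- term is zero by definition.
  have hiso : ∀ (r r' : ℕ) [NeZero r'] (s s' : ℤ) (χ : DirichletCharacter ℂ r'), 1 - s < N →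
      ∑ p ∈ Finset.Ioo 0 N, (if s = 1 - p then isolatedTerm r s' s χ (I * y) else 0) =
        isolatedTerm r s' s χ (I * y) := by
    intro r r' _ s s' χ hs
    by_cases h : r = 1 ∧ s ≤ 0
    · rw [Finset.sum_eq_single (1 - s)]
      · simp
      · intro p _ hp
        rw [if_neg (by omega)]
      · intro hp
        simp only [Finset.mem_Ioo] at hp
        omega
    · simp [isolatedTerm, h]
  rw [hsplit, Finset.sum_union hdisj, Finset.sum_image (fun a _ b _ h => by simpa using h), XiPert, add_comm]
  congr 1
  · rw [← hiso r₂ r₁ s₂ s₁ χ₁ hN₂, ← hiso r₁ r₂ s₁ s₂ χ₂ hN₁, ← Finset.sum_add_distrib]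
    refine Finset.sum_congr rfl fun p hp => ?_
    rw [polarContribution, if_neg (by simp at hp; omega)]
  · refine Finset.sum_congr rfl fun k _ => ?_
    simp [polarContribution]

end PrincipalParts

/-! ### The exact identity -/

section ExactIdentity

/-- `B` resums `∑ₙ (s₁)ₙ (s₂)ₙ / n! (-z)^{-n}`, in the sense that `e^{-x} B(x)` has the
Mellin transform `Γ(v+s₁) Γ(v+s₂) / Γ(v+s₁+s₂)`. -/
structure IsResummation (s₁ s₂ : ℤ) (B : ℂ → ℂ) : Prop where
  isMultiplier : IsMultiplier B
  hasMellin : ∀ v : ℂ, 0 < v.re + s₁ → 0 < v.re + s₂ → 0 < v.re + s₁ + s₂ →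
    HasMellin (fun x : ℝ => cexp (-x) * B x) v
      (Gamma (v + s₁) * Gamma (v + s₂) / Gamma (v + s₁ + s₂))

lemma exists_norm_LFunction_le {r : ℕ} [NeZero r] (χ : DirichletCharacter ℂ r) {σ : ℝ}
    (hσ : 1 < σ) : ∃ C : ℝ, 0 ≤ C ∧ ∀ t : ℂ, t.re = σ → ‖χ.LFunction t‖ ≤ C := by
  refine ⟨∑' n : ℕ+, ‖χ ((n : ℕ) : ZMod r) * (n : ℂ) ^ (-(σ : ℂ))‖,
    tsum_nonneg fun _ => norm_nonneg _, fun t ht => ?_⟩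
  obtain ⟨h1, h2⟩ := hasSum_pnat_LFunction χ (s := t) (by rwa [ht])
  rw [← h2]
  refine (norm_tsum_le_tsum_norm h1).trans (le_of_eq (tsum_congr fun n => ?_))
  rw [norm_mul, norm_mul, norm_natCast_cpow_of_pos n.pos, norm_natCast_cpow_of_pos n.pos]
  simp [ht]

lemma norm_ofReal_cpow_eq {x : ℝ} (hx : 0 < x) {t : ℂ} {σ : ℝ} (ht : t.re = σ) :
    ‖(x : ℂ) ^ t‖ = x ^ σ := by
  rw [norm_cpow_eq_rpow_re_of_pos hx, ht]

variable {r₁ r₂ : ℕ} [NeZero r₁] [NeZero r₂] {s₁ s₂ : ℤ} {χ₁ : DirichletCharacter ℂ r₁}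
  {χ₂ : DirichletCharacter ℂ r₂}

lemma analyticAt_mellinXi (h₁ : χ₁.IsPrimitive) (h₂ : χ₂.IsPrimitive) {t : ℂ}
    (ht : ∀ p : ℤ, t ≠ p) : AnalyticAt ℂ (mellinXi s₁ s₂ χ₁ χ₂) t := by
  have hG : AnalyticAt ℂ Gamma t := analyticAt_Gamma fun m h => ht (-m) (by simpa using h)
  have h : ∀ s : ℤ, (s : ℂ) + t ≠ 1 := fun s h => ht (1 - s) (by
    push_cast; linear_combination h)
  exact hG.mul ((analyticAt_two_pi_cpow t).mul ((analyticAt_LFunction_add h₁ (Or.inl (h s₁))).mul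
    (analyticAt_LFunction_add h₂ (Or.inl (h s₂)))))

lemma expGrowth_mellinXi (a b : ℝ) : ExpGrowth a b (mellinXi s₁ s₂ χ₁ χ₂) := by
  obtain ⟨C, -, hG⟩ := exists_norm_Gamma_le a b
  have h1 : ExpGrowth a b Gamma := expGrowth_of_bounded fun t ha hb hi =>
    hG t ha hb (by linarith)
  have h2 : ExpGrowth a b fun t => ((2 * π : ℝ) : ℂ) ^ (-t) := by
    simpa using expGrowth_cpow a b (x := 2 * π) (by positivity) (-1)
  have h3 : ExpGrowth a b fun t => χ₁.LFunction (s₁ + t) := by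
    simpa using (expGrowth_LFunction χ₁ (s₁ + a) (s₁ + b)).comp_add
  have h4 : ExpGrowth a b fun t => χ₂.LFunction (s₂ + t) := by
    simpa using (expGrowth_LFunction χ₂ (s₂ + a) (s₂ + b)).comp_add
  exact h1.mul (h2.mul (h3.mul h4))

lemma exists_norm_mellinXi_le_right {b : ℝ} (hb : 0 < b) (h₁ : 1 < s₁ + b) (h₂ : 1 < s₂ + b) :
    ∃ C : ℝ, ∀ t : ℂ, t.re = b → ‖mellinXi s₁ s₂ χ₁ χ₂ t‖ ≤ C / (1 + t.im ^ 2) := by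
  obtain ⟨C, hC, hG⟩ := exists_norm_Gamma_mul_le 1 hb
  obtain ⟨C₁, hC₁, hL₁⟩ := exists_norm_LFunction_le χ₁ h₁
  obtain ⟨C₂, hC₂, hL₂⟩ := exists_norm_LFunction_le χ₂ h₂
  have hp : (0 : ℝ) < 2 * π := by positivity
  refine ⟨C * ((2 * π) ^ (-b) * (C₁ * C₂)), fun t ht => ?_⟩
  have hpos : 0 < 1 + t.im ^ 2 := by positivity
  have h1 : ‖Gamma t‖ ≤ C / (1 + t.im ^ 2) := by
    rw [le_div_iff₀ hpos]; simpa using hG t ht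
  have h3 := hL₁ (s₁ + t) (by simp [ht])
  have h4 := hL₂ (s₂ + t) (by simp [ht])
  rw [mellinXi, norm_mul, norm_mul, norm_mul, norm_ofReal_cpow_eq hp (σ := -b) (by simp [ht]),
    mul_div_right_comm]
  gcongr

/-- The functional equation moves the L-values into the region of absolute convergence, where they
are bounded, and the Gamma quotient provides the decay. A nonintegral a keeps the whole line away
from the exceptional points. -/
lemma exists_norm_mellinXi_le_left (h₁ : χ₁.IsPrimitive) (h₂ : χ₂.IsPrimitive)
    (hpar : s₁ + s₂ ≡ parity χ₁ + parity χ₂ + 1 [ZMOD 2]) {a : ℝ} (ha : ∀ n : ℤ, a ≠ n)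
    (ha₁ : s₁ + a < 0) (ha₂ : s₂ + a < 0) (ha₀ : a < 1) :
    ∃ C : ℝ, ∀ t : ℂ, t.re = a → ‖mellinXi s₁ s₂ χ₁ χ₂ t‖ ≤ C / (1 + t.im ^ 2) := by
  have p1 : (0 : ℝ) < r₁ := by exact_mod_cast Nat.pos_of_ne_zero (NeZero.ne r₁)
  have p2 : (0 : ℝ) < r₂ := by exact_mod_cast Nat.pos_of_ne_zero (NeZero.ne r₂)
  set σ : ℝ := 1 - (s₁ + s₂) - a with hσ
  have hp : (0 : ℝ) < 2 * π / (r₁ * r₂) := by positivity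
  obtain ⟨C, hC, hG⟩ := exists_norm_Gamma_mul_Gamma_div_le s₁ s₂ (σ := σ) (by linarith)
    (by linarith) (by linarith)
  obtain ⟨C₁, hC₁, hL₁⟩ := exists_norm_LFunction_le (star χ₂) (σ := s₁ + σ) (by linarith)
  obtain ⟨C₂, hC₂, hL₂⟩ := exists_norm_LFunction_le (star χ₁) (σ := s₂ + σ) (by linarith)
  obtain ⟨A, hA⟩ : ∃ A, A = frickeConst s₁ s₂ χ₁ χ₂ * ((r₁ : ℂ) * r₂ * I) ^ (s₁ + s₂ - 1) :=
    ⟨_, rfl⟩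
  refine ⟨‖A‖ * (C * ((2 * π / (r₁ * r₂)) ^ (-σ) * (C₁ * C₂))), fun t ht => ?_⟩
  set v : ℂ := 1 - (s₁ + s₂) - t with hv
  have hvre : v.re = σ := by simp [hv, ht, hσ]
  have hvim : v.im = -t.im := by simp [hv]
  have hpos : 0 < 1 + t.im ^ 2 := by positivity
  rw [mellinXi_functional_equation h₁ h₂ hpar
    (fun n h => ha n (by rw [← ht, h, intCast_re])) hv, ← hA, norm_mul, norm_mul,
    norm_mul (_ ^ _), norm_mul (DirichletCharacter.LFunction _ _),
    norm_ofReal_cpow_eq hp (σ := -σ) (by simp [hvre])]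
  have h1 := hG v hvre
  rw [hvim, neg_sq] at h1
  have h3 := hL₁ (s₁ + v) (by simp [hvre])
  have h4 := hL₂ (s₂ + v) (by simp [hvre])
  rw [mul_div_assoc ‖A‖, mul_div_right_comm C]
  gcongr

lemma hasMellin_Xi {t : ℂ} (ht : 0 < t.re) (h₁ : 1 < s₁ + t.re) (h₂ : 1 < s₂ + t.re) :
    HasMellin (fun y : ℝ => Xi s₁ s₂ χ₁ χ₂ (I * y)) t (mellinXi s₁ s₂ χ₁ χ₂ t) := by
  have h := isMultiplier_one.hasMellin_tsum_mulTerm s₁ s₂ χ₁ χ₂ (c := 2 * π) (by positivity)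
    (m := Gamma t) (by simpa using mellinConvergent_exp_neg ht) h₁ h₂
  rw [mellinXi]
  convert h using 2 with y
  rw [Xi, xiTerm_eq_mulTerm, neg_two_pi_mul_I_mul_I_mul, ofReal_mul (2 * π) y]

/-- The non-perturbative part for a resummation `B`. -/
noncomputable def npSum (s₁ s₂ : ℤ) (χ₁ : DirichletCharacter ℂ r₁) (χ₂ : DirichletCharacter ℂ r₂)
    (B : ℂ → ℂ) (τ : ℂ) : ℂ :=
  frickeConst s₁ s₂ χ₁ χ₂ * ((r₁ : ℂ) * r₂ * τ) ^ (s₁ + s₂ - 1) *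
    ∑' n, mulTerm s₁ s₂ (star χ₂) (star χ₁) B (2 * π * I / ((r₁ : ℂ) * r₂ * τ)) n

variable {B : ℂ → ℂ}

lemma npSum_I_mul {y : ℝ} (hy : 0 < y) :
    npSum s₁ s₂ χ₁ χ₂ B (I * y) =
      frickeConst s₁ s₂ χ₁ χ₂ * ((r₁ : ℂ) * r₂ * I) ^ (s₁ + s₂ - 1) *
      ((y : ℂ) ^ ((s₁ + s₂ - 1 : ℤ) : ℂ) • ∑' n, mulTerm s₁ s₂ (star χ₂) (star χ₁) B
        ((2 * π / (r₁ * r₂) : ℝ) * (y⁻¹ : ℝ)) n) := by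
  have n1 : (r₁ : ℂ) ≠ 0 := NeZero.ne _
  have n2 : (r₂ : ℂ) ≠ 0 := NeZero.ne _
  have n3 : (y : ℂ) ≠ 0 := ofReal_ne_zero.2 hy.ne'
  rw [npSum, cpow_intCast, smul_eq_mul, ← mul_assoc (r₁ * r₂ : ℂ) I (y : ℂ),
    mul_zpow _ (y : ℂ)]
  have : 2 * π * I / ((r₁ : ℂ) * r₂ * I * y) = (2 * π / (r₁ * r₂) : ℝ) * (y⁻¹ : ℝ) := by
    push_cast
    field_simp [I_ne_zero]
  rw [this]
  ring

/-- At τ = iy the sum is y^{s₁+s₂-1} times a series in y⁻¹; the power and the inversion together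
turn the variable t into v. -/
lemma hasMellin_npSum (hB : IsResummation s₁ s₂ B) {t v : ℂ} (hv : v = 1 - (s₁ + s₂) - t)
    (ha₁ : s₁ + t.re < 0) (ha₂ : s₂ + t.re < 0) (ha₀ : t.re < 1) :
    HasMellin (fun y : ℝ => npSum s₁ s₂ χ₁ χ₂ B (I * y)) t
      (frickeConst s₁ s₂ χ₁ χ₂ * ((r₁ : ℂ) * r₂ * I) ^ (s₁ + s₂ - 1) *
      ((Gamma (v + s₁) * Gamma (v + s₂) / Gamma (v + s₁ + s₂)) *
        (((2 * π / (r₁ * r₂) : ℝ) : ℂ) ^ (-v) *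
          ((star χ₂).LFunction (s₁ + v) * (star χ₁).LFunction (s₂ + v))))) := by
  have p1 : (0 : ℝ) < r₁ := by exact_mod_cast Nat.pos_of_ne_zero (NeZero.ne r₁)
  have p2 : (0 : ℝ) < r₂ := by exact_mod_cast Nat.pos_of_ne_zero (NeZero.ne r₂)
  have hvre : v.re = 1 - (s₁ + s₂) - t.re := by simp [hv]
  have h := hB.isMultiplier.hasMellin_tsum_mulTerm s₁ s₂ (star χ₂) (star χ₁)
    (c := 2 * π / (r₁ * r₂)) (by positivity)
    (hB.hasMellin v (by linarith) (by linarith) (by linarith)) (by linarith) (by linarith)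
  have hvt : v = -(t + ((s₁ + s₂ - 1 : ℤ) : ℂ)) := by rw [hv]; push_cast; ring
  have h' := hasMellin_comp_inv (t := t + ((s₁ + s₂ - 1 : ℤ) : ℂ)) (hvt ▸ h)
  rw [← hvt] at h'
  have h'' := HasMellin.fun_const_mul (t := t) (f := fun y : ℝ =>
    (y : ℂ) ^ ((s₁ + s₂ - 1 : ℤ) : ℂ) • ∑' n, mulTerm s₁ s₂ (star χ₂) (star χ₁) B
        ((2 * π / (r₁ * r₂) : ℝ) * (y⁻¹ : ℝ)) n)
    ⟨MellinConvergent.cpow_smul.2 h'.1, (mellin_cpow_smul _ _ _).trans h'.2⟩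
    (frickeConst s₁ s₂ χ₁ χ₂ * ((r₁ : ℂ) * r₂ * I) ^ (s₁ + s₂ - 1))
  refine hasMellin_congr_of_ne_one h'' fun y hy _ => (npSum_I_mul hy).symm

lemma re_two_pi_I_div_pos {τ : ℂ} (hτ : 0 < τ.im) :
    0 < (2 * π * I / ((r₁ : ℂ) * r₂ * τ)).re := by
  have p1 : (0 : ℝ) < r₁ := by exact_mod_cast Nat.pos_of_ne_zero (NeZero.ne r₁)
  have p2 : (0 : ℝ) < r₂ := by exact_mod_cast Nat.pos_of_ne_zero (NeZero.ne r₂)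
  have hn : 0 < normSq τ := normSq_pos.2 fun h => by simp [h] at hτ
  have : (2 * π * I / ((r₁ : ℂ) * r₂ * τ)) = ((2 * π / (r₁ * r₂) : ℝ) : ℂ) * (I / τ) := by
    push_cast; rw [div_mul_div_comm]
  rw [this, re_ofReal_mul, div_re]
  simp only [I_re, I_im, zero_mul, zero_div, one_mul, zero_add]
  positivity

lemma differentiableOn_npSum (hB : IsMultiplier B) :
    DifferentiableOn ℂ (npSum s₁ s₂ χ₁ χ₂ B) {τ | 0 < τ.im} := by
  have n1 : (r₁ : ℂ) ≠ 0 := NeZero.ne _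
  have n2 : (r₂ : ℂ) ≠ 0 := NeZero.ne _
  have h0 : ∀ τ ∈ {τ : ℂ | 0 < τ.im}, (r₁ : ℂ) * r₂ * τ ≠ 0 := fun τ (hτ : 0 < τ.im) =>
    mul_ne_zero (mul_ne_zero n1 n2) fun h => by simp [h] at hτ
  have h1 : DifferentiableOn ℂ (fun τ : ℂ => (r₁ : ℂ) * r₂ * τ) {τ | 0 < τ.im} := by fun_prop
  refine ((differentiableOn_const _).mul (fun τ hτ => ?_)).mul
    ((hB.differentiableOn_tsum_mulTerm s₁ s₂ (star χ₂) (star χ₁)).comp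
      ((differentiableOn_const (2 * π * I)).div h1 h0) fun τ hτ => re_two_pi_I_div_pos hτ)
  exact (h1 τ hτ).zpow (Or.inl (h0 τ hτ))

lemma differentiableOn_XiPert : DifferentiableOn ℂ (XiPert s₁ s₂ χ₁ χ₂) {τ | 0 < τ.im} := by
  have h0 : ∀ τ ∈ {τ : ℂ | 0 < τ.im}, -2 * π * I * τ ∈ slitPlane := fun τ (hτ : 0 < τ.im) =>
    Or.inl (by rw [re_neg_two_pi_I_mul]; positivity)
  have h1 : DifferentiableOn ℂ (fun τ : ℂ => -2 * π * I * τ) {τ | 0 < τ.im} := by fun_prop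
  have hiso : ∀ (r r' : ℕ) [NeZero r'] (s s' : ℤ) (χ : DirichletCharacter ℂ r'),
      DifferentiableOn ℂ (isolatedTerm r s' s χ) {τ | 0 < τ.im} := by
    intro r r' _ s s' χ
    unfold isolatedTerm
    split_ifs with h
    · have h2 : DifferentiableOn ℂ (fun τ : ℂ => (-2 * π * I * τ) ^ (s - 1)) {τ | 0 < τ.im} :=
        fun τ hτ => (h1 τ hτ).zpow (Or.inl (slitPlane_ne_zero (h0 τ hτ)))
      exact (h2.mul_const _).mul_const _
    · exact differentiableOn_const _
  have hdouble : ∀ (r : ℕ) [NeZero r] (s : ℤ) (χ : DirichletCharacter ℂ r) (k : ℕ),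
      DifferentiableOn ℂ (fun τ => doublePoleTerm s χ τ k) {τ | 0 < τ.im} := by
    intro r _ s χ k
    unfold doublePoleTerm
    have := h1.clog h0
    fun_prop
  unfold XiPert
  refine ((hiso _ _ _ _ _).add (hiso _ _ _ _ _)).add (DifferentiableOn.fun_sum fun k _ => ?_)
  unfold pertTerm
  split_ifs
  · exact hdouble _ _ _ _
  · exact hdouble _ _ _ _
  · fun_prop

/-- Ξ and the resummed dual series have the common transform `mellinXi` on two lines enclosing
exactly the poles collected in Ξ^Pert. -/
theorem Xi_eq_XiPert_add_npSum_of_imaginary (h₁ : χ₁.IsPrimitive) (h₂ : χ₂.IsPrimitive)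
    (hpar : s₁ + s₂ ≡ parity χ₁ + parity χ₂ + 1 [ZMOD 2]) (hB : IsResummation s₁ s₂ B)
    {y : ℝ} (hy : 0 < y) :
    Xi s₁ s₂ χ₁ χ₂ (I * y) = npSum s₁ s₂ χ₁ χ₂ B (I * y) + XiPert s₁ s₂ χ₁ χ₂ (I * y) := by
  set K := pertLength s₁ s₂ with hK
  have hK₁ : s₁ + 1 ≤ K := by rw [hK, pertLength]; omega
  have hK₂ : s₂ + 1 ≤ K := by rw [hK, pertLength]; omega
  have hK₁' : (s₁ : ℝ) + 1 ≤ K := by exact_mod_cast hK₁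
  have hK₂' : (s₂ : ℝ) + 1 ≤ K := by exact_mod_cast hK₂
  have hK₀' : (0 : ℝ) ≤ K := Nat.cast_nonneg K
  obtain ⟨N, hN₀, hN₁, hN₂⟩ : ∃ N : ℤ, 1 ≤ N ∧ 2 - s₁ ≤ N ∧ 2 - s₂ ≤ N :=
    ⟨max 1 (max (2 - s₁) (2 - s₂)), by omega, by omega, by omega⟩
  have hN₀' : (1 : ℝ) ≤ N := by exact_mod_cast hN₀
  have hN₁' : (2 : ℝ) - s₁ ≤ N := by exact_mod_cast hN₁
  have hN₂' : (2 : ℝ) - s₂ ≤ N := by exact_mod_cast hN₂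
  have hhalf : ∀ m n : ℤ, (m : ℝ) + 1 / 2 ≠ n := fun m n h => by
    have h2 : (2 : ℝ) * m + 1 = 2 * n := by linarith
    have h3 : 2 * m + 1 = 2 * n := by exact_mod_cast h2
    omega
  -- Half-integral abscissae miss every pole. At b = N - 1/2 the Dirichlet series converge
  -- absolutely, at a = -K + 1/2 the dual ones do, and the integers in between form `Ioo (-K) N`.
  set a : ℝ := ((-K : ℤ) : ℝ) + 1 / 2 with ha
  set b : ℝ := ((N - 1 : ℤ) : ℝ) + 1 / 2 with hb
  have hau : a = -K + 1 / 2 := by rw [ha]; push_cast; ring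
  have hbu : b = N - 1 / 2 := by rw [hb]; push_cast; ring
  have hpp := exists_principalPart h₁ h₂ hpar
  choose α β hαβ hval using hpp
  obtain ⟨Bg, c, hgrowth⟩ := expGrowth_mellinXi (s₁ := s₁) (s₂ := s₂) (χ₁ := χ₁) (χ₂ := χ₂) a b
  obtain ⟨C₁, hC₁⟩ := exists_norm_mellinXi_le_left h₁ h₂ hpar (a := a) (hhalf _)
    (by linarith) (by linarith) (by linarith)
  obtain ⟨C₂, hC₂⟩ := exists_norm_mellinXi_le_right (χ₁ := χ₁) (χ₂ := χ₂) (s₁ := s₁) (s₂ := s₂)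
    (b := b) (by linarith) (by linarith) (by linarith)
  have hmap : ∀ y ∈ Set.Ioi (0 : ℝ), I * (y : ℂ) ∈ {τ : ℂ | 0 < τ.im} := fun y hy => by
    simpa using hy
  have hcont : ContinuousOn (fun y : ℝ => I * (y : ℂ)) (Set.Ioi 0) := by fun_prop
  have key := eq_add_residues_of_mellin (f := fun y : ℝ => Xi s₁ s₂ χ₁ χ₂ (I * y))
    (g := fun y : ℝ => npSum s₁ s₂ χ₁ χ₂ B (I * y)) (F := mellinXi s₁ s₂ χ₁ χ₂) (a := a) (b := b)
    (B := Bg) (c := c) (C := max C₁ C₂) (by linarith) (Finset.Ioo (-(K : ℤ)) N) α β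
    (fun p hp => ?_)
    ((differentiableOn_Xi s₁ s₂ χ₁ χ₂).continuousOn.comp hcont hmap)
    ((differentiableOn_npSum hB.isMultiplier).continuousOn.comp hcont hmap)
    (fun t ht => hasMellin_Xi (by linarith) (by linarith) (by linarith))
    (fun t ht => ?_) (fun t hta htb hp => ?_) (fun p _ => hαβ p) hgrowth
    (fun t ht => (hC₁ t ht).trans (by gcongr; exact le_max_left _ _))
    (fun t ht => (hC₂ t ht).trans (by gcongr; exact le_max_right _ _)) hy
  · rw [key, Finset.sum_congr rfl fun p _ => hval p y hy, sum_polarContribution (by omega)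
      (by omega) (by omega)]
  · simp only [Finset.mem_Ioo] at hp
    have h1 : (-K : ℝ) + 1 ≤ p := by exact_mod_cast hp.1
    have h2 : (p : ℝ) + 1 ≤ N := by exact_mod_cast hp.2
    constructor <;> linarith
  · rw [mellinXi_functional_equation h₁ h₂ hpar
      (fun n h => hhalf _ n (by rw [← ha, ← ht, h, intCast_re])) rfl]
    exact hasMellin_npSum hB rfl (by linarith) (by linarith) (by linarith)
  · refine analyticAt_mellinXi h₁ h₂ fun p htp => hp p ?_ htp
    have htr : t.re = p := by rw [htp, intCast_re]
    rw [htr, hau] at hta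
    rw [htr, hbu] at htb
    have h1 : (-K : ℝ) < p := by linarith
    have h2 : (p : ℝ) < N := by linarith
    rw [Finset.mem_Ioo]
    exact ⟨by exact_mod_cast h1, by exact_mod_cast h2⟩

/-- The exact Fricke identity, for any resummation `B` of the non-perturbative part. -/
theorem Xi_eq_XiPert_add_npSum (h₁ : χ₁.IsPrimitive) (h₂ : χ₂.IsPrimitive)
    (hpar : s₁ + s₂ ≡ parity χ₁ + parity χ₂ + 1 [ZMOD 2]) (hB : IsResummation s₁ s₂ B)
    {τ : ℂ} (hτ : 0 < τ.im) :
    Xi s₁ s₂ χ₁ χ₂ τ = npSum s₁ s₂ χ₁ χ₂ B τ + XiPert s₁ s₂ χ₁ χ₂ τ := by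
  have hopen : IsOpen {τ : ℂ | 0 < τ.im} := isOpen_lt continuous_const continuous_im
  have hconv : Convex ℝ {τ : ℂ | 0 < τ.im} := convex_halfSpace_im_gt 0
  refine AnalyticOnNhd.eqOn_of_preconnected_of_frequently_eq
    (f := Xi s₁ s₂ χ₁ χ₂) (g := fun τ => npSum s₁ s₂ χ₁ χ₂ B τ + XiPert s₁ s₂ χ₁ χ₂ τ)
    ((differentiableOn_Xi s₁ s₂ χ₁ χ₂).analyticOnNhd hopen)
    (((differentiableOn_npSum hB.isMultiplier).add differentiableOn_XiPert).analyticOnNhd hopen)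
    hconv.isPreconnected (z₀ := I) (by simp) ?_ hτ
  -- Points of the imaginary axis accumulating at i, as the identity theorem requires.
  have hseq : Tendsto (fun n : ℕ => I * ((1 + 1 / ((n : ℝ) + 1) : ℝ) : ℂ)) atTop (𝓝[≠] I) := by
    refine tendsto_nhdsWithin_of_tendsto_nhds_of_eventually_within _ ?_
      (Eventually.of_forall fun n h => ?_)
    · have h1 : Tendsto (fun n : ℕ => (1 + 1 / ((n : ℝ) + 1) : ℝ)) atTop (𝓝 (1 + 0)) :=
        tendsto_const_nhds.add tendsto_one_div_add_atTop_nhds_zero_nat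
      have h2 := (continuous_ofReal.tendsto _).comp h1
      simpa using h2.const_mul I
    · have h3 : (0 : ℝ) < 1 / ((n : ℝ) + 1) := by positivity
      have h4 := congrArg im (Set.mem_singleton_iff.1 h)
      rw [I_mul_im, ofReal_re, I_im] at h4
      linarith
  refine hseq.frequently (Frequently.of_forall fun n => ?_)
  exact Xi_eq_XiPert_add_npSum_of_imaginary h₁ h₂ hpar hB (by positivity)

end ExactIdentity

/-! ### Terminating resummation -/

section Terminating

/-- The coefficient `(s₁)ₙ (s₂)ₙ / n!`. -/
noncomputable def asymCoef (s₁ s₂ : ℤ) (n : ℕ) : ℂ :=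
  (ascPochhammer ℂ n).eval (s₁ : ℂ) * (ascPochhammer ℂ n).eval (s₂ : ℂ) / (n ! : ℂ)

/-- The truncation of the series `∑ₙ (s₁)ₙ (s₂)ₙ / n! (-z)^{-n}`. -/
noncomputable def asymSum (s₁ s₂ : ℤ) (N : ℕ) (z : ℂ) : ℂ :=
  ∑ n ∈ Finset.range N, asymCoef s₁ s₂ n * ((-z) ^ n)⁻¹

lemma isMultiplier_asymSum (s₁ s₂ : ℤ) (N : ℕ) : IsMultiplier (asymSum s₁ s₂ N) := by
  refine ⟨?_, ∑ n ∈ Finset.range N, ‖asymCoef s₁ s₂ n‖, N, 0,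
    Finset.sum_nonneg fun _ _ => norm_nonneg _, fun z hz => ?_⟩
  · refine DifferentiableOn.fun_sum fun n _ => (differentiableOn_const _).mul ?_
    refine DifferentiableOn.fun_inv (by fun_prop) fun z (hz : 0 < z.re) => pow_ne_zero _ ?_
    exact neg_ne_zero.2 fun h => by simp [h] at hz
  · rw [pow_zero, mul_one, Finset.sum_mul]
    refine norm_sum_le_of_le _ fun n hn => ?_
    rw [norm_mul, norm_inv, norm_pow, norm_neg, ← inv_pow]
    have h1 : ‖z‖⁻¹ ≤ 1 + z.re⁻¹ := by
      have : ‖z‖⁻¹ ≤ z.re⁻¹ := inv_anti₀ hz ((le_abs_self _).trans (abs_re_le_norm z))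
      linarith
    have h2 : 1 ≤ 1 + z.re⁻¹ := by have := inv_pos.2 hz; linarith
    gcongr
    exact (pow_le_pow_left₀ (by positivity) h1 n).trans
      (pow_le_pow_right₀ h2 (Finset.mem_range.1 hn).le)

lemma ascPochhammer_eval_succ_left (x : ℂ) (n : ℕ) :
    (ascPochhammer ℂ (n + 1)).eval x = x * (ascPochhammer ℂ n).eval (x + 1) := by
  rw [ascPochhammer_succ_left]; simp [Polynomial.eval_comp]

/-- The Chu–Vandermonde identity. -/
lemma ascPochhammer_eval_add (n : ℕ) (x y : ℂ) :
    ∑ ij ∈ Finset.HasAntidiagonal.antidiagonal n, (n.choose ij.1 : ℂ) *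
      ((ascPochhammer ℂ ij.1).eval x * (ascPochhammer ℂ ij.2).eval y) =
    (ascPochhammer ℂ n).eval (x + y) := by
  induction n generalizing x y with
  | zero => simp
  | succ n ih =>
    -- Pascal's rule splits the sum in two; taking out the factors y and x leaves the induction
    -- hypothesis at (x, y+1) and at (x+1, y).
    rw [Finset.sum_antidiagonal_choose_succ_mul
      (fun i j => (ascPochhammer ℂ i).eval x * (ascPochhammer ℂ j).eval y),
      ascPochhammer_eval_succ_left, add_mul]
    have e1 := congrArg (y * ·) (ih x (y + 1))
    have e2 := congrArg (x * ·) (ih (x + 1) y)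
    simp only [Finset.mul_sum] at e1 e2
    rw [show x + (y + 1) = x + y + 1 by ring] at e1
    rw [show x + 1 + y = x + y + 1 by ring] at e2
    rw [← e1, ← e2, add_comm]
    congr 1
    · refine Finset.sum_congr rfl fun ij hij => ?_
      rw [ascPochhammer_eval_succ_left, ← Finset.HasAntidiagonal.mem_antidiagonal.1 hij, Nat.choose_symm_add]
      ring
    · refine Finset.sum_congr rfl fun ij _ => ?_
      rw [ascPochhammer_eval_succ_left]
      ring

lemma neg_one_pow_mul_ascPochhammer_neg (m n : ℕ) :
    (-1 : ℂ) ^ n * (ascPochhammer ℂ n).eval (-(m : ℂ)) / (n ! : ℂ) = m.choose n := by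
  rw [ascPochhammer_eval_neg_eq_descPochhammer, ← mul_assoc, ← mul_pow, neg_one_mul, neg_neg,
    one_pow, one_mul, descPochhammer_eval_eq_descFactorial, Nat.descFactorial_eq_factorial_mul_choose]
  have : ((n ! : ℕ) : ℂ) ≠ 0 := by exact_mod_cast n.factorial_ne_zero
  push_cast
  field_simp

lemma Gamma_add_natCast {z : ℂ} (hz : 0 < z.re) (n : ℕ) :
    Gamma (z + n) = Gamma z * (ascPochhammer ℂ n).eval z := by
  rw [← Gamma_add_nat_div_Gamma_eq z fun k h => by
    rw [h, neg_re, natCast_re] at hz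
    have : (0 : ℝ) ≤ k := Nat.cast_nonneg k
    linarith, mul_div_cancel₀ _ (Gamma_ne_zero_of_re_pos hz)]

lemma hasMellin_exp_neg_div_pow {v : ℂ} {n : ℕ} (hv : n < v.re) :
    HasMellin (fun x : ℝ => cexp (-x) * ((-(x : ℂ)) ^ n)⁻¹) v ((-1) ^ n * Gamma (v - n)) := by
  have h := mellinConvergent_exp_neg (t := v - n) (by simpa using hv)
  rw [sub_eq_add_neg] at h
  have h' := HasMellin.fun_const_mul (t := v) (f := fun x : ℝ => (x : ℂ) ^ (-(n : ℂ)) • cexp (-x))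
    ⟨MellinConvergent.cpow_smul.2 h.1, (mellin_cpow_smul _ _ _).trans h.2⟩ ((-1) ^ n)
  rw [← sub_eq_add_neg] at h'
  refine hasMellin_congr_of_ne_one h' fun x hx _ => ?_
  rw [cpow_neg, cpow_natCast, smul_eq_mul, neg_pow (x : ℂ), mul_inv, ← inv_pow (-1 : ℂ), inv_neg_one]
  ring

/-- With w = v+s₁ one has Γ(v-n) = Γ(w)(w)_{m-n} and Γ(v+s₂) = Γ(w+s₂)(w+s₂)_m, while (-1)ⁿ(-m)ₙ/n!
is a binomial coefficient. The termwise transforms therefore add up by Chu–Vandermonde for (s₂+w)_m.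
Convergence holds because n ≤ m and re w > 0. -/
lemma isResummation_asymSum {s₁ s₂ : ℤ} {m : ℕ} (hm : s₁ = -m) :
    IsResummation s₁ s₂ (asymSum s₁ s₂ (m + 1)) := by
  refine ⟨isMultiplier_asymSum _ _ _, fun v h1 h2 h3 => ?_⟩
  have hmR : (s₁ : ℝ) = -m := by rw [hm]; simp
  have hmC : (s₁ : ℂ) = -m := by rw [hm]; simp
  have h := hasMellin_finset_sum (Finset.range (m + 1))
    (f := fun n (x : ℝ) => asymCoef s₁ s₂ n * (cexp (-x) * ((-(x : ℂ)) ^ n)⁻¹)) (t := v)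
    fun n hn => (hasMellin_exp_neg_div_pow (v := v) (n := n) (by
      have : (n : ℝ) ≤ m := by exact_mod_cast Nat.lt_succ_iff.1 (Finset.mem_range.1 hn)
      linarith)).fun_const_mul (asymCoef s₁ s₂ n)
  convert h using 2 with x
  · rw [asymSum, Finset.mul_sum]
    exact Finset.sum_congr rfl fun n _ => by ring
  · have hw : 0 < (v + s₁).re := by simpa using h1
    have hw2 : 0 < (v + s₁ + s₂).re := by simpa using h3
    have e2 : Gamma (v + s₂) = Gamma (v + s₁ + s₂) * (ascPochhammer ℂ m).eval (v + s₁ + s₂) := by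
      rw [← Gamma_add_natCast hw2, hmC]; congr 1; ring
    rw [e2, show v + s₁ + s₂ = s₂ + (v + s₁) by ring,
      ← ascPochhammer_eval_add, mul_comm (Gamma (s₂ + (v + s₁))), ← mul_assoc,
      mul_div_cancel_right₀ _ (Gamma_ne_zero_of_re_pos (by rwa [add_comm] at hw2)),
      Finset.Nat.sum_antidiagonal_eq_sum_range_succ_mk, Finset.mul_sum]
    refine Finset.sum_congr rfl fun n hn => ?_
    have hnm : n ≤ m := Nat.lt_succ_iff.1 (Finset.mem_range.1 hn)
    have e3 : Gamma (v - n) = Gamma (v + s₁) * (ascPochhammer ℂ (m - n)).eval (v + s₁) := by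
      rw [← Gamma_add_natCast hw, hmC, Nat.cast_sub hnm]; congr 1; ring
    rw [e3, ← neg_one_pow_mul_ascPochhammer_neg m n, asymCoef, hmC]
    ring

end Terminating

/-! ### Laplace transforms -/

section Laplace

lemma integrableOn_rpow_mul_exp_neg {a δ : ℝ} (ha : 0 < a) (hδ : 0 < δ) :
    IntegrableOn (fun t : ℝ => t ^ (a - 1) * Real.exp (-δ * t)) (Set.Ioi 0) := by
  simpa using integrableOn_rpow_mul_exp_neg_mul_rpow (s := a - 1) (by linarith) one_pos hδ

/-- `k` has a Laplace transform on the right half-plane. -/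
structure LaplaceConvergent (k : ℝ → ℝ) : Prop where
  aestronglyMeasurable : AEStronglyMeasurable k (volume.restrict (Set.Ioi 0))
  integrableOn : ∀ δ : ℝ, 0 < δ → IntegrableOn (fun t => k t * Real.exp (-δ * t)) (Set.Ioi 0)

lemma laplaceConvergent_of_le {k : ℝ → ℝ} {a C : ℝ} (ha : 0 < a)
    (hk : ContinuousOn k (Set.Ioi 0)) (hle : ∀ t : ℝ, 0 < t → |k t| ≤ C * t ^ (a - 1)) :
    LaplaceConvergent k := by
  have hm := hk.aestronglyMeasurable (μ := volume) measurableSet_Ioi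
  refine ⟨hm, fun δ hδ => ?_⟩
  refine Integrable.mono' ((integrableOn_rpow_mul_exp_neg ha hδ).const_mul C)
    (hm.mul (by fun_prop)) ?_
  filter_upwards [ae_restrict_mem measurableSet_Ioi] with t ht
  rw [norm_mul, Real.norm_eq_abs, Real.norm_of_nonneg (Real.exp_pos _).le, ← mul_assoc]
  gcongr
  exact hle t ht

lemma laplaceConvergent_rpow {a : ℝ} (ha : 0 < a) : LaplaceConvergent fun t => t ^ (a - 1) :=
  laplaceConvergent_of_le (C := 1) ha
    (continuousOn_id.rpow_const fun t ht => Or.inl (ne_of_gt ht)) fun t ht => by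
    rw [one_mul, abs_of_nonneg (by positivity)]

variable {k : ℝ → ℝ}

lemma LaplaceConvergent.integrableOn_cexp (hk : LaplaceConvergent k) {z : ℂ} (hz : 0 < z.re) :
    IntegrableOn (fun t : ℝ => cexp (-(t * z)) * (k t : ℂ)) (Set.Ioi 0) := by
  refine Integrable.mono' (hk.integrableOn z.re hz).norm ?_ ?_
  · exact (Continuous.aestronglyMeasurable (by fun_prop)).mul
      (continuous_ofReal.comp_aestronglyMeasurable hk.aestronglyMeasurable)
  · refine Eventually.of_forall fun t => le_of_eq ?_
    rw [norm_mul, norm_mul, norm_exp, norm_real, mul_comm, Real.norm_of_nonneg (Real.exp_pos _).le]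
    congr 2
    simp [mul_comm]

lemma LaplaceConvergent.differentiableOn (hk : LaplaceConvergent k) :
    DifferentiableOn ℂ (fun z : ℂ => ∫ t in Set.Ioi (0 : ℝ), cexp (-(t * z)) * (k t : ℂ))
      {z | 0 < z.re} := by
  intro z₀ (hz₀ : 0 < z₀.re)
  have hnhds : {z : ℂ | z₀.re / 2 < z.re} ∈ 𝓝 z₀ :=
    (isOpen_lt continuous_const continuous_re).mem_nhds (show z₀.re / 2 < z₀.re by linarith)
  have hmeas : ∀ z : ℂ, AEStronglyMeasurable (fun t : ℝ => cexp (-(t * z)) * (k t : ℂ))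
      (volume.restrict (Set.Ioi 0)) := fun z =>
    (Continuous.aestronglyMeasurable (by fun_prop)).mul
      (continuous_ofReal.comp_aestronglyMeasurable hk.aestronglyMeasurable)
  have h := hasDerivAt_integral_of_dominated_loc_of_deriv_le
    (F := fun (z : ℂ) (t : ℝ) => cexp (-(t * z)) * (k t : ℂ))
    (F' := fun (z : ℂ) (t : ℝ) => cexp (-(t * z)) * (-t) * (k t : ℂ))
    (μ := volume.restrict (Set.Ioi 0))
    -- Near z₀ the real part exceeds re z₀/2. Half of this rate absorbs the factor t, by t e^{-δt} ≤
    -- 1/δ with δ = re z₀/4; the other half stays integrable against k.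
    (bound := fun t => 4 / z₀.re * ‖k t * Real.exp (-(z₀.re / 4) * t)‖)
    hnhds (Eventually.of_forall hmeas) (hk.integrableOn_cexp hz₀)
    (((Continuous.aestronglyMeasurable (by fun_prop)).mul
      (continuous_ofReal.comp_aestronglyMeasurable hk.aestronglyMeasurable))) ?_
    ((hk.integrableOn (z₀.re / 4) (by linarith)).norm.const_mul _) ?_
  · exact h.2.differentiableAt.differentiableWithinAt
  · filter_upwards [ae_restrict_mem measurableSet_Ioi] with t (ht : 0 < t) z (hz : z₀.re / 2 < z.re)
    rw [norm_mul, norm_mul, norm_exp, norm_neg, norm_real, norm_real, norm_mul,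
      Real.norm_of_nonneg (Real.exp_pos _).le, Real.norm_of_nonneg ht.le]
    have h1 : Real.exp (-((t : ℂ) * z)).re ≤ Real.exp (-(z₀.re / 4) * t) * Real.exp (-(z₀.re / 4) * t) := by
      rw [← Real.exp_add, Real.exp_le_exp, neg_re, re_ofReal_mul]
      nlinarith
    have h2 : Real.exp (-(z₀.re / 4) * t) * t ≤ 4 / z₀.re := by
      have h3 := Real.add_one_le_exp (z₀.re / 4 * t)
      have h4 : Real.exp (-(z₀.re / 4) * t) * Real.exp (z₀.re / 4 * t) = 1 := by
        rw [← Real.exp_add]; simp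
      rw [le_div_iff₀ hz₀]
      have h5 := Real.exp_pos (-(z₀.re / 4) * t)
      nlinarith
    calc Real.exp (-((t : ℂ) * z)).re * t * ‖k t‖
        ≤ Real.exp (-(z₀.re / 4) * t) * Real.exp (-(z₀.re / 4) * t) * t * ‖k t‖ := by gcongr
      _ = (Real.exp (-(z₀.re / 4) * t) * t) * (‖k t‖ * Real.exp (-(z₀.re / 4) * t)) := by ring
      _ ≤ _ := by gcongr
  · refine Eventually.of_forall fun t z _ => ?_
    have := ((hasDerivAt_id z).const_mul (t : ℂ)).neg.cexp.mul_const (k t : ℂ)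
    simpa using this

lemma eqOn_re_pos_of_eq_ofReal {f g : ℂ → ℂ} (hf : DifferentiableOn ℂ f {z | 0 < z.re})
    (hg : DifferentiableOn ℂ g {z | 0 < z.re}) (h : ∀ x : ℝ, 0 < x → f x = g x) {z : ℂ}
    (hz : 0 < z.re) : f z = g z := by
  have hconv : Convex ℝ {z : ℂ | 0 < z.re} := convex_halfSpace_re_gt 0
  refine AnalyticOnNhd.eqOn_of_preconnected_of_frequently_eq (hf.analyticOnNhd isOpen_re_pos)
    (hg.analyticOnNhd isOpen_re_pos) hconv.isPreconnected (z₀ := 1) (by simp) ?_ hz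
  have hseq : Tendsto (fun n : ℕ => ((1 + 1 / ((n : ℝ) + 1) : ℝ) : ℂ)) atTop (𝓝[≠] 1) := by
    refine tendsto_nhdsWithin_of_tendsto_nhds_of_eventually_within _ ?_
      (Eventually.of_forall fun n h => ?_)
    · have h1 : Tendsto (fun n : ℕ => (1 + 1 / ((n : ℝ) + 1) : ℝ)) atTop (𝓝 (1 + 0)) :=
        tendsto_const_nhds.add tendsto_one_div_add_atTop_nhds_zero_nat
      have h2 := (continuous_ofReal.tendsto _).comp h1
      rw [add_zero, ofReal_one] at h2
      exact h2
    · have h3 : (0 : ℝ) < 1 / ((n : ℝ) + 1) := by positivity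
      have h4 := congrArg re (Set.mem_singleton_iff.1 h)
      rw [ofReal_re, one_re] at h4
      linarith
  exact hseq.frequently (Frequently.of_forall fun n => h _ (by positivity))

lemma ofReal_integral_exp (k : ℝ → ℝ) (x : ℝ) :
    ∫ t in Set.Ioi (0 : ℝ), cexp (-(t * (x : ℂ))) * (k t : ℂ) =
      ((∫ t in Set.Ioi (0 : ℝ), Real.exp (-(x * t)) * k t : ℝ) : ℂ) := by
  refine Eq.trans ?_ integral_ofReal
  congr 1 with t
  simp [mul_comm (t : ℂ)]

lemma laplace_rpow_ofReal {a x : ℝ} (ha : 0 < a) (hx : 0 < x) :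
    ∫ t in Set.Ioi (0 : ℝ), Real.exp (-(x * t)) * t ^ (a - 1) = (1 / x) ^ a * Real.Gamma a := by
  rw [← Real.integral_rpow_mul_exp_neg_mul_Ioi ha hx]
  simp only [mul_comm]

/-- For positive real z this is the Gamma integral, and the identity theorem does the rest; a
natural exponent avoids choosing a branch of the power. -/
lemma laplace_rpow {n : ℕ} (hn : 0 < n) {z : ℂ} (hz : 0 < z.re) :
    ∫ t in Set.Ioi (0 : ℝ), cexp (-(t * z)) * ((t ^ ((n : ℝ) - 1) : ℝ) : ℂ) =
      (z ^ n)⁻¹ * Real.Gamma n := by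
  have hn' : (0 : ℝ) < n := by exact_mod_cast hn
  refine eqOn_re_pos_of_eq_ofReal (f := fun z => ∫ t in Set.Ioi (0 : ℝ),
    cexp (-(t * z)) * ((t ^ ((n : ℝ) - 1) : ℝ) : ℂ)) (g := fun z => (z ^ n)⁻¹ * Real.Gamma n)
    (laplaceConvergent_rpow hn').differentiableOn ?_ (fun x hx => ?_) hz
  · have h1 : DifferentiableOn ℂ (fun z : ℂ => z ^ n) {z | 0 < z.re} := by fun_prop
    have h2 : ∀ z ∈ {z : ℂ | 0 < z.re}, z ^ n ≠ 0 := fun z hz =>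
      pow_ne_zero _ (slitPlane_ne_zero (Or.inl hz))
    exact (h1.fun_inv h2).mul_const _
  · rw [ofReal_integral_exp (fun t => t ^ ((n : ℝ) - 1)), laplace_rpow_ofReal hn' hx]
    push_cast
    rw [Real.rpow_natCast]
    push_cast
    rw [one_div, inv_pow]

end Laplace

/-! ### Euler's beta integral on the half-line -/

section Beta

lemma ofReal_cpow_eq_exp {x : ℝ} (hx : 0 < x) (s : ℂ) : (x : ℂ) ^ s = cexp (Real.log x * s) := by
  rw [cpow_def_of_ne_zero (ofReal_ne_zero.2 hx.ne'), ofReal_log hx.le]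

/-- The substitution x = (1+t)⁻¹ carries the half-line to (0, 1) and this integral to the usual beta
integral. -/
lemma integral_beta_Ioi {u v : ℂ} (hu : 0 < u.re) (hv : 0 < v.re) :
    ∫ t in Set.Ioi (0 : ℝ), (t : ℂ) ^ (v - 1) * ((1 + t : ℝ) : ℂ) ^ (-(u + v)) =
      Gamma u * Gamma v / Gamma (u + v) := by
  have himg : (fun t : ℝ => (1 + t)⁻¹) '' Set.Ioi 0 = Set.Ioo 0 1 := by
    ext x
    simp only [Set.mem_image, Set.mem_Ioi, Set.mem_Ioo]
    constructor
    · rintro ⟨t, ht, rfl⟩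
      exact ⟨by positivity, inv_lt_one_of_one_lt₀ (by linarith)⟩
    · rintro ⟨h0, h1⟩
      refine ⟨x⁻¹ - 1, ?_, by simp⟩
      have := (one_lt_inv₀ h0).2 h1
      linarith
  have hder : ∀ t ∈ Set.Ioi (0 : ℝ), HasDerivWithinAt (fun t : ℝ => (1 + t)⁻¹)
      (-1 / (1 + t) ^ 2) (Set.Ioi 0) t := fun t (ht : 0 < t) => by
    have h := ((hasDerivAt_id t).const_add 1).fun_inv (by simp; linarith)
    simpa using h.hasDerivWithinAt
  have hinj : Set.InjOn (fun t : ℝ => (1 + t)⁻¹) (Set.Ioi 0) := fun a _ b _ h => by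
    simpa using inv_injective h
  rw [← betaIntegral_eq_Gamma_mul_div u v hu hv, betaIntegral,
    intervalIntegral.integral_of_le zero_le_one, integral_Ioc_eq_integral_Ioo, ← himg,
    integral_image_eq_integral_abs_deriv_smul measurableSet_Ioi hder hinj]
  refine setIntegral_congr_fun measurableSet_Ioi fun t (ht : 0 < t) => ?_
  have h1 : 0 < 1 + t := by linarith
  have e1 : (1 : ℂ) - (((1 + t)⁻¹ : ℝ) : ℂ) = ((t * (1 + t)⁻¹ : ℝ) : ℂ) := by
    rw [← ofReal_one, ← ofReal_sub]
    congr 1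
    field_simp
    ring
  have e2 : |-1 / (1 + t) ^ 2| = (1 + t)⁻¹ ^ 2 := by
    rw [abs_div, abs_neg, abs_one, abs_of_pos (by positivity), one_div, inv_pow]
  have e3 : (((1 + t)⁻¹ ^ 2 : ℝ) : ℂ) = cexp (-2 * Real.log (1 + t)) := by
    rw [show (-2 * Real.log (1 + t) : ℂ) = ((2 * Real.log (1 + t)⁻¹ : ℝ) : ℂ) by
      rw [Real.log_inv]; push_cast; ring, ← ofReal_exp, two_mul, Real.exp_add,
      Real.exp_log (by positivity), sq]
  simp only [e2, real_smul, e3]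
  rw [e1, ofReal_cpow_eq_exp ht, ofReal_cpow_eq_exp h1, ofReal_cpow_eq_exp (inv_pos.2 h1),
    ofReal_cpow_eq_exp (by positivity), Real.log_mul ht.ne' (by positivity), Real.log_inv,
    ← Complex.exp_add, ← Complex.exp_add, ← Complex.exp_add]
  congr 1
  push_cast
  ring

end Beta

/-! ### The Borel resummation -/

section Borel

/-- The density whose Laplace transform gives the Borel sum. -/
noncomputable def borelKernel (a b : ℕ) (t : ℝ) : ℝ := t ^ ((b : ℝ) - 1) * (1 + t) ^ (-(a : ℝ))

/-- The Borel sum as a single Laplace transform. -/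
noncomputable def laplaceResum (a b : ℕ) (z : ℂ) : ℂ :=
  z ^ b * (Real.Gamma b : ℂ)⁻¹ * ∫ t in Set.Ioi (0 : ℝ), cexp (-(t * z)) * (borelKernel a b t : ℂ)

variable {a b : ℕ}

lemma one_add_rpow_neg_le_one (a : ℕ) {t : ℝ} (ht : 0 < t) : (1 + t) ^ (-(a : ℝ)) ≤ 1 :=
  Real.rpow_le_one_of_one_le_of_nonpos (by linarith) (neg_nonpos.2 (Nat.cast_nonneg a))

lemma continuousOn_one_add_rpow (c : ℝ) : ContinuousOn (fun t : ℝ => (1 + t) ^ c) (Set.Ioi 0) :=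
  ContinuousOn.rpow_const (by fun_prop) fun t ht => Or.inl (by
    have : 0 < t := ht
    linarith)

lemma continuousOn_borelKernel : ContinuousOn (borelKernel a b) (Set.Ioi 0) :=
  (continuousOn_id.rpow_const fun _ ht => Or.inl (ne_of_gt ht)).mul (continuousOn_one_add_rpow _)

lemma borelKernel_nonneg {t : ℝ} (ht : 0 < t) : 0 ≤ borelKernel a b t := by
  rw [borelKernel]; positivity

lemma laplaceConvergent_borelKernel (hb : 0 < b) : LaplaceConvergent (borelKernel a b) := by
  refine laplaceConvergent_of_le (a := b) (C := 1) (by exact_mod_cast hb)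
    continuousOn_borelKernel fun t ht => ?_
  rw [abs_of_nonneg (borelKernel_nonneg ht), borelKernel, one_mul]
  exact mul_le_of_le_one_right (by positivity) (one_add_rpow_neg_le_one a ht)

/-- The substitution t = xu turns the convolution of the kernel with t^{a-1} into Euler's integral
for ₂F₁(a, b; a+b; -x). -/
lemma integral_borelKernel_mul_rpow (a b : ℕ) {x : ℝ} (hx : 0 < x) :
    ∫ t in (0 : ℝ)..x, borelKernel a b t * (x - t) ^ ((a : ℝ) - 1) =
      x ^ ((a : ℤ) + b - 1) *
        ∫ u in (0 : ℝ)..1, u ^ ((b : ℝ) - 1) * (1 - u) ^ ((a : ℝ) - 1) * (1 + x * u) ^ (-(a : ℝ)) := by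
  have h := intervalIntegral.mul_integral_comp_mul_left (a := 0) (b := 1) x
    (f := fun t => borelKernel a b t * (x - t) ^ ((a : ℝ) - 1))
  rw [mul_zero, mul_one] at h
  rw [← h, intervalIntegral.integral_of_le zero_le_one, intervalIntegral.integral_of_le zero_le_one,
    integral_Ioc_eq_integral_Ioo, integral_Ioc_eq_integral_Ioo, ← integral_const_mul,
    ← integral_const_mul]
  refine setIntegral_congr_fun measurableSet_Ioo fun u hu => ?_
  have h1 : 0 < 1 - u := by linarith [hu.2]
  have e : x ^ ((a : ℤ) + b - 1) = x * (x ^ ((b : ℝ) - 1) * x ^ ((a : ℝ) - 1)) := by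
    rw [← Real.rpow_intCast, show (((a : ℤ) + b - 1 : ℤ) : ℝ) = 1 + (((b : ℝ) - 1) + ((a : ℝ) - 1)) by
      push_cast; ring, Real.rpow_add hx, Real.rpow_add hx, Real.rpow_one]
  simp only [borelKernel]
  rw [e, Real.mul_rpow hx.le hu.1.le, show x - x * u = x * (1 - u) by ring,
    Real.mul_rpow hx.le h1.le]
  ring

/-- By Euler's integral the Borel integrand is a multiple of the convolution of e^{-tz}
`borelKernel` with e^{-tz} t^{a-1}. Integrability and factorisation are those of a convolution of
integrable functions; the second factor contributes Γ(a) z^{-a}. -/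
lemma exists_borelIntegrand (ha : 0 < a) (hb : 0 < b) {z : ℂ} (hz : 0 < z.re) :
    IntegrableOn (borelIntegrand a b z) (Set.Ioi 0) ∧
    ∫ t in Set.Ioi (0 : ℝ), borelIntegrand a b z t =
      (∫ t in Set.Ioi (0 : ℝ), cexp (-(t * z)) * (borelKernel a b t : ℂ)) *
        ((z ^ a)⁻¹ * (Real.Gamma b : ℂ)⁻¹) := by
  have ha' : (0 : ℝ) < a := by exact_mod_cast ha
  have hb' : (0 : ℝ) < b := by exact_mod_cast hb
  have hΓa := (Real.Gamma_pos_of_pos ha').ne'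
  have hΓb := (Real.Gamma_pos_of_pos hb').ne'
  have hΓab := (Real.Gamma_pos_of_pos (add_pos ha' hb')).ne'
  set f : ℝ → ℂ := fun t => cexp (-(t * z)) * (borelKernel a b t : ℂ) with hf
  set g : ℝ → ℂ := fun t => cexp (-(t * z)) * ((t ^ ((a : ℝ) - 1) : ℝ) : ℂ) with hg
  have hfi : IntegrableOn f (Set.Ioi 0) := (laplaceConvergent_borelKernel hb).integrableOn_cexp hz
  have hgi : IntegrableOn g (Set.Ioi 0) := (laplaceConvergent_rpow ha').integrableOn_cexp hz
  have hconv : ∀ x ∈ Set.Ioi (0 : ℝ), borelIntegrand a b z x =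
      (((Real.Gamma a * Real.Gamma b)⁻¹ : ℝ) : ℂ) *
        ∫ t in (0 : ℝ)..x, ContinuousLinearMap.mul ℝ ℂ (f t) (g (x - t)) := by
    intro x hx
    have e1 : ∀ t : ℝ, ContinuousLinearMap.mul ℝ ℂ (f t) (g (x - t)) =
        cexp (-(x * z)) * ((borelKernel a b t * (x - t) ^ ((a : ℝ) - 1) : ℝ) : ℂ) := fun t => by
      rw [ContinuousLinearMap.mul_apply', hf, hg]
      simp only
      rw [mul_mul_mul_comm, ← Complex.exp_add, ← ofReal_mul]
      congr 2
      push_cast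
      ring
    simp only [e1]
    rw [intervalIntegral.integral_const_mul, intervalIntegral.integral_ofReal,
      integral_borelKernel_mul_rpow a b hx, borelIntegrand, hyp2F1,
      mul_left_comm (((Real.Gamma a * Real.Gamma b)⁻¹ : ℝ) : ℂ), ← ofReal_mul]
    congr 2
    simp only [Int.cast_natCast, add_sub_cancel_right, neg_mul, sub_neg_eq_add]
    field_simp
    simp only [mul_comm x]
  have hint : IntegrableOn (fun x => ∫ t in (0 : ℝ)..x,
      ContinuousLinearMap.mul ℝ ℂ (f t) (g (x - t))) (Set.Ioi 0) := by
    have := integrable_posConvolution (ν := volume) (μ := volume) hfi hgi (ContinuousLinearMap.mul ℝ ℂ)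
    rwa [posConvolution, integrable_indicator_iff measurableSet_Ioi] at this
  constructor
  · exact IntegrableOn.congr_fun (hint.const_mul _) (fun x hx => (hconv x hx).symm) measurableSet_Ioi
  · rw [setIntegral_congr_fun measurableSet_Ioi hconv, integral_const_mul,
      integral_posConvolution (ν := volume) (μ := volume) hfi hgi, ContinuousLinearMap.mul_apply',
      hg, laplace_rpow ha hz]
    have : (Real.Gamma a : ℂ) ≠ 0 := ofReal_ne_zero.2 hΓa
    push_cast
    field_simp

lemma borelSum_eq_laplaceResum (ha : 0 < a) (hb : 0 < b) {z : ℂ} (hz : 0 < z.re) :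
    borelSum a b z = laplaceResum a b z := by
  have hz0 : z ≠ 0 := slitPlane_ne_zero (Or.inl hz)
  rw [borelSum, laplaceResum, (exists_borelIntegrand ha hb hz).2, zpow_add₀ hz0, zpow_natCast,
    zpow_natCast]
  generalize ∫ t in Set.Ioi (0 : ℝ), cexp (-(t * z)) * (borelKernel a b t : ℂ) = J
  field_simp

/-- Dropping (1+t)^{-a} ≤ 1 bounds the integral by Γ(b)(re z)^{-b}, hence the whole by (‖z‖/re z)^b.
This is why `IsMultiplier` allows such a factor. -/
lemma isMultiplier_laplaceResum (a : ℕ) (hb : 0 < b) : IsMultiplier (laplaceResum a b) := by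
  have hb' : (0 : ℝ) < b := by exact_mod_cast hb
  have hk := laplaceConvergent_borelKernel (a := a) hb
  have hΓ := Real.Gamma_pos_of_pos hb'
  refine ⟨?_, 1, 0, b, zero_le_one, fun z hz => ?_⟩
  · refine DifferentiableOn.mul ?_ hk.differentiableOn
    fun_prop
  · have h1 : ‖∫ t in Set.Ioi (0 : ℝ), cexp (-(t * z)) * (borelKernel a b t : ℂ)‖ ≤
        (1 / z.re) ^ (b : ℝ) * Real.Gamma b := by
      rw [← laplace_rpow_ofReal hb' hz]
      refine norm_integral_le_of_norm_le ?_ ?_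
      · have : IntegrableOn (fun t => Real.exp (-(z.re * t)) * t ^ ((b : ℝ) - 1)) (Set.Ioi 0) :=
          (integrableOn_rpow_mul_exp_neg hb' hz).congr_fun
            (fun t _ => by beta_reduce; rw [neg_mul, mul_comm]) measurableSet_Ioi
        exact this
      · filter_upwards [ae_restrict_mem measurableSet_Ioi] with t (ht : 0 < t)
        rw [norm_mul, norm_exp, norm_real, Real.norm_of_nonneg (borelKernel_nonneg ht), neg_re,
          re_ofReal_mul, mul_comm t]
        gcongr
        exact mul_le_of_le_one_right (by positivity) (one_add_rpow_neg_le_one a ht)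
    rw [laplaceResum, norm_mul, norm_mul, norm_pow, norm_inv, norm_real,
      Real.norm_of_nonneg hΓ.le, pow_zero, mul_one, one_mul]
    rw [Real.rpow_natCast] at h1
    calc ‖z‖ ^ b * (Real.Gamma b)⁻¹ * _
        ≤ ‖z‖ ^ b * (Real.Gamma b)⁻¹ * ((1 / z.re) ^ b * Real.Gamma b) := by gcongr
      _ = (‖z‖ / z.re) ^ b := by
        rw [one_div, inv_pow, div_pow]
        field_simp

end Borel

/-! ### The Mellin transform of the Borel sum -/

section BorelMellin

variable {a b : ℕ}

lemma integrable_mellin_exp {s : ℂ} {c : ℝ} (hs : 0 < s.re) (hc : 0 < c) :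
    IntegrableOn (fun x : ℝ => (x : ℂ) ^ (s - 1) * cexp (-(c * x))) (Set.Ioi 0) := by
  refine Integrable.mono' (integrableOn_rpow_mul_exp_neg hs hc) ?_ ?_
  · exact (Measurable.mul (by fun_prop) (by fun_prop)).aestronglyMeasurable
  · filter_upwards [ae_restrict_mem measurableSet_Ioi] with x (hx : 0 < x)
    rw [norm_mul, norm_cpow_eq_rpow_re_of_pos hx, norm_exp]
    simp

lemma integral_norm_mellin_exp {s : ℂ} {c : ℝ} (hs : 0 < s.re) (hc : 0 < c) :
    ∫ x in Set.Ioi (0 : ℝ), ‖(x : ℂ) ^ (s - 1) * cexp (-(c * x))‖ =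
      (1 / c) ^ s.re * Real.Gamma s.re := by
  rw [← Real.integral_rpow_mul_exp_neg_mul_Ioi hs hc]
  refine setIntegral_congr_fun measurableSet_Ioi fun x (hx : 0 < x) => ?_
  rw [norm_mul, norm_cpow_eq_rpow_re_of_pos hx, norm_exp]
  simp

lemma borelKernel_mul_one_add_cpow {w : ℂ} {t : ℝ} (ht : 0 < t) :
    (1 / ((1 + t : ℝ) : ℂ)) ^ (w + b) * (borelKernel a b t : ℂ) =
      (t : ℂ) ^ ((b : ℂ) - 1) * ((1 + t : ℝ) : ℂ) ^ (-(w + a + b)) := by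
  have h1 : 0 < 1 + t := by linarith
  rw [borelKernel, ofReal_mul, ofReal_cpow ht.le, ofReal_cpow h1.le, one_div, ← ofReal_inv,
    ofReal_cpow_eq_exp h1, ofReal_cpow_eq_exp h1, ofReal_cpow_eq_exp (inv_pos.2 h1), Real.log_inv,
    mul_left_comm, ← Complex.exp_add]
  push_cast
  congr 2
  ring

lemma integrable_beta_Ioi {x y : ℝ} (hx : 0 < x) (hy : 0 < y) :
    IntegrableOn (fun t : ℝ => (t : ℂ) ^ ((y : ℂ) - 1) * ((1 + t : ℝ) : ℂ) ^ (-((x : ℂ) + y)))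
      (Set.Ioi 0) := by
  -- A nonintegrable function would have integral 0 by convention, whereas the beta value is a
  -- nonzero quotient of Gamma values.
  by_contra h
  have h1 := integral_undef h
  rw [integral_beta_Ioi (by simpa) (by simpa)] at h1
  have h2 : (0 : ℝ) < ((x : ℂ) + y).re := by simp; positivity
  have h3 := Gamma_ne_zero_of_re_pos (s := (x : ℂ)) (by simpa)
  have h4 := Gamma_ne_zero_of_re_pos (s := (y : ℂ)) (by simpa)
  exact div_ne_zero (mul_ne_zero h3 h4) (Gamma_ne_zero_of_re_pos h2) h1

lemma measurable_borelKernel : Measurable (borelKernel a b) := by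
  unfold borelKernel
  fun_prop

/-- This justifies Fubini: in absolute value the x-integral is a Gamma integral, and a beta integral
in t remains. -/
lemma integrable_prod_mellin_borelKernel (hb : 0 < b) {s : ℂ} (hs : 0 < s.re + b)
    (ha : 0 < s.re + a) :
    Integrable (fun p : ℝ × ℝ => (p.1 : ℂ) ^ (s + b - 1) * cexp (-((1 + p.2 : ℝ) * p.1)) *
      (borelKernel a b p.2 : ℂ))
      ((volume.restrict (Set.Ioi 0)).prod (volume.restrict (Set.Ioi 0))) := by
  have hs' : 0 < (s + b).re := by simpa using hs
  have hb' : (0 : ℝ) < b := by exact_mod_cast hb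
  have hm : Measurable (fun p : ℝ × ℝ => (borelKernel a b p.2 : ℂ)) :=
    (measurable_ofReal.comp measurable_borelKernel).comp measurable_snd
  have hm' : Measurable (fun p : ℝ × ℝ => (p.1 : ℂ) ^ (s + b - 1) *
      cexp (-((1 + p.2 : ℝ) * p.1)) * (borelKernel a b p.2 : ℂ)) :=
    Measurable.mul (by fun_prop) hm
  rw [integrable_prod_iff' hm'.aestronglyMeasurable]
  constructor
  · filter_upwards [ae_restrict_mem measurableSet_Ioi] with t (ht : 0 < t)
    exact (integrable_mellin_exp hs' (c := 1 + t) (by linarith)).mul_const _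
  · have h := ((integrable_beta_Ioi (x := s.re + a) (y := b) ha hb').norm.const_mul
      (Real.Gamma (s.re + b)))
    refine IntegrableOn.congr_fun h (fun t ht => ?_) measurableSet_Ioi
    have ht : 0 < t := ht
    have h1 : 0 < 1 + t := by linarith
    have e := borelKernel_mul_one_add_cpow (a := a) (b := b) (w := (s.re : ℂ)) ht
    have e' := congrArg norm e
    rw [norm_mul, one_div, ← ofReal_inv, norm_cpow_eq_rpow_re_of_pos (inv_pos.2 h1)] at e'
    simp only [norm_mul (_ * _) ((borelKernel a b t : ℝ) : ℂ)]
    rw [integral_mul_const, integral_norm_mellin_exp hs' h1]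
    push_cast at e' ⊢
    rw [← e']
    simp
    ring

/-- After interchanging, the x-integral is Γ(v+b)(1+t)^{-(v+b)} and the t-integral is
Γ(v+a)Γ(b)/Γ(v+a+b); the factor Γ(b) cancels the normalisation. -/
lemma hasMellin_laplaceResum (hb : 0 < b) {v : ℂ} (h₁ : 0 < v.re + a) (h₂ : 0 < v.re + b) :
    HasMellin (fun x : ℝ => cexp (-x) * laplaceResum a b x) v
      (Gamma (v + a) * Gamma (v + b) / Gamma (v + a + b)) := by
  have hG := integrable_prod_mellin_borelKernel (s := v) hb h₂ h₁
  have hb' : (0 : ℝ) < b := by exact_mod_cast hb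
  have h₂' : 0 < (v + b).re := by simpa using h₂
  have hΓ : (Real.Gamma b : ℂ) ≠ 0 := ofReal_ne_zero.2 (Real.Gamma_pos_of_pos hb').ne'
  have hfun : ∀ x ∈ Set.Ioi (0 : ℝ), (x : ℂ) ^ (v - 1) • (cexp (-x) * laplaceResum a b x) =
      (Real.Gamma b : ℂ)⁻¹ * ∫ t in Set.Ioi (0 : ℝ),
        (x : ℂ) ^ (v + b - 1) * cexp (-((1 + t : ℝ) * x)) * (borelKernel a b t : ℂ) := by
    intro x (hx : 0 < x)
    have e1 : ∀ t : ℝ, (x : ℂ) ^ (v + b - 1) * cexp (-((1 + t : ℝ) * x)) * (borelKernel a b t : ℂ) =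
        ((x : ℂ) ^ (v + b - 1) * cexp (-x)) * (cexp (-(t * x)) * (borelKernel a b t : ℂ)) := by
      intro t
      rw [show -(((1 + t : ℝ) : ℂ) * x) = -x + -(t * x) by push_cast; ring, Complex.exp_add]
      ring
    simp only [e1]
    rw [integral_const_mul, laplaceResum, smul_eq_mul, show v + b - 1 = (v - 1) + b by ring,
      cpow_add _ _ (ofReal_ne_zero.2 hx.ne'), cpow_natCast]
    ring
  constructor
  · exact IntegrableOn.congr_fun (hG.integral_prod_left.const_mul _)
      (fun x hx => (hfun x hx).symm) measurableSet_Ioi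
  · rw [mellin, setIntegral_congr_fun measurableSet_Ioi hfun, integral_const_mul,
      integral_integral_swap hG]
    have e2 : ∀ t ∈ Set.Ioi (0 : ℝ), (∫ x in Set.Ioi (0 : ℝ),
        (x : ℂ) ^ (v + b - 1) * cexp (-((1 + t : ℝ) * x)) * (borelKernel a b t : ℂ)) =
        Gamma (v + b) * ((t : ℂ) ^ ((b : ℂ) - 1) * ((1 + t : ℝ) : ℂ) ^ (-(v + a + b))) := by
      intro t (ht : 0 < t)
      rw [integral_mul_const, integral_cpow_mul_exp_neg_mul_Ioi h₂' (by linarith),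
        ← borelKernel_mul_one_add_cpow ht]
      ring
    rw [setIntegral_congr_fun measurableSet_Ioi e2, integral_const_mul,
      integral_beta_Ioi (by simpa using h₁) (by simpa using hb'), ← ofReal_natCast b, Gamma_ofReal]
    field_simp

lemma isResummation_laplaceResum (hb : 0 < b) :
    IsResummation a b (laplaceResum a b) :=
  ⟨isMultiplier_laplaceResum a hb, fun v h₁ h₂ _ => by
    simpa using hasMellin_laplaceResum hb (by simpa using h₁) (by simpa using h₂)⟩

end BorelMellin

/-! ### Asymptotics of the Borel sum -/

section BorelAsymptotics

/-- The Taylor polynomial of `(1 + t)^{-a}` at `0`. -/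
noncomputable def binomialTaylor (a : ℝ) (N : ℕ) (t : ℝ) : ℝ :=
  ∑ n ∈ Finset.range N, (-1) ^ n * (ascPochhammer ℝ n).eval a / (n ! : ℝ) * t ^ n

lemma hasDerivAt_binomialTaylor (a : ℝ) (N : ℕ) (t : ℝ) :
    HasDerivAt (binomialTaylor a (N + 1)) (-a * binomialTaylor (a + 1) N t) t := by
  have h : binomialTaylor a (N + 1) = fun t => ∑ n ∈ Finset.range N,
      (-1) ^ (n + 1) * (ascPochhammer ℝ (n + 1)).eval a / ((n + 1)! : ℝ) * t ^ (n + 1) + 1 := by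
    ext t
    rw [binomialTaylor, Finset.sum_range_succ']
    simp
  rw [h, binomialTaylor, Finset.mul_sum]
  refine (HasDerivAt.fun_sum fun n _ => ?_).add_const 1
  refine ((hasDerivAt_pow (n + 1) t).const_mul _).congr_deriv ?_
  have hn : ((n ! : ℕ) : ℝ) ≠ 0 := by exact_mod_cast n.factorial_ne_zero
  have hn' : (n : ℝ) + 1 ≠ 0 := by positivity
  rw [ascPochhammer_succ_left, Nat.factorial_succ]
  simp only [Polynomial.eval_mul, Polynomial.eval_X, Polynomial.eval_comp, Polynomial.eval_add,
    Polynomial.eval_one, add_tsub_cancel_right]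
  push_cast
  field_simp
  ring

/-- The Taylor error for exponent a and order N+1 vanishes at 0 and has derivative -a times the
error for a+1 and order N, so induction over all a with the mean value inequality applies. -/
lemma exists_abs_one_add_rpow_sub_le (N : ℕ) {a : ℝ} (ha : 0 ≤ a) : ∃ C : ℝ, 0 ≤ C ∧
    ∀ t : ℝ, 0 ≤ t → |(1 + t) ^ (-a) - binomialTaylor a N t| ≤ C * t ^ N := by
  induction N generalizing a with
  | zero =>
    refine ⟨1, zero_le_one, fun t ht => ?_⟩
    rw [binomialTaylor, Finset.sum_range_zero, sub_zero, abs_of_nonneg (by positivity), pow_zero,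
      mul_one]
    exact Real.rpow_le_one_of_one_le_of_nonpos (by linarith) (neg_nonpos.2 ha)
  | succ N ih =>
    obtain ⟨C, hC, h⟩ := ih (a := a + 1) (by linarith)
    refine ⟨a * C, by positivity, fun t ht => ?_⟩
    have hd : ∀ x ∈ Set.Icc 0 t, HasDerivWithinAt
        (fun t : ℝ => (1 + t) ^ (-a) - binomialTaylor a (N + 1) t)
        (-a * ((1 + x) ^ (-(a + 1)) - binomialTaylor (a + 1) N x)) (Set.Icc 0 t) x := by
      intro x hx
      have h1 : (1 : ℝ) + x ≠ 0 := by linarith [hx.1]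
      have h2 := ((hasDerivAt_id x).const_add 1).rpow_const (p := -a) (Or.inl h1)
      refine (h2.sub (hasDerivAt_binomialTaylor a N x)).hasDerivWithinAt.congr_deriv ?_
      simp only [id]
      rw [show -a - 1 = -(a + 1) by ring]
      ring
    have hb : ∀ x ∈ Set.Icc 0 t,
        ‖-a * ((1 + x) ^ (-(a + 1)) - binomialTaylor (a + 1) N x)‖ ≤ a * (C * t ^ N) := by
      intro x hx
      rw [norm_mul, norm_neg, Real.norm_of_nonneg ha]
      refine mul_le_mul_of_nonneg_left ((h x hx.1).trans ?_) ha
      have := hx.1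
      have := hx.2
      gcongr
    have hmv := Convex.norm_image_sub_le_of_norm_hasDerivWithin_le hd hb (convex_Icc 0 t)
      (Set.left_mem_Icc.2 ht) (Set.right_mem_Icc.2 ht)
    have h0 : (1 + (0 : ℝ)) ^ (-a) - binomialTaylor a (N + 1) 0 = 0 := by
      rw [binomialTaylor, Finset.sum_range_succ']
      simp
    simp only [h0] at hmv
    rw [sub_zero, sub_zero, Real.norm_eq_abs, Real.norm_of_nonneg ht] at hmv
    exact hmv.trans (le_of_eq (by ring))

variable {a b : ℕ}

lemma Real_Gamma_add_natCast {x : ℝ} (hx : 0 < x) (n : ℕ) :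
    Real.Gamma (x + n) = Real.Gamma x * (ascPochhammer ℝ n).eval x := by
  induction n with
  | zero => simp
  | succ n ih =>
    rw [ascPochhammer_succ_eval, Nat.cast_succ, ← add_assoc, Real.Gamma_add_one (by positivity), ih]
    ring

lemma integrableOn_exp_mul_rpow {a x : ℝ} (ha : 0 < a) (hx : 0 < x) :
    IntegrableOn (fun t : ℝ => Real.exp (-(x * t)) * t ^ (a - 1)) (Set.Ioi 0) :=
  (integrableOn_rpow_mul_exp_neg ha hx).congr_fun
    (fun t _ => by beta_reduce; rw [neg_mul, mul_comm]) measurableSet_Ioi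

/-- Watson's lemma with a global error bound: the Laplace transform of t^{b-1+n} produces Γ(b+n) =
Γ(b)(b)ₙ, so the Taylor coefficients of (1+t)^{-a} become (a)ₙ(b)ₙ/n! (-x)^{-n}. -/
lemma exists_norm_laplaceResum_sub_asymSum_le (a : ℕ) (hb : 0 < b) (N : ℕ) : ∃ C : ℝ, 0 ≤ C ∧
    ∀ x : ℝ, 0 < x → ‖laplaceResum a b x - asymSum a b N x‖ ≤ C * (x ^ N)⁻¹ := by
  obtain ⟨C, hC, h⟩ := exists_abs_one_add_rpow_sub_le N (a := a) (Nat.cast_nonneg a)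
  have hb' : (0 : ℝ) < b := by exact_mod_cast hb
  have hΓ := Real.Gamma_pos_of_pos hb'
  have hcast : ∀ (n c : ℕ), (ascPochhammer ℂ n).eval ((c : ℤ) : ℂ) =
      (((ascPochhammer ℝ n).eval (c : ℝ) : ℝ) : ℂ) := fun n c => by
    rw [Int.cast_natCast, ← ascPochhammer_eval_cast, ← ascPochhammer_eval_cast, ofReal_natCast]
  have hΓN : 0 < Real.Gamma (b + N) := Real.Gamma_pos_of_pos (by positivity)
  refine ⟨(Real.Gamma b)⁻¹ * (C * Real.Gamma (b + N)), by positivity, fun x hx => ?_⟩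
  have hpow : ∀ (n : ℕ) {t : ℝ}, 0 < t → t ^ ((b : ℝ) - 1) * t ^ n = t ^ ((b + n : ℝ) - 1) :=
    fun n t ht => by
      rw [← Real.rpow_natCast, ← Real.rpow_add ht]; congr 1; ring
  have hmono : ∀ n : ℕ, IntegrableOn
      (fun t : ℝ => Real.exp (-(x * t)) * (t ^ ((b : ℝ) - 1) * t ^ n)) (Set.Ioi 0) ∧
      ∫ t in Set.Ioi (0 : ℝ), Real.exp (-(x * t)) * (t ^ ((b : ℝ) - 1) * t ^ n) =
        (x ^ b)⁻¹ * (x ^ n)⁻¹ * Real.Gamma (b + n) := by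
    intro n
    have hbn : (0 : ℝ) < b + n := by positivity
    have heq : ∀ t ∈ Set.Ioi (0 : ℝ), Real.exp (-(x * t)) * t ^ ((b + n : ℝ) - 1) =
        Real.exp (-(x * t)) * (t ^ ((b : ℝ) - 1) * t ^ n) := fun t ht => by rw [hpow n ht]
    refine ⟨(integrableOn_exp_mul_rpow hbn hx).congr_fun heq measurableSet_Ioi, ?_⟩
    rw [← setIntegral_congr_fun measurableSet_Ioi heq, laplace_rpow_ofReal hbn hx,
      ← Nat.cast_add, Real.rpow_natCast, one_div, inv_pow, pow_add, mul_inv]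
  have hpoly : IntegrableOn
      (fun t : ℝ => Real.exp (-(x * t)) * (t ^ ((b : ℝ) - 1) * binomialTaylor a N t)) (Set.Ioi 0) ∧
      ∫ t in Set.Ioi (0 : ℝ), Real.exp (-(x * t)) * (t ^ ((b : ℝ) - 1) * binomialTaylor a N t) =
        ∑ n ∈ Finset.range N, (-1) ^ n * (ascPochhammer ℝ n).eval (a : ℝ) / (n ! : ℝ) *
          ((x ^ b)⁻¹ * (x ^ n)⁻¹ * Real.Gamma (b + n)) := by
    have heq : ∀ t : ℝ, Real.exp (-(x * t)) * (t ^ ((b : ℝ) - 1) * binomialTaylor a N t) =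
        ∑ n ∈ Finset.range N, (-1) ^ n * (ascPochhammer ℝ n).eval (a : ℝ) / (n ! : ℝ) *
          (Real.exp (-(x * t)) * (t ^ ((b : ℝ) - 1) * t ^ n)) := fun t => by
      rw [binomialTaylor, Finset.mul_sum, Finset.mul_sum]
      exact Finset.sum_congr rfl fun n _ => by ring
    simp only [heq]
    refine ⟨integrable_finsetSum _ fun n _ => (hmono n).1.const_mul _, ?_⟩
    rw [integral_finsetSum _ fun n _ => (hmono n).1.const_mul _]
    exact Finset.sum_congr rfl fun n _ => by rw [integral_const_mul, (hmono n).2]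
  have hker : IntegrableOn (fun t : ℝ => Real.exp (-(x * t)) * borelKernel a b t) (Set.Ioi 0) :=
    ((laplaceConvergent_borelKernel hb).integrableOn x hx).congr_fun
      (fun t _ => by beta_reduce; rw [neg_mul, mul_comm]) measurableSet_Ioi
  have hsum : asymSum a b N x = ((x ^ b * (Real.Gamma b)⁻¹ * ∫ t in Set.Ioi (0 : ℝ),
      Real.exp (-(x * t)) * (t ^ ((b : ℝ) - 1) * binomialTaylor a N t) : ℝ) : ℂ) := by
    rw [hpoly.2, asymSum, Finset.mul_sum, ofReal_sum]
    refine Finset.sum_congr rfl fun n _ => ?_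
    have e1 : asymCoef a b n = (((ascPochhammer ℝ n).eval (a : ℝ) *
        (ascPochhammer ℝ n).eval (b : ℝ) / (n ! : ℝ) : ℝ) : ℂ) := by
      rw [asymCoef, hcast, hcast]; push_cast; rfl
    rw [e1, ← ofReal_neg, ← ofReal_pow, ← ofReal_inv, ← ofReal_mul, Real_Gamma_add_natCast hb',
      neg_pow x, mul_inv, ← inv_pow (-1 : ℝ), inv_neg_one]
    congr 1
    field_simp
  rw [laplaceResum, ofReal_integral_exp, hsum]
  rw [← ofReal_pow, ← ofReal_inv, ← ofReal_mul, ← ofReal_mul, ← ofReal_sub, norm_real, ← mul_sub,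
    ← integral_sub hker hpoly.1, norm_mul, Real.norm_of_nonneg (by positivity)]
  have hle : ‖∫ t in Set.Ioi (0 : ℝ), (Real.exp (-(x * t)) * borelKernel a b t -
      Real.exp (-(x * t)) * (t ^ ((b : ℝ) - 1) * binomialTaylor a N t))‖ ≤
      C * ((x ^ b)⁻¹ * (x ^ N)⁻¹ * Real.Gamma (b + N)) := by
    rw [← (hmono N).2, ← integral_const_mul]
    refine norm_integral_le_of_norm_le ((hmono N).1.const_mul C) ?_
    filter_upwards [ae_restrict_mem measurableSet_Ioi] with t (ht : 0 < t)
    rw [← mul_sub, borelKernel, ← mul_sub, norm_mul, norm_mul, Real.norm_of_nonneg (by positivity),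
      Real.norm_of_nonneg (by positivity), Real.norm_eq_abs]
    calc _ ≤ Real.exp (-(x * t)) * (t ^ ((b : ℝ) - 1) * (C * t ^ N)) := by
          gcongr; exact h t ht.le
      _ = _ := by ring
  calc _ ≤ x ^ b * (Real.Gamma b)⁻¹ * (C * ((x ^ b)⁻¹ * (x ^ N)⁻¹ * Real.Gamma (b + N))) := by
        gcongr
    _ = _ := by field_simp

end BorelAsymptotics

/-! ### The non-perturbative terms -/

section NonPerturbative

variable {r₁ r₂ : ℕ} [NeZero r₁] [NeZero r₂] {s₁ s₂ : ℤ} {χ₁ : DirichletCharacter ℂ r₁}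
  {χ₂ : DirichletCharacter ℂ r₂}

lemma IsResummation.swap {B : ℂ → ℂ} (hB : IsResummation s₁ s₂ B) : IsResummation s₂ s₁ B :=
  ⟨hB.isMultiplier, fun v h₁ h₂ h₃ => by
    have := hB.hasMellin v h₂ h₁ (by linarith)
    rwa [mul_comm (Gamma _), add_right_comm] at this⟩

lemma asymCoef_swap (n : ℕ) : asymCoef s₁ s₂ n = asymCoef s₂ s₁ n := by
  rw [asymCoef, asymCoef, mul_comm (Polynomial.eval _ _)]

lemma asymSum_swap (N : ℕ) : asymSum s₁ s₂ N = asymSum s₂ s₁ N := by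
  ext z
  exact Finset.sum_congr rfl fun n _ => by rw [asymCoef_swap]

lemma exists_isResummation_asymSum (h : s₁ ≤ 0 ∨ s₂ ≤ 0) :
    ∃ m : ℕ, IsResummation s₁ s₂ (asymSum s₁ s₂ (m + 1)) ∧ (s₁ = -m ∨ s₂ = -m) := by
  rcases h with h | h
  · exact ⟨(-s₁).toNat, isResummation_asymSum (by omega), Or.inl (by omega)⟩
  · refine ⟨(-s₂).toNat, ?_, Or.inr (by omega)⟩
    rw [asymSum_swap]
    exact (isResummation_asymSum (by omega)).swap

lemma asymCoef_eq_zero {m n : ℕ} (h : s₁ = -m ∨ s₂ = -m) (hn : m < n) : asymCoef s₁ s₂ n = 0 := by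
  have h0 := ascPochhammer_eval_neg_coe_nat_of_lt (R := ℂ) hn
  rcases h with rfl | rfl <;> simp [asymCoef, h0]

lemma asymSum_eq_of_le {m N : ℕ} (h : s₁ = -m ∨ s₂ = -m) (hN : m + 1 ≤ N) :
    asymSum s₁ s₂ N = asymSum s₁ s₂ (m + 1) := by
  ext z
  rw [asymSum, asymSum]
  refine (Finset.sum_subset (Finset.range_mono hN) fun n _ hn => ?_).symm
  rw [asymCoef_eq_zero h (by rw [Finset.mem_range] at hn; omega), zero_mul]

/-- For x ≥ 1 the power x^{-N} dominates all later ones. This range suffices, since for small y all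
arguments of B exceed 1. -/
lemma exists_norm_asymSum_sub_le (s₁ s₂ : ℤ) {M N : ℕ} (h : N ≤ M) : ∃ C : ℝ, 0 ≤ C ∧
    ∀ x : ℝ, 1 ≤ x → ‖asymSum s₁ s₂ M x - asymSum s₁ s₂ N x‖ ≤ C * (x ^ N)⁻¹ := by
  refine ⟨∑ n ∈ Finset.Ico N M, ‖asymCoef s₁ s₂ n‖, Finset.sum_nonneg fun _ _ => norm_nonneg _,
    fun x hx => ?_⟩
  rw [asymSum, asymSum, ← Finset.sum_Ico_eq_sub _ h, Finset.sum_mul]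
  refine norm_sum_le_of_le _ fun n hn => ?_
  rw [norm_mul, norm_inv, norm_pow, norm_neg, norm_real, Real.norm_of_nonneg (by linarith)]
  gcongr
  exact (Finset.mem_Ico.1 hn).1

/-- In every case there is a resummation, with the expected asymptotic expansion. -/
lemma exists_isResummation (s₁ s₂ : ℤ) : ∃ B : ℂ → ℂ, IsResummation s₁ s₂ B ∧
    ∀ N : ℕ, ∃ C : ℝ, 0 ≤ C ∧ ∀ x : ℝ, 1 ≤ x → ‖B x - asymSum s₁ s₂ N x‖ ≤ C * (x ^ N)⁻¹ := by
  by_cases h : s₁ ≤ 0 ∨ s₂ ≤ 0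
  · obtain ⟨m, hm, hs⟩ := exists_isResummation_asymSum h
    refine ⟨_, hm, fun N => ?_⟩
    -- Coefficients beyond m vanish, so B may be written with max(N, m+1) terms, which makes it an
    -- extension of the N-term sum.
    rw [← asymSum_eq_of_le hs (le_max_right N (m + 1))]
    exact exists_norm_asymSum_sub_le s₁ s₂ (le_max_left _ _)
  · push Not at h
    lift s₁ to ℕ using h.1.le
    lift s₂ to ℕ using h.2.le
    have hb : 0 < s₂ := by exact_mod_cast h.2
    refine ⟨_, isResummation_laplaceResum hb, fun N => ?_⟩
    obtain ⟨C, hC, hle⟩ := exists_norm_laplaceResum_sub_asymSum_le s₁ hb N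
    exact ⟨C, hC, fun x hx => hle x (by linarith)⟩

lemma neg_two_pi_I_mul_fricke {r₁ r₂ : ℕ} (τ : ℂ) :
    -2 * π * I * fricke (r₁ * r₂) τ = 2 * π * I / ((r₁ : ℂ) * r₂ * τ) := by
  rw [fricke]
  push_cast
  ring

lemma coef_add_natCast {r₁ r₂ : ℕ} {s₁ s₂ : ℤ} {χ₁ : DirichletCharacter ℂ r₁}
    {χ₂ : DirichletCharacter ℂ r₂} (n : ℕ) (p : ℕ+ × ℕ+) :
    coef (s₁ + n) (s₂ + n) χ₁ χ₂ p = coef s₁ s₂ χ₁ χ₂ p * ((prodR p : ℂ) ^ n)⁻¹ := by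
  have h1 : ((p.1 : ℕ) : ℂ) ≠ 0 := by exact_mod_cast p.1.ne_zero
  have h2 : ((p.2 : ℕ) : ℂ) ≠ 0 := by exact_mod_cast p.2.ne_zero
  rw [coef, coef, prodR, zpow_add₀ h1, zpow_add₀ h2, zpow_natCast, zpow_natCast]
  push_cast
  rw [mul_pow, mul_inv]
  simp only [div_eq_mul_inv, mul_inv]
  ring

lemma npSum_sub {B B' : ℂ → ℂ} (hB : IsMultiplier B) (hB' : IsMultiplier B') {τ : ℂ}
    (hτ : 0 < τ.im) :
    npSum s₁ s₂ χ₁ χ₂ B τ - npSum s₁ s₂ χ₁ χ₂ B' τ = npSum s₁ s₂ χ₁ χ₂ (fun z => B z - B' z) τ := by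
  have hζ := re_two_pi_I_div_pos (r₁ := r₁) (r₂ := r₂) hτ
  rw [npSum, npSum, npSum, ← mul_sub, ← (hB.summable_mulTerm _ _ _ _ hζ).tsum_sub
    (hB'.summable_mulTerm _ _ _ _ hζ)]
  congr 1
  refine tsum_congr fun n => ?_
  rw [mulTerm, mulTerm, mulTerm]
  ring

/-- Raising both parameters by n divides the coefficient by (n₁n₂)ⁿ. With the extra power of r₁r₂τ
and (-2πi)^{-n} this is (-z)^{-n} at z = 2πi n₁n₂/(r₁r₂τ). -/
lemma npTerm_eq_npSum {τ : ℂ} (hτ : 0 < τ.im) (n : ℕ) :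
    npTerm s₁ s₂ χ₁ χ₂ τ n =
      npSum s₁ s₂ χ₁ χ₂ (fun z => asymCoef s₁ s₂ n * ((-z) ^ n)⁻¹) τ := by
  have hτ0 : τ ≠ 0 := fun h => by simp [h] at hτ
  have hw : (r₁ : ℂ) * r₂ * τ ≠ 0 := mul_ne_zero (mul_ne_zero (NeZero.ne _) (NeZero.ne _)) hτ0
  have hpi : (2 * π * I : ℂ) ≠ 0 := two_pi_I_ne_zero
  rw [npTerm, npSum, frickeCoeff, ← asymCoef, Xi, ← tsum_mul_left, ← tsum_mul_left]
  refine tsum_congr fun p => ?_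
  have hp : (prodR p : ℂ) ≠ 0 := ofReal_ne_zero.2 (prodR_pos p).ne'
  rw [xiTerm_eq, neg_two_pi_I_mul_fricke, coef_add_natCast, mulTerm,
    show s₁ + s₂ + n - 1 = (s₁ + s₂ - 1) + n by ring, zpow_add₀ hw, zpow_natCast]
  generalize (r₁ : ℂ) * r₂ * τ = w at hw ⊢
  rw [show -(2 * π * I / w * (prodR p : ℂ)) = (-2 * π * I) * (prodR p : ℂ) / w by ring, div_pow,
    mul_pow _ (prodR p : ℂ), inv_div]
  have hpi' : (-2 * π * I : ℂ) ≠ 0 := by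
    rw [show (-2 * π * I : ℂ) = -(2 * π * I) by ring]; exact neg_ne_zero.2 hpi
  generalize (-2 * π * I : ℂ) = q at hpi' ⊢
  field_simp

lemma sum_npTerm {τ : ℂ} (hτ : 0 < τ.im) (N : ℕ) :
    ∑ n ∈ Finset.range N, npTerm s₁ s₂ χ₁ χ₂ τ n =
      npSum s₁ s₂ χ₁ χ₂ (asymSum s₁ s₂ N) τ := by
  induction N with
  | zero => simp [npSum, asymSum, mulTerm]
  | succ N ih =>
    rw [Finset.sum_range_succ, ih, npTerm_eq_npSum hτ, eq_comm, ← sub_eq_iff_eq_add',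
      npSum_sub (isMultiplier_asymSum _ _ _) (isMultiplier_asymSum _ _ _) hτ]
    congr 1
    ext z
    rw [asymSum, asymSum, Finset.sum_range_succ, add_sub_cancel_left]

lemma Xi_eq_of_left_nonpos (h₁ : χ₁.IsPrimitive) (h₂ : χ₂.IsPrimitive)
    (hpar : s₁ + s₂ ≡ parity χ₁ + parity χ₂ + 1 [ZMOD 2]) (hs : s₁ ≤ 0) {τ : ℂ} (hτ : 0 < τ.im) :
    Xi s₁ s₂ χ₁ χ₂ τ = XiPert s₁ s₂ χ₁ χ₂ τ +
      ∑ n ∈ Finset.range ((-s₁).toNat + 1), npTerm s₁ s₂ χ₁ χ₂ τ n := by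
  rw [sum_npTerm hτ, add_comm]
  exact Xi_eq_XiPert_add_npSum h₁ h₂ hpar (isResummation_asymSum (by omega)) hτ

lemma Xi_eq_of_right_nonpos (h₁ : χ₁.IsPrimitive) (h₂ : χ₂.IsPrimitive)
    (hpar : s₁ + s₂ ≡ parity χ₁ + parity χ₂ + 1 [ZMOD 2]) (hs : s₂ ≤ 0) {τ : ℂ} (hτ : 0 < τ.im) :
    Xi s₁ s₂ χ₁ χ₂ τ = XiPert s₁ s₂ χ₁ χ₂ τ +
      ∑ n ∈ Finset.range ((-s₂).toNat + 1), npTerm s₁ s₂ χ₁ χ₂ τ n := by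
  rw [sum_npTerm hτ, add_comm, asymSum_swap]
  exact Xi_eq_XiPert_add_npSum h₁ h₂ hpar (isResummation_asymSum (by omega)).swap hτ

lemma integrableOn_borelIntegrand (hs₁ : 0 < s₁) (hs₂ : 0 < s₂) {z : ℂ} (hz : 0 < z.re) :
    IntegrableOn (borelIntegrand s₁ s₂ z) (Set.Ioi 0) := by
  lift s₁ to ℕ using hs₁.le
  lift s₂ to ℕ using hs₂.le
  exact (exists_borelIntegrand (by exact_mod_cast hs₁) (by exact_mod_cast hs₂) hz).1

lemma hasSum_npResummedTerm (h₁ : χ₁.IsPrimitive) (h₂ : χ₂.IsPrimitive)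
    (hpar : s₁ + s₂ ≡ parity χ₁ + parity χ₂ + 1 [ZMOD 2]) (hs₁ : 0 < s₁) (hs₂ : 0 < s₂)
    {τ : ℂ} (hτ : 0 < τ.im) : HasSum (npResummedTerm s₁ s₂ χ₁ χ₂ τ)
      (Xi s₁ s₂ χ₁ χ₂ τ - XiPert s₁ s₂ χ₁ χ₂ τ) := by
  lift s₁ to ℕ using hs₁.le
  lift s₂ to ℕ using hs₂.le
  have ha : 0 < s₁ := by exact_mod_cast hs₁
  have hb : 0 < s₂ := by exact_mod_cast hs₂
  have hB : IsResummation s₁ s₂ (laplaceResum s₁ s₂) := isResummation_laplaceResum hb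
  have hζ := re_two_pi_I_div_pos (r₁ := r₁) (r₂ := r₂) hτ
  rw [Xi_eq_XiPert_add_npSum h₁ h₂ hpar hB hτ, add_sub_cancel_right, npSum]
  refine ((hB.isMultiplier.summable_mulTerm _ _ _ _ hζ).hasSum.mul_left _).congr_fun ?_
  intro n
  rw [npResummedTerm, xiTerm_eq, neg_two_pi_I_mul_fricke, mulTerm, mul_assoc (coef _ _ _ _ _)]
  have e : 2 * π * I * ((n.1 : ℂ) * (n.2 : ℂ)) / ((r₁ : ℂ) * r₂ * τ) =
      2 * π * I / ((r₁ : ℂ) * r₂ * τ) * prodR n := by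
    rw [prodR]; push_cast; ring
  rw [e, borelSum_eq_laplaceResum ha hb (re_mul_prodR_pos hζ n)]

/-- For y < c only arguments w n₁n₂ of B with w = c/y ≥ 1 occur. The bound x^{-N} gives the factor
y^N, and the series is of size e^{-w}. -/
lemma npSum_isBigO {B : ℂ → ℂ} {C : ℝ} {N : ℕ} (hC : 0 ≤ C)
    (hle : ∀ x : ℝ, 1 ≤ x → ‖B x‖ ≤ C * (x ^ N)⁻¹) :
    (fun y : ℝ => npSum s₁ s₂ χ₁ χ₂ B (I * y)) =O[𝓝[>] 0]
      fun y : ℝ => y ^ (s₁ + s₂ + N - 1) * Real.exp (-(2 * π) / (r₁ * r₂ * y)) := by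
  have p1 : (0 : ℝ) < r₁ := by exact_mod_cast Nat.pos_of_ne_zero (NeZero.ne r₁)
  have p2 : (0 : ℝ) < r₂ := by exact_mod_cast Nat.pos_of_ne_zero (NeZero.ne r₂)
  set c : ℝ := 2 * π / (r₁ * r₂) with hc
  have hc0 : 0 < c := by positivity
  obtain ⟨C', hC', hsum⟩ := exists_tsum_prodR_le (s₁.natAbs + s₂.natAbs) one_pos
  obtain ⟨A, hA⟩ : ∃ A, A = frickeConst s₁ s₂ χ₁ χ₂ * ((r₁ : ℂ) * r₂ * I) ^ (s₁ + s₂ - 1) :=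
    ⟨_, rfl⟩
  refine IsBigO.of_bound (‖A‖ * (C * (c ^ N)⁻¹ * C')) ?_
  have hmem : Set.Ioo 0 c ∈ 𝓝[>] (0 : ℝ) := Ioo_mem_nhdsGT hc0
  filter_upwards [hmem] with y ⟨hy, hyc⟩
  set w : ℝ := c * y⁻¹ with hw
  have hw1 : 1 ≤ w := by
    rw [hw, ← div_eq_mul_inv, one_le_div hy]; exact hyc.le
  have hterm : ∀ n : ℕ+ × ℕ+, ‖mulTerm s₁ s₂ (star χ₂) (star χ₁) B ((c : ℝ) * (y⁻¹ : ℝ)) n‖ ≤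
      C * (w ^ N)⁻¹ * (prodR n ^ (s₁.natAbs + s₂.natAbs) * Real.exp (-w * prodR n)) := by
    intro n
    have hn := one_le_prodR n
    have hwn : 1 ≤ w * prodR n := one_le_mul_of_one_le_of_one_le hw1 hn
    have e : ((c : ℝ) : ℂ) * ((y⁻¹ : ℝ) : ℂ) * (prodR n : ℂ) = ((w * prodR n : ℝ) : ℂ) := by
      rw [hw]; push_cast; ring
    rw [mulTerm, e, norm_mul, norm_mul, ← ofReal_neg, ← ofReal_exp, norm_real,
      Real.norm_of_nonneg (Real.exp_pos _).le]
    have h1 := norm_coef_le s₁ s₂ (star χ₂) (star χ₁) n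
    have h2 : ‖B ((w * prodR n : ℝ) : ℂ)‖ ≤ C * (w ^ N)⁻¹ := by
      refine (hle _ hwn).trans ?_
      gcongr
      exact le_mul_of_one_le_right (by linarith) hn
    calc _ ≤ prodR n ^ (s₁.natAbs + s₂.natAbs) * (Real.exp (-(w * prodR n)) * (C * (w ^ N)⁻¹)) := by
          gcongr
      _ = _ := by rw [neg_mul]; ring
  have hsumm := (summable_prodR_pow_mul_exp (s₁.natAbs + s₂.natAbs)
    (one_pos.trans_le hw1)).mul_left (C * (w ^ N)⁻¹)
  have hS := tsum_of_norm_bounded hsumm.hasSum hterm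
  rw [tsum_mul_left] at hS
  rw [npSum_I_mul hy, ← hA, smul_eq_mul, norm_mul, norm_mul, cpow_intCast, norm_zpow, norm_real,
    norm_mul, norm_zpow, Real.norm_of_nonneg hy.le, Real.norm_of_nonneg (Real.exp_pos _).le]
  have e1 : y ^ (s₁ + s₂ + N - 1) = y ^ (s₁ + s₂ - 1) * y ^ N := by
    rw [← zpow_natCast, ← zpow_add₀ hy.ne']; congr 1; ring
  have e2 : -(2 * π) / (r₁ * r₂ * y) = -w := by
    rw [hw, hc]; field_simp
  have e3 : (w ^ N)⁻¹ = (c ^ N)⁻¹ * y ^ N := by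
    rw [hw, mul_pow, mul_inv, inv_pow, inv_inv]
  rw [e1, e2]
  calc _ ≤ ‖A‖ * (y ^ (s₁ + s₂ - 1) * (C * (w ^ N)⁻¹ * (C' * Real.exp (-w)))) := by
        have hyp : 0 ≤ y ^ (s₁ + s₂ - 1) := zpow_nonneg hy.le _
        refine mul_le_mul_of_nonneg_left (mul_le_mul_of_nonneg_left (hS.trans ?_) hyp)
          (norm_nonneg _)
        exact mul_le_mul_of_nonneg_left (hsum w hw1) (by positivity)
    _ = _ := by rw [e3]; ring

lemma isBigO_remainder (h₁ : χ₁.IsPrimitive) (h₂ : χ₂.IsPrimitive)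
    (hpar : s₁ + s₂ ≡ parity χ₁ + parity χ₂ + 1 [ZMOD 2]) (N : ℕ) :
    (fun y : ℝ => Xi s₁ s₂ χ₁ χ₂ (I * y) - XiPert s₁ s₂ χ₁ χ₂ (I * y) -
      ∑ n ∈ Finset.range N, npTerm s₁ s₂ χ₁ χ₂ (I * y) n) =O[𝓝[>] 0]
        fun y : ℝ => y ^ (s₁ + s₂ + N - 1) * Real.exp (-(2 * π) / (r₁ * r₂ * y)) := by
  obtain ⟨B, hB, hasym⟩ := exists_isResummation s₁ s₂
  obtain ⟨C, hC, hle⟩ := hasym N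
  refine (npSum_isBigO (χ₁ := χ₁) (χ₂ := χ₂) (B := fun z => B z - asymSum s₁ s₂ N z) hC
    hle).congr' ?_ EventuallyEq.rfl
  filter_upwards [self_mem_nhdsWithin] with y (hy : 0 < y)
  have hτ : 0 < (I * (y : ℂ)).im := by simpa using hy
  rw [Xi_eq_XiPert_add_npSum h₁ h₂ hpar hB hτ, add_sub_cancel_right, sum_npTerm hτ,
    npSum_sub hB.isMultiplier (isMultiplier_asymSum _ _ _) hτ]

end NonPerturbative

/-! ### The perturbative part -/

section Perturbative

/-- These are the trivial zeros. The excluded case n = 0, r = 1 is ζ(0) ≠ 0; for even χ with r > 1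
the value at 0 is -χ(0)/2 = 0. -/
lemma LFunction_intCast_eq_zero {r : ℕ} [NeZero r] (χ : DirichletCharacter ℂ r) {n : ℤ}
    (hn : n ≤ 0) (h : n ≡ parity χ [ZMOD 2]) (h0 : n ≠ 0 ∨ r ≠ 1) : χ.LFunction n = 0 := by
  rcases χ.even_or_odd with hχ | hχ
  · rw [parity, if_pos hχ] at h
    obtain ⟨m, rfl⟩ : ∃ m : ℕ, n = -(2 * m : ℕ) := by
      have := h.dvd
      exact ⟨(-n / 2).toNat, by omega⟩
    rcases Nat.eq_zero_or_pos m with rfl | hm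
    · have hr : r ≠ 1 := by simpa using h0
      have : Fact (1 < r) := ⟨by have := NeZero.ne r; omega⟩
      simp only [mul_zero, CharP.cast_eq_zero, neg_zero, Int.cast_zero]
      rw [DirichletCharacter.LFunction, ZMod.LFunction_apply_zero_of_even hχ.to_fun,
        MulChar.map_zero, neg_zero, zero_div]
    · have : NeZero m := ⟨hm.ne'⟩
      have := hχ.LFunction_neg_two_mul_nat m
      push_cast
      exact this
  · rw [parity, if_neg hχ.not_even] at h
    obtain ⟨m, rfl⟩ : ∃ m : ℕ, n = -(2 * m : ℕ) - 1 := by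
      have := h.dvd
      exact ⟨((-n - 1) / 2).toNat, by omega⟩
    have := hχ.LFunction_neg_two_mul_nat_sub_one m
    push_cast
    exact this

variable {r₁ r₂ : ℕ} [NeZero r₁] [NeZero r₂] {s₁ s₂ : ℤ} {χ₁ : DirichletCharacter ℂ r₁}
  {χ₂ : DirichletCharacter ℂ r₂}

lemma pertTerm_eq_zero (hpar : s₁ + s₂ ≡ parity χ₁ + parity χ₂ + 1 [ZMOD 2]) {k : ℕ}
    (hk : pertLength s₁ s₂ ≤ k) (τ : ℂ) : pertTerm s₁ s₂ χ₁ χ₂ τ k = 0 := by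
  rw [pertLength] at hk
  have hd := hpar.dvd
  rw [pertTerm, if_neg (by omega), if_neg (by omega)]
  -- The two differences add up to κ₁ + κ₂ + 1 modulo 2, so one of the factors has the parity of a
  -- trivial zero; beyond `pertLength` both arguments are negative.
  have h : s₁ - k ≡ parity χ₁ [ZMOD 2] ∨ s₂ - k ≡ parity χ₂ [ZMOD 2] := by
    rw [Int.modEq_iff_dvd, Int.modEq_iff_dvd]
    omega
  rcases h with h | h
  · rw [LFunction_intCast_eq_zero χ₁ (by omega) h (Or.inl (by omega)), zero_mul, mul_zero]
  · rw [LFunction_intCast_eq_zero χ₂ (by omega) h (Or.inl (by omega)), mul_zero, mul_zero]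

/-- `f` is given by a Laurent polynomial on the upper half-plane. -/
def IsLaurent (f : ℂ → ℂ) : Prop :=
  ∃ P : ℤ →₀ ℂ, ∀ τ : ℂ, 0 < τ.im → f τ = P.sum fun j c => c * τ ^ j

lemma isLaurent_zero : IsLaurent fun _ => 0 := ⟨0, fun τ _ => by simp⟩

lemma isLaurent_monomial (c : ℂ) (j : ℤ) : IsLaurent fun τ => c * τ ^ j :=
  ⟨Finsupp.single j c, fun τ _ => by simp⟩

lemma IsLaurent.add {f g : ℂ → ℂ} (hf : IsLaurent f) (hg : IsLaurent g) :
    IsLaurent fun τ => f τ + g τ := by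
  obtain ⟨P, hP⟩ := hf
  obtain ⟨Q, hQ⟩ := hg
  refine ⟨P + Q, fun τ hτ => ?_⟩
  beta_reduce
  rw [hP τ hτ, hQ τ hτ, Finsupp.sum_add_index' (by simp) fun _ _ _ => by ring]

lemma IsLaurent.congr {f g : ℂ → ℂ} (hf : IsLaurent f) (h : ∀ τ, f τ = g τ) : IsLaurent g := by
  rwa [← funext h]

/-- A Laurent polynomial plus a multiple of `log (-2 π i τ)`; if `p` holds there is no logarithm. -/
def IsLogLaurent (p : Prop) (f : ℂ → ℂ) : Prop :=
  ∃ g h : ℂ → ℂ, IsLaurent g ∧ IsLaurent h ∧ (p → ∀ τ, h τ = 0) ∧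
    ∀ τ, f τ = g τ + h τ * log (-2 * π * I * τ)

lemma IsLaurent.isLogLaurent {p : Prop} {f : ℂ → ℂ} (hf : IsLaurent f) : IsLogLaurent p f :=
  ⟨f, _, hf, isLaurent_zero, fun _ _ => rfl, fun τ => by ring⟩

lemma IsLogLaurent.add {p : Prop} {f₁ f₂ : ℂ → ℂ} (h₁ : IsLogLaurent p f₁)
    (h₂ : IsLogLaurent p f₂) : IsLogLaurent p fun τ => f₁ τ + f₂ τ := by
  obtain ⟨g₁, k₁, a₁, b₁, c₁, d₁⟩ := h₁
  obtain ⟨g₂, k₂, a₂, b₂, c₂, d₂⟩ := h₂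
  exact ⟨_, _, a₁.add a₂, b₁.add b₂, fun hp τ => by rw [c₁ hp, c₂ hp, add_zero],
    fun τ => by beta_reduce; rw [d₁, d₂]; ring⟩

lemma IsLogLaurent.sum {p : Prop} {ι : Type*} (S : Finset ι) {f : ι → ℂ → ℂ}
    (h : ∀ i ∈ S, IsLogLaurent p (f i)) : IsLogLaurent p fun τ => ∑ i ∈ S, f i τ := by
  classical
  induction S using Finset.induction_on with
  | empty => simpa using isLaurent_zero.isLogLaurent
  | insert i S hi ih =>
    simp only [Finset.sum_insert hi]
    exact (h i (Finset.mem_insert_self _ _)).add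
      (ih fun j hj => h j (Finset.mem_insert_of_mem hj))

lemma IsLogLaurent.exists_finsupp {p : Prop} {f : ℂ → ℂ} (hf : IsLogLaurent p f) :
    ∃ P Q : ℤ →₀ ℂ, (∀ τ : ℂ, 0 < τ.im → f τ =
      (P.sum fun j c => c * τ ^ j) + (Q.sum fun j c => c * τ ^ j) * log (-2 * π * I * τ)) ∧
      (p → Q = 0) := by
  obtain ⟨g, h, ⟨P, hP⟩, ⟨Q, hQ⟩, h0, hfgh⟩ := hf
  by_cases hp : p
  · refine ⟨P, 0, fun τ hτ => ?_, fun _ => rfl⟩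
    rw [hfgh, hP τ hτ, h0 hp]
    simp
  · exact ⟨P, Q, fun τ hτ => by rw [hfgh, hP τ hτ, hQ τ hτ], fun h => absurd h hp⟩

lemma isLaurent_isolatedTerm (r : ℕ) {r' : ℕ} [NeZero r'] (s s' : ℤ)
    (χ : DirichletCharacter ℂ r') : IsLaurent (isolatedTerm r s s' χ) := by
  by_cases h : r = 1 ∧ s' ≤ 0
  · refine (isLaurent_monomial ((-2 * π * I) ^ (s' - 1) * Complex.Gamma (1 - s') *
      χ.LFunction ((s + 1 - s' : ℤ) : ℂ)) (s' - 1)).congr fun τ => ?_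
    rw [isolatedTerm, if_pos h, mul_zpow _ τ]
    ring
  · exact isLaurent_zero.congr fun τ => by rw [isolatedTerm, if_neg h]

lemma isLaurent_pow (c : ℂ) (k : ℕ) : IsLaurent fun τ => (2 * π * I * τ) ^ k / (k ! : ℂ) * c :=
  (isLaurent_monomial ((2 * π * I) ^ k / (k ! : ℂ) * c) k).congr fun τ => by
    rw [mul_pow _ τ, zpow_natCast]; ring

lemma isLogLaurent_doublePoleTerm {r : ℕ} [NeZero r] {p : Prop} {s : ℤ}
    {χ : DirichletCharacter ℂ r} {k : ℕ} (h : p → χ.LFunction ((s - k : ℤ) : ℂ) = 0) :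
    IsLogLaurent p fun τ => doublePoleTerm s χ τ k := by
  refine ⟨_, _, isLaurent_pow (deriv χ.LFunction ((s - k : ℤ) : ℂ) +
    ((Real.eulerMascheroniConstant : ℂ) + digamma ((k : ℂ) + 1)) *
      χ.LFunction ((s - k : ℤ) : ℂ)) k, isLaurent_pow (-χ.LFunction ((s - k : ℤ) : ℂ)) k,
    fun hp τ => by rw [h hp]; simp, fun τ => ?_⟩
  beta_reduce
  rw [doublePoleTerm]
  ring

/-- A logarithm comes only from a double pole, with coefficient L(χ, s-k) for the other character.
If that s is nonpositive, the parity condition puts s-k at a trivial zero, except possibly when both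
characters are trivial. -/
lemma isLogLaurent_XiPert (hpar : s₁ + s₂ ≡ parity χ₁ + parity χ₂ + 1 [ZMOD 2]) :
    IsLogLaurent ((r₁ ≠ 1 ∧ r₂ ≠ 1) ∨ ((s₁ ≤ 0 ∨ s₂ ≤ 0) ∧ (r₁ ≠ 1 ∨ r₂ ≠ 1)))
      (XiPert s₁ s₂ χ₁ χ₂) := by
  have hpar1 : ∀ {r : ℕ} (χ : DirichletCharacter ℂ r), r = 1 → parity χ = 0 := by
    rintro r χ rfl; exact parity_of_level_one χ
  have hd := hpar.dvd
  refine ((isLaurent_isolatedTerm _ _ _ _).isLogLaurent.add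
    (isLaurent_isolatedTerm _ _ _ _).isLogLaurent).add (IsLogLaurent.sum _ fun k _ => ?_)
  unfold pertTerm
  split_ifs with h₂ h₁
  · refine isLogLaurent_doublePoleTerm fun h => ?_
    have := hpar1 χ₂ h₂.1
    refine LFunction_intCast_eq_zero χ₁ (by omega) ?_ (by omega)
    rw [Int.modEq_iff_dvd]
    omega
  · refine isLogLaurent_doublePoleTerm fun h => ?_
    have := hpar1 χ₁ h₁.1
    refine LFunction_intCast_eq_zero χ₂ (by omega) ?_ (by omega)
    rw [Int.modEq_iff_dvd]
    omega
  · exact (isLaurent_pow _ k).isLogLaurent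

end Perturbative

/-! ### Special cases -/

section SpecialCases

variable {r₁ r₂ : ℕ} [NeZero r₁] [NeZero r₂] {χ₁ : DirichletCharacter ℂ r₁}
  {χ₂ : DirichletCharacter ℂ r₂}

lemma blockTriangular_frickeMatrix (m : ℕ) (τ : ℂ) :
    (frickeMatrix m χ₁ χ₂ τ).BlockTriangular id := by
  intro a b hab
  have hab' : b < a := hab
  rw [frickeMatrix, Matrix.of_apply, if_neg (not_le.2 hab')]

/-- Moving from row index a to column a+n raises both parameters by n, so row a lists consecutive
transseries terms. There are m-1-a = |s₂|+1 of them, exactly those before the series terminates. -/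
lemma frickeMatrix_mulVec {m : ℕ} (a : Fin (m - 1)) (τ : ℂ) :
    (frickeMatrix m χ₁ χ₂ τ *ᵥ fun b : Fin (m - 1) =>
      Xi ((b : ℤ) + 1) ((b : ℤ) + 2 - m) (star χ₂) (star χ₁) (fricke (r₁ * r₂) τ)) a =
    ∑ n ∈ Finset.range (m - 1 - a), npTerm ((a : ℤ) + 1) ((a : ℤ) + 2 - m) χ₁ χ₂ τ n := by
  have hF : ∀ b : Fin (m - 1), frickeMatrix m χ₁ χ₂ τ a b *
      Xi ((b : ℤ) + 1) ((b : ℤ) + 2 - m) (star χ₂) (star χ₁) (fricke (r₁ * r₂) τ) =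
      if (a : ℕ) ≤ b then npTerm ((a : ℤ) + 1) ((a : ℤ) + 2 - m) χ₁ χ₂ τ (b - a) else 0 := by
    intro b
    rw [frickeMatrix, Matrix.of_apply]
    by_cases h : (a : ℕ) ≤ b
    · rw [if_pos (Fin.le_def.2 h), if_pos h, npTerm]
      congr 2 <;> push_cast [h] <;> ring
    · rw [if_neg (fun h' => h (Fin.le_def.1 h')), if_neg h, zero_mul]
  simp only [Matrix.mulVec, dotProduct, hF]
  rw [Fin.sum_univ_eq_sum_range (fun b : ℕ => if (a : ℕ) ≤ b then
    npTerm ((a : ℤ) + 1) ((a : ℤ) + 2 - m) χ₁ χ₂ τ (b - a) else 0) (m - 1), ← Finset.sum_filter]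
  symm
  refine Finset.sum_bij (fun n _ => n + a) (fun n hn => ?_) (fun _ _ _ _ h => by simpa using h)
    (fun b hb => ?_) (fun n _ => by rw [Nat.add_sub_cancel])
  · rw [Finset.mem_range] at hn
    rw [Finset.mem_filter, Finset.mem_range]
    omega
  · rw [Finset.mem_filter, Finset.mem_range] at hb
    exact ⟨b - a, by rw [Finset.mem_range]; omega, by omega⟩

lemma Xi_eq_XiPert_add_frickeMatrix (h₁ : χ₁.IsPrimitive) (h₂ : χ₂.IsPrimitive) {m : ℕ}
    (hm : (m : ℤ) ≡ parity χ₁ + parity χ₂ [ZMOD 2]) {τ : ℂ} (hτ : 0 < τ.im) :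
    (fun a : Fin (m - 1) => Xi ((a : ℤ) + 1) ((a : ℤ) + 2 - m) χ₁ χ₂ τ) =
      (fun a : Fin (m - 1) => XiPert ((a : ℤ) + 1) ((a : ℤ) + 2 - m) χ₁ χ₂ τ) +
      frickeMatrix m χ₁ χ₂ τ *ᵥ fun b : Fin (m - 1) =>
        Xi ((b : ℤ) + 1) ((b : ℤ) + 2 - m) (star χ₂) (star χ₁) (fricke (r₁ * r₂) τ) := by
  ext a
  have ha := a.2
  have hd := hm.dvd
  rw [Pi.add_apply, frickeMatrix_mulVec, Xi_eq_of_right_nonpos h₁ h₂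
    (Int.modEq_iff_dvd.2 (by omega)) (by omega) hτ]
  congr 3
  omega

lemma natCast_cpow_eq_mul_zpow {r : ℕ} [NeZero r] {a b : ℂ} {n : ℤ} (h : a = b + n) :
    (r : ℂ) ^ a = (r : ℂ) ^ b * (r : ℂ) ^ n := by
  rw [h, cpow_add _ _ (NeZero.ne _), cpow_intCast]

lemma Xi_weight_three (h₁ : χ₁.IsPrimitive) (h₂ : χ₂.IsPrimitive)
    (hκ : parity χ₁ + parity χ₂ = 1) {τ : ℂ} (hτ : 0 < τ.im) :
    ![Xi 1 (-1) χ₁ χ₂ τ, Xi 2 0 χ₁ χ₂ τ] =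
      ![XiPert 1 (-1) χ₁ χ₂ τ, XiPert 2 0 χ₁ χ₂ τ] +
      (I * χ₁.rootNumber * χ₂.rootNumber * (r₁ : ℂ) ^ (-(3 : ℂ) / 2) * (r₂ : ℂ) ^ ((1 : ℂ) / 2)) •
        (!![τ⁻¹, (r₁ : ℂ) * r₂ / (2 * π * I); 0, (r₁ : ℂ) * r₂ * τ] *ᵥ
          ![Xi 1 (-1) (star χ₂) (star χ₁) (fricke (r₁ * r₂) τ),
            Xi 2 0 (star χ₂) (star χ₁) (fricke (r₁ * r₂) τ)]) := by
  have hκ' : (parity χ₁ : ℤ) + parity χ₂ = 1 := by exact_mod_cast hκ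
  have hτ0 : τ ≠ 0 := fun h => by simp [h] at hτ
  have n1 : (r₁ : ℂ) ≠ 0 := NeZero.ne _
  have n2 : (r₂ : ℂ) ≠ 0 := NeZero.ne _
  have hpi : (π : ℂ) ≠ 0 := ofReal_ne_zero.2 Real.pi_ne_zero
  have e1 := Xi_eq_of_right_nonpos (s₁ := 1) (s₂ := -1) h₁ h₂ (by rw [hκ']; decide) (by simp) hτ
  have e2 := Xi_eq_of_right_nonpos (s₁ := 2) (s₂ := 0) h₁ h₂ (by rw [hκ']; decide) (by simp) hτ
  -- For (1, -1) the powers are r₁^{-1/2} r₂^{3/2}; relative to the common factor with r₁^{-3/2}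
  -- r₂^{1/2} a factor r₁r₂ is left over.
  have c1 : frickeConst 1 (-1) χ₁ χ₂ = (I * χ₁.rootNumber * χ₂.rootNumber *
      (r₁ : ℂ) ^ (-(3 : ℂ) / 2) * (r₂ : ℂ) ^ ((1 : ℂ) / 2)) * (r₁ * r₂) := by
    rw [frickeConst, hκ, natCast_cpow_eq_mul_zpow (b := -(3 : ℂ) / 2) (n := 1) (by push_cast; ring),
      natCast_cpow_eq_mul_zpow (a := (1 : ℂ) / 2 - ((-1 : ℤ) : ℂ)) (b := (1 : ℂ) / 2) (n := 1)
        (by push_cast; ring)]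
    simp only [zpow_one, pow_one]
    ring
  have c2 : frickeConst 2 0 χ₁ χ₂ = I * χ₁.rootNumber * χ₂.rootNumber *
      (r₁ : ℂ) ^ (-(3 : ℂ) / 2) * (r₂ : ℂ) ^ ((1 : ℂ) / 2) := by
    rw [frickeConst, hκ, show (1 : ℂ) / 2 - ((2 : ℤ) : ℂ) = -(3 : ℂ) / 2 by push_cast; ring,
      show (1 : ℂ) / 2 - ((0 : ℤ) : ℂ) = 1 / 2 by push_cast; ring]
    ring
  set A := I * χ₁.rootNumber * χ₂.rootNumber * (r₁ : ℂ) ^ (-(3 : ℂ) / 2) *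
    (r₂ : ℂ) ^ ((1 : ℂ) / 2) with hA
  ext i
  fin_cases i
  · simp only [Fin.zero_eta, Matrix.cons_val_zero, Pi.add_apply, Pi.smul_apply, smul_eq_mul,
      Matrix.mulVec, dotProduct, Fin.sum_univ_two, Matrix.of_apply, Matrix.cons_val_one]
    rw [e1]
    simp only [neg_neg, Int.toNat_one, Finset.sum_range_succ, Finset.sum_range_zero, zero_add,
      npTerm, frickeCoeff, c1]
    simp
    field_simp
    linear_combination (-(A * r₁ * r₂ * τ * Xi 2 0 (star χ₂) (star χ₁) (fricke (r₁ * r₂) τ))) *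
      I_mul_I
  · simp only [Fin.mk_one, Matrix.cons_val_zero, Pi.add_apply, Pi.smul_apply, smul_eq_mul,
      Matrix.mulVec, dotProduct, Fin.sum_univ_two, Matrix.of_apply, Matrix.cons_val_one]
    rw [e2]
    simp [npTerm, frickeCoeff, c2]
    ring

lemma isPrimitive_one_level_one : (1 : DirichletCharacter ℂ 1).IsPrimitive :=
  DirichletCharacter.isPrimitive_one_level_one

variable {r : ℕ} [NeZero r] {χ : DirichletCharacter ℂ r}

/-- With a parameter equal to 0 only this term survives. `Xi_swap` restores the nontrivial character
to first place, so each Lambert series is sent to the other kind. -/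
lemma npTerm_level_one_zero (s₁ s₂ : ℤ) (τ : ℂ) :
    npTerm s₁ s₂ χ (1 : DirichletCharacter ℂ 1) τ 0 =
      (r : ℂ) ^ ((1 : ℂ) / 2 - s₁) * χ.rootNumber * I ^ parity χ * ((r : ℂ) * τ) ^ (s₁ + s₂ - 1) *
        Xi s₂ s₁ (star χ) (1 : DirichletCharacter ℂ 1) (fricke r τ) := by
  rw [npTerm, frickeCoeff, frickeConst, Xi_swap, DirichletCharacter.rootNumber_modOne,
    parity_of_level_one]
  simp [star_one]

lemma neg_two_pi_I_zpow_neg_one (τ : ℂ) : (-2 * π * I * τ) ^ (-1 : ℤ) = -(2 * π * I * τ)⁻¹ := by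
  rw [zpow_neg_one, show -2 * π * I * τ = -(2 * π * I * τ) by ring, inv_neg]

lemma lambert_eq (hχ : χ.IsPrimitive) (hr : r ≠ 1) {m : ℕ} (hm : 1 ≤ m)
    (hpar : m ≡ parity χ [MOD 2]) {τ : ℂ} (hτ : 0 < τ.im) :
    lambert (m - 1) χ τ =
      -(2 * π * I * τ)⁻¹ * χ.LFunction m +
      (∑ k ∈ Finset.range (m + parity χ - 1), (2 * π * I * τ) ^ k / (k ! : ℂ) *
        riemannZeta (-k) * χ.LFunction (m - k - 1)) +
      I ^ parity χ * (χ.rootNumber / (r : ℂ) ^ ((1 : ℂ) / 2)) * τ ^ ((m : ℤ) - 2) *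
        lambertTilde (m - 1) (star χ) (fricke r τ) := by
  have hd := (Nat.modEq_iff_dvd.1 hpar)
  have hκ : parity χ = 0 ∨ parity χ = 1 := by rw [parity]; split_ifs <;> simp
  rw [lambert, Xi_eq_of_right_nonpos hχ isPrimitive_one_level_one
    (by rw [parity_of_level_one, Int.modEq_iff_dvd]; push_cast; omega) le_rfl hτ]
  congr 1
  · have hlen : pertLength ((m : ℤ) - 1) 0 = m := by rw [pertLength]; omega
    rw [XiPert, hlen, isolatedTerm_eq_zero_of_ne_one hr, add_zero, isolatedTerm,
      if_pos ⟨rfl, le_rfl⟩]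
    congr 1
    · rw [zero_sub, neg_two_pi_I_zpow_neg_one]
      simp
    · have hterm : ∀ k : ℕ, pertTerm ((m : ℤ) - 1) 0 χ (1 : DirichletCharacter ℂ 1) τ k =
          (2 * π * I * τ) ^ k / (k ! : ℂ) * riemannZeta (-k) * χ.LFunction (m - k - 1) := by
        intro k
        rw [pertTerm, if_neg (by omega), if_neg (fun h => hr h.1),
          DirichletCharacter.LFunction_modOne_eq]
        push_cast
        rw [zero_sub, show (m : ℂ) - 1 - k = m - k - 1 by ring]
        ring
      simp only [hterm]
      -- For even χ the last term k = m-1 contains L(χ, 0) = 0, whence the range m + κ - 1.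
      rcases hκ with h | h
      · obtain ⟨n, rfl⟩ : ∃ n, m = n + 1 := ⟨m - 1, by omega⟩
        have h0 := LFunction_intCast_eq_zero χ (n := 0) le_rfl (by rw [h]; rfl) (Or.inr hr)
        rw [h, add_zero, Nat.add_sub_cancel, Finset.sum_range_succ,
          show (((n + 1 : ℕ) : ℂ) - n - 1) = ((0 : ℤ) : ℂ) by push_cast; ring, h0, mul_zero,
          add_zero]
      · rw [h, Nat.add_sub_cancel]
  · have hpow : (r : ℂ) ^ ((1 : ℂ) / 2 - ((m - 1 : ℤ) : ℂ)) * (r : ℂ) ^ ((m : ℤ) - 2) =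
        ((r : ℂ) ^ ((1 : ℂ) / 2))⁻¹ := by
      rw [← cpow_neg, ← natCast_cpow_eq_mul_zpow]
      push_cast
      ring
    simp only [neg_zero, Int.toNat_zero, zero_add, Finset.sum_range_one]
    rw [npTerm_level_one_zero, lambertTilde, show (m : ℤ) - 1 + 0 - 1 = m - 2 by ring, mul_zpow,
      div_eq_mul_inv (DirichletCharacter.rootNumber χ), ← hpow]
    ring

lemma lambertTilde_eq (hχ : χ.IsPrimitive) (hr : r ≠ 1) {m : ℕ} (hm : 1 ≤ m)
    (hpar : m ≡ parity χ [MOD 2]) {τ : ℂ} (hτ : 0 < τ.im) :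
    lambertTilde (m - 1) χ τ =
      (if m = 1 then -(2 * π * I * τ)⁻¹ * χ.LFunction 1
        else (deriv χ.LFunction (2 - m) +
          ((Real.eulerMascheroniConstant : ℂ) + digamma (m - 1) - log (-2 * π * I * τ)) *
            χ.LFunction (2 - m)) * ((2 * π * I * τ) ^ (m - 2) / ((m - 2)! : ℂ))) +
      (∑ k ∈ (Finset.range (m + parity χ)).filter (fun k : ℕ => (k : ℤ) ≠ m - 2),
        (2 * π * I * τ) ^ k / (k ! : ℂ) * riemannZeta (m - k - 1) * χ.LFunction (-k)) +
      I ^ parity χ * χ.rootNumber * (r : ℂ) ^ ((1 : ℂ) / 2) *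
        ((r : ℂ) * τ) ^ ((m : ℤ) - 2) * lambert (m - 1) (star χ) (fricke r τ) := by
  have hd := (Nat.modEq_iff_dvd.1 hpar)
  have hκ : parity χ = 0 ∨ parity χ = 1 := by rw [parity]; split_ifs <;> simp
  rw [lambertTilde, Xi_eq_of_left_nonpos hχ isPrimitive_one_level_one
    (by rw [parity_of_level_one, Int.modEq_iff_dvd]; push_cast; omega) le_rfl hτ]
  congr 1
  · have hlen : pertLength 0 ((m : ℤ) - 1) = m := by rw [pertLength]; omega
    rw [XiPert, hlen, isolatedTerm_eq_zero_of_ne_one hr, add_zero]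
    have hterm : ∀ k : ℕ, (k : ℤ) ≠ m - 2 →
        pertTerm 0 ((m : ℤ) - 1) χ (1 : DirichletCharacter ℂ 1) τ k =
          (2 * π * I * τ) ^ k / (k ! : ℂ) * riemannZeta (m - k - 1) * χ.LFunction (-k) := by
      intro k hk
      rw [pertTerm, if_neg (by omega), if_neg (fun h => hr h.1),
        DirichletCharacter.LFunction_modOne_eq]
      push_cast
      rw [zero_sub, show (m : ℂ) - 1 - k = m - k - 1 by ring]
      ring
    have hsum : ∑ k ∈ (Finset.range (m + parity χ)).filter (fun k : ℕ => (k : ℤ) ≠ m - 2),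
        (2 * π * I * τ) ^ k / (k ! : ℂ) * riemannZeta (m - k - 1) * χ.LFunction (-k) =
        ∑ k ∈ (Finset.range m).filter (fun k : ℕ => (k : ℤ) ≠ m - 2),
          pertTerm 0 ((m : ℤ) - 1) χ (1 : DirichletCharacter ℂ 1) τ k := by
      rw [Finset.sum_congr rfl fun k hk => hterm k (Finset.mem_filter.1 hk).2]
      -- For odd χ the range has an extra term k = m, which vanishes because m is odd and L(χ, -m)
      -- is a trivial zero.
      rcases hκ with h | h
      · rw [h, add_zero]
      · have h0 := LFunction_intCast_eq_zero χ (n := -m) (by omega)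
          (Int.modEq_iff_dvd.2 (by omega)) (Or.inr hr)
        rw [h, Finset.range_add_one, Finset.filter_insert, if_pos (by omega),
          Finset.sum_insert (by simp)]
        push_cast at h0
        rw [h0, mul_zero, zero_add]
    rw [hsum]
    -- The index m-2 is excluded as an integer. For m = 1 nothing is removed and the isolated
    -- monomial is present; for m ≥ 2 the removed index carries the double pole.
    by_cases hm1 : m = 1
    · subst hm1
      rw [if_pos rfl, isolatedTerm, if_pos ⟨rfl, by simp⟩]
      congr 1
      · simp only [Nat.cast_one, sub_self, zero_sub, neg_two_pi_I_zpow_neg_one]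
        simp
    · rw [if_neg hm1, isolatedTerm, if_neg (by omega), zero_add,
        ← Finset.sum_filter_add_sum_filter_not (Finset.range m) (fun k : ℕ => (k : ℤ) ≠ m - 2),
        add_comm]
      congr 1
      have hone : (Finset.range m).filter (fun k : ℕ => ¬ (k : ℤ) ≠ m - 2) = {m - 2} := by
        ext k
        simp only [Finset.mem_filter, Finset.mem_range, Finset.mem_singleton]
        omega
      have hcast : ((m - 2 : ℕ) : ℂ) = m - 2 := by
        rw [Nat.cast_sub (by omega)]; push_cast; rfl
      rw [hone, Finset.sum_singleton, pertTerm, if_pos ⟨rfl, by omega⟩, doublePoleTerm]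
      push_cast
      rw [hcast, zero_sub, neg_sub, show (m : ℂ) - 2 + 1 = m - 1 by ring, mul_comm]
  · simp only [neg_zero, Int.toNat_zero, zero_add, Finset.sum_range_one]
    rw [npTerm_level_one_zero, lambert, show (0 : ℤ) + (m - 1) - 1 = m - 2 by ring]
    push_cast
    rw [sub_zero]
    ring

end SpecialCases

end TwistedLambert

theorem mainTheorem1 {r₁ r₂ : ℕ} [NeZero r₁] [NeZero r₂]
    (χ₁ : DirichletCharacter ℂ r₁) (χ₂ : DirichletCharacter ℂ r₂)
    (h₁ : χ₁.IsPrimitive) (h₂ : χ₂.IsPrimitive) :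
    -- the transseries identity
    (∀ s₁ s₂ : ℤ, s₁ + s₂ ≡ parity χ₁ + parity χ₂ + 1 [ZMOD 2] →
      -- the perturbative expansion terminates
      (∀ k : ℕ, pertLength s₁ s₂ ≤ k → ∀ τ : ℂ, pertTerm s₁ s₂ χ₁ χ₂ τ k = 0) ∧
      -- it is a Laurent polynomial, possibly with a logarithm
      (∃ P Q : ℤ →₀ ℂ,
        (∀ τ : ℂ, 0 < τ.im → XiPert s₁ s₂ χ₁ χ₂ τ =
          (P.sum fun j c => c * τ ^ j) + (Q.sum fun j c => c * τ ^ j) * log (-2 * π * I * τ)) ∧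
        (r₁ ≠ 1 ∧ r₂ ≠ 1 → Q = 0) ∧
        ((s₁ ≤ 0 ∨ s₂ ≤ 0) ∧ (r₁ ≠ 1 ∨ r₂ ≠ 1) → Q = 0)) ∧
      (∀ τ : ℂ, 0 < τ.im → Summable (xiTerm s₁ s₂ χ₁ χ₂ τ)) ∧
      -- exact identity when the sum over `n` terminates
      (s₁ ≤ 0 → ∀ τ : ℂ, 0 < τ.im → Xi s₁ s₂ χ₁ χ₂ τ = XiPert s₁ s₂ χ₁ χ₂ τ +
        ∑ n ∈ Finset.range ((-s₁).toNat + 1), npTerm s₁ s₂ χ₁ χ₂ τ n) ∧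
      (s₂ ≤ 0 → ∀ τ : ℂ, 0 < τ.im → Xi s₁ s₂ χ₁ χ₂ τ = XiPert s₁ s₂ χ₁ χ₂ τ +
        ∑ n ∈ Finset.range ((-s₂).toNat + 1), npTerm s₁ s₂ χ₁ χ₂ τ n) ∧
      -- exact identity when it does not terminate, with the divergent sum over `n` Borel resummed
      (0 < s₁ → 0 < s₂ →
        (∀ z : ℂ, 0 < z.re → IntegrableOn (borelIntegrand s₁ s₂ z) (Set.Ioi 0)) ∧
        ∀ τ : ℂ, 0 < τ.im → HasSum (npResummedTerm s₁ s₂ χ₁ χ₂ τ)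
          (Xi s₁ s₂ χ₁ χ₂ τ - XiPert s₁ s₂ χ₁ χ₂ τ)) ∧
      -- the sum over `n` as an asymptotic expansion, for `τ = i y` and `y → 0⁺`
      (∀ N : ℕ, (fun y : ℝ => Xi s₁ s₂ χ₁ χ₂ (I * y) - XiPert s₁ s₂ χ₁ χ₂ (I * y) -
          ∑ n ∈ Finset.range N, npTerm s₁ s₂ χ₁ χ₂ (I * y) n) =O[𝓝[>] 0]
        fun y : ℝ => y ^ (s₁ + s₂ + N - 1) * Real.exp (-(2 * π) / (r₁ * r₂ * y)))) ∧
    -- the upper-triangular Fricke action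
    (∀ m : ℕ, 1 ≤ m → (m : ℤ) ≡ parity χ₁ + parity χ₂ [ZMOD 2] → ∀ τ : ℂ, 0 < τ.im →
      (frickeMatrix m χ₁ χ₂ τ).BlockTriangular id ∧
      (fun a : Fin (m - 1) => Xi ((a : ℤ) + 1) ((a : ℤ) + 2 - m) χ₁ χ₂ τ) =
        (fun a : Fin (m - 1) => XiPert ((a : ℤ) + 1) ((a : ℤ) + 2 - m) χ₁ χ₂ τ) +
        frickeMatrix m χ₁ χ₂ τ *ᵥ
          fun b : Fin (m - 1) => Xi ((b : ℤ) + 1) ((b : ℤ) + 2 - m) (star χ₂) (star χ₁)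
            (fricke (r₁ * r₂) τ)) ∧
    -- the example of weight `3`
    (parity χ₁ + parity χ₂ = 1 → ∀ τ : ℂ, 0 < τ.im →
      ![Xi 1 (-1) χ₁ χ₂ τ, Xi 2 0 χ₁ χ₂ τ] =
        ![XiPert 1 (-1) χ₁ χ₂ τ, XiPert 2 0 χ₁ χ₂ τ] +
        (I * χ₁.rootNumber * χ₂.rootNumber * (r₁ : ℂ) ^ (-(3 : ℂ) / 2) * (r₂ : ℂ) ^ ((1 : ℂ) / 2)) •
          (!![τ⁻¹, (r₁ : ℂ) * r₂ / (2 * π * I); 0, (r₁ : ℂ) * r₂ * τ] *ᵥ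
            ![Xi 1 (-1) (star χ₂) (star χ₁) (fricke (r₁ * r₂) τ),
              Xi 2 0 (star χ₂) (star χ₁) (fricke (r₁ * r₂) τ)])) ∧
    -- one nontrivial character and `s = m - 1`
    (r₁ ≠ 1 → ∀ m : ℕ, 1 ≤ m → m ≡ parity χ₁ [MOD 2] → ∀ τ : ℂ, 0 < τ.im →
      (lambert (m - 1) χ₁ τ =
        -(2 * π * I * τ)⁻¹ * χ₁.LFunction m +
        (∑ k ∈ Finset.range (m + parity χ₁ - 1), (2 * π * I * τ) ^ k / (k ! : ℂ) *
          riemannZeta (-k) * χ₁.LFunction (m - k - 1)) +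
        I ^ parity χ₁ * (χ₁.rootNumber / (r₁ : ℂ) ^ ((1 : ℂ) / 2)) * τ ^ ((m : ℤ) - 2) *
          lambertTilde (m - 1) (star χ₁) (fricke r₁ τ)) ∧
      (lambertTilde (m - 1) χ₁ τ =
        (if m = 1 then -(2 * π * I * τ)⁻¹ * χ₁.LFunction 1
          else (deriv χ₁.LFunction (2 - m) +
            ((Real.eulerMascheroniConstant : ℂ) + digamma (m - 1) - log (-2 * π * I * τ)) *
              χ₁.LFunction (2 - m)) * ((2 * π * I * τ) ^ (m - 2) / ((m - 2)! : ℂ))) +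
        (∑ k ∈ (Finset.range (m + parity χ₁)).filter (fun k : ℕ => (k : ℤ) ≠ m - 2),
          (2 * π * I * τ) ^ k / (k ! : ℂ) * riemannZeta (m - k - 1) * χ₁.LFunction (-k)) +
        I ^ parity χ₁ * χ₁.rootNumber * (r₁ : ℂ) ^ ((1 : ℂ) / 2) *
          ((r₁ : ℂ) * τ) ^ ((m : ℤ) - 2) * lambert (m - 1) (star χ₁) (fricke r₁ τ))) := by
  refine ⟨fun s₁ s₂ hpar => ⟨fun k hk τ => pertTerm_eq_zero hpar hk τ, ?_,
    fun τ hτ => summable_xiTerm s₁ s₂ χ₁ χ₂ hτ,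
    fun hs τ hτ => Xi_eq_of_left_nonpos h₁ h₂ hpar hs hτ,
    fun hs τ hτ => Xi_eq_of_right_nonpos h₁ h₂ hpar hs hτ,
    fun hs₁ hs₂ => ⟨fun z hz => integrableOn_borelIntegrand hs₁ hs₂ hz,
      fun τ hτ => hasSum_npResummedTerm h₁ h₂ hpar hs₁ hs₂ hτ⟩,
    fun N => isBigO_remainder h₁ h₂ hpar N⟩,
    fun m _ hm τ hτ => ⟨blockTriangular_frickeMatrix m τ,
      Xi_eq_XiPert_add_frickeMatrix h₁ h₂ hm hτ⟩,
    fun hκ τ hτ => Xi_weight_three h₁ h₂ hκ hτ,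
    fun hr m hm hpar τ hτ => ⟨lambert_eq h₁ hr hm hpar hτ, lambertTilde_eq h₁ hr hm hpar hτ⟩⟩
  obtain ⟨P, Q, hPQ, hQ⟩ := (isLogLaurent_XiPert hpar).exists_finsupp
  exact ⟨P, Q, hPQ, fun h => hQ (Or.inl h), fun h => hQ (Or.inr h)⟩
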